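/- Let $T$ be a finite tree in which every vertex has degree at most $3$. A \emph{greedy drawing} of $T$ is a map $V(T)\to\mathbb R^2$ such that for any two distinct vertices $s,t$ there is a neighbour $u$ of $s$ with $|ut|<|st|$ (Euclidean distances between the images). An \emph{irreducible triple} is a triple $(b_1,b_2,b_3)$ of vertices such that $\deg b_1=3$, $b_2\ne b_3$, $b_1b_2$ and $b_1b_3$ are edges (the branches), and removing either branch disconnects the graph. Two triples are \emph{independent} if they have no vertex in common and deleting all their branches leaves their first vertices connected. Let $n_3$ be the maximum number of pairwise independent irreducible triples of $T$. For $k\ge 0$ let $Q_k$ be the tree with root $b_0$ consisting of the path $b_0b_1\dots b_{k+2}$ together with one further leaf $c_i$ attached to $b_i$ for each $i=1,\dots,k+1$ (so $Q_0=K_{1,3}$). A \emph{five-crab} with attached caterpillars $Q_{k_1},\dots,Q_{k_5}$ is obtained, for some $\ell,m\ge 0$, from a path $p_0p_1\dots p_\ell\, e_0\, r_m\dots r_1r_0$ by attaching one leaf $q_i$ to each $p_i$ ($1\le i\le\ell$) and one leaf $s_i$ to each $r_i$ ($1\le i\le m$), and attaching disjoint copies of $Q_{k_1},Q_{k_2}$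 by identifying their roots with $p_0$, of $Q_{k_3},Q_{k_4}$ by identifying their roots with $r_0$, and of $Q_{k_5}$ by identifying its root with $e_0$. Given a subdivision of a five-crab in $T$, let $T_i$ $(1\le i\le 5)$ be the subtree of $T$ rooted at $r$ that consists of the edge $rv$ and the component of $T-rv$ containing $v$, where $r$ is the vertex to which the $i$-th caterpillar is attached and $v$ is the neighbour of $r$ in the direction of that caterpillar. Then $T$ has a greedy drawing in $\mathbb R^2$ if and only if one of the following holds: 1. $n_3\le 4$; or 2. $n_3=5$ and $T$ contains a subdivision of a five-crab such that the rooted subtrees $T_1,\dots,T_5$ of $T$ are subdivisions of $Q_{k_1},\dots,Q_{k_5}$, where the multiset $\{k_1,\dots,k_5\}$ is $\{0,0,0,x_1,x_2\}$ or $\{0,0,1,1,x_1\}$ for some integers $x_1,x_2\ge 0$. Equivalently, $T$ has a greedy drawing if and only if $n_3\le 5$ and $T$ contains, as a subgraph, neither a subdivision of a five-crab with four attached $Q_1$'s (and one $Q_0$) nor a subdivision of a five-crab with two attached $Q_2$'s and one $Q_1$ (and two $Q_0$'s). -/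

import Mathlib

namespace GreedyTree

/-- A straight-line drawing in the Euclidean plane is given by the positions of the vertices.
It is greedy if for every two distinct vertices `s`, `t` some neighbour of `s` is strictly closer
to `t` than `s` is. -/
def IsGreedyDrawing {V : Type*} (G : SimpleGraph V) (pos : V → EuclideanSpace ℝ (Fin 2)) : Prop :=
  ∀ s t : V, s ≠ t → ∃ u : V, G.Adj s u ∧ dist (pos u) (pos t) < dist (pos s) (pos t)

/-- `G` has a greedy drawing in the Euclidean plane. -/
def HasGreedyDrawing {V : Type*} (G : SimpleGraph V) : Prop :=
  ∃ pos : V → EuclideanSpace ℝ (Fin 2), IsGreedyDrawing G pos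

/-- The three nodes of a triple. -/
def tripleNodes {V : Type*} (b : V × V × V) : Set V := {b.1, b.2.1, b.2.2}

/-- The two branches `b₁b₂` and `b₁b₃` of a triple. -/
def tripleBranches {V : Type*} (b : V × V × V) : Set (Sym2 V) := {s(b.1, b.2.1), s(b.1, b.2.2)}

/-- `(b₁, b₂, b₃)` is an irreducible triple: `b₁` has degree 3, `b₁b₂` and `b₁b₃` are two
edges (the branches), and removing any one of the branches disconnects the graph. -/
def IsIrreducibleTriple {V : Type*} (G : SimpleGraph V) (b : V × V × V) : Prop :=
  (G.neighborSet b.1).ncard = 3 ∧ b.2.1 ≠ b.2.2 ∧ G.Adj b.1 b.2.1 ∧ G.Adj b.1 b.2.2 ∧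
    ∀ e ∈ tripleBranches b, ¬ (G.deleteEdges {e}).Connected

/-- Two triples are independent if they have no node in common and deleting all the branches of
both keeps their first nodes connected. -/
def IndependentTriples {V : Type*} (G : SimpleGraph V) (b x : V × V × V) : Prop :=
  Disjoint (tripleNodes b) (tripleNodes x) ∧
    (G.deleteEdges (tripleBranches b ∪ tripleBranches x)).Reachable b.1 x.1

/-- A set of pairwise independent irreducible triples. -/
def IsIndependentFamily {V : Type*} (G : SimpleGraph V) (S : Finset (V × V × V)) : Prop :=
  (∀ b ∈ S, IsIrreducibleTriple G b) ∧
    ∀ b ∈ S, ∀ x ∈ S, b ≠ x → IndependentTriples G b x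

open Classical in
/-- The maximum number `n₃` of pairwise independent irreducible triples of a finite graph. -/
noncomputable def tripleNumber {V : Type*} [Fintype V] (G : SimpleGraph V) : ℕ :=
  ((Finset.univ : Finset (Finset (V × V × V))).filter (IsIndependentFamily G)).sup Finset.card

/-- A realization of a subdivision of `H` inside `G`: the vertices of `H` are mapped injectively
to vertices of `G`, and the edges of `H` to paths of `G` between the images of their ends, such
that the paths contain no images of other vertices and are internally disjoint. -/
structure SubdivisionIn {W V : Type*} (H : SimpleGraph W) (G : SimpleGraph V) where
  node : W → V
  node_injective : Function.Injective node
  path : ∀ {a b : W}, H.Adj a b → G.Walk (node a) (node b)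
  isPath : ∀ {a b : W} (h : H.Adj a b), (path h).IsPath
  path_symm : ∀ {a b : W} (h : H.Adj a b), path h.symm = (path h).reverse
  node_mem : ∀ {a b : W} (h : H.Adj a b) (c : W), node c ∈ (path h).support → c = a ∨ c = b
  disjoint : ∀ {a b c d : W} (h : H.Adj a b) (h' : H.Adj c d), s(a, b) ≠ s(c, d) →
    ∀ v : V, v ∈ (path h).support → v ∈ (path h').support → ∃ x : W, node x = v

/-- The realized subdivision is all of `G`. -/
def SubdivisionIn.Spanning {W V : Type*} {H : SimpleGraph W} {G : SimpleGraph V}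
    (f : SubdivisionIn H G) : Prop :=
  (∀ v : V, (∃ a : W, f.node a = v) ∨ ∃ (a b : W) (h : H.Adj a b), v ∈ (f.path h).support) ∧
    ∀ e ∈ G.edgeSet, ∃ (a b : W) (h : H.Adj a b), e ∈ (f.path h).edges

/-- `G` contains a subdivision of `H` (as a subgraph). -/
def ContainsSubdivision {W V : Type*} (G : SimpleGraph V) (H : SimpleGraph W) : Prop :=
  Nonempty (SubdivisionIn H G)

/-- `G` with root `r` is a subdivision of `H` with root `ρ`. -/
def IsRootedSubdivision {W V : Type*} (G : SimpleGraph V) (r : V) (H : SimpleGraph W) (ρ : W) :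
    Prop :=
  ∃ f : SubdivisionIn H G, f.node ρ = r ∧ f.Spanning

/-- Vertices of the caterpillar `Q_k`: `b 0, …, b (k+2)`, and `c 0, …, c k`, where `c j` stands
for the leaf usually called `c_{j+1}`. -/
inductive QVertex (k : ℕ) : Type
  | b (j : Fin (k + 3)) : QVertex k
  | c (j : Fin (k + 1)) : QVertex k

/-- Edges of `Q_k`: `b_j b_{j+1}` for `0 ≤ j ≤ k+1`, and `b_j c_j` for `1 ≤ j ≤ k+1`. -/
inductive QEdge (k : ℕ) : QVertex k → QVertex k → Prop
  | spine (j : Fin (k + 2)) : QEdge k (.b j.castSucc) (.b j.succ)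
  | pendant (j : Fin (k + 1)) : QEdge k (.b j.succ.castSucc) (.c j)

/-- The caterpillar `Q_k`; its root is `QVertex.b 0`. -/
def caterpillar (k : ℕ) : SimpleGraph (QVertex k) := SimpleGraph.fromRel (QEdge k)

/-- Vertices of a five-crab with `l` and `m` pendant edges on the two arms of its body and with
attached caterpillars of orders `k 0, …, k 4`. On the left arm, `left 0` is the node carrying the
first two caterpillars and `left i`, `leftLeaf i` for `i ≥ 1` are the ends of the `i`-th pendant
edge (`leftLeaf` is indexed from 0); similarly on the right arm. The node `centre` carries the
fifth caterpillar. The vertices `leg i j` and `legLeaf i j` are the vertices `b_{j+1}` and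
`c_{j+1}` of the `i`-th caterpillar; its root `b_0` is the node that carries it. -/
inductive CrabVertex (l m : ℕ) (k : Fin 5 → ℕ) : Type
  | centre : CrabVertex l m k
  | left (i : Fin (l + 1)) : CrabVertex l m k
  | leftLeaf (i : Fin l) : CrabVertex l m k
  | right (i : Fin (m + 1)) : CrabVertex l m k
  | rightLeaf (i : Fin m) : CrabVertex l m k
  | leg (i : Fin 5) (j : Fin (k i + 2)) : CrabVertex l m k
  | legLeaf (i : Fin 5) (j : Fin (k i + 1)) : CrabVertex l m k

/-- The node of the five-crab that is the root of the `i`-th attached caterpillar. -/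
def hub (l m : ℕ) (k : Fin 5 → ℕ) (i : Fin 5) : CrabVertex l m k :=
  if i = 0 ∨ i = 1 then .left 0 else if i = 2 ∨ i = 3 then .right 0 else .centre

/-- Edges of the five-crab. -/
inductive CrabEdge (l m : ℕ) (k : Fin 5 → ℕ) : CrabVertex l m k → CrabVertex l m k → Prop
  | left (i : Fin l) : CrabEdge l m k (.left i.castSucc) (.left i.succ)
  | leftPendant (i : Fin l) : CrabEdge l m k (.left i.succ) (.leftLeaf i)
  | leftCentre : CrabEdge l m k (.left (Fin.last l)) .centre
  | right (i : Fin m) : CrabEdge l m k (.right i.castSucc) (.right i.succ)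
  | rightPendant (i : Fin m) : CrabEdge l m k (.right i.succ) (.rightLeaf i)
  | rightCentre : CrabEdge l m k (.right (Fin.last m)) .centre
  | root (i : Fin 5) : CrabEdge l m k (hub l m k i) (.leg i 0)
  | leg (i : Fin 5) (j : Fin (k i + 1)) : CrabEdge l m k (.leg i j.castSucc) (.leg i j.succ)
  | legPendant (i : Fin 5) (j : Fin (k i + 1)) :
      CrabEdge l m k (.leg i j.castSucc) (.legLeaf i j)

/-- The five-crab with `l` and `m` pendant edges on its arms and attached caterpillars
`Q_{k 0}, …, Q_{k 4}`. -/
def fiveCrab (l m : ℕ) (k : Fin 5 → ℕ) : SimpleGraph (CrabVertex l m k) :=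
  SimpleGraph.fromRel (CrabEdge l m k)

theorem hub_adj (l m : ℕ) (k : Fin 5 → ℕ) (i : Fin 5) :
    (fiveCrab l m k).Adj (hub l m k i) (.leg i 0) := by
  refine (SimpleGraph.fromRel_adj _ _ _).2 ⟨?_, Or.inl (.root i)⟩
  unfold hub
  split_ifs <;> simp

/-- The vertex set of the rooted subtree `T_{rv}^v + rv` of a tree `T`: the root `r` and the
component of `v` after removing the edge `rv`. -/
def branchSet {V : Type*} (T : SimpleGraph V) (r v : V) : Set V :=
  {w | w = r ∨ (T.deleteEdges {s(r, v)}).Reachable v w}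

/-- The rooted subtree `T_{rv}^v + rv` of `T`, with root `r`, is a subdivision of `Q_k`
(it has order `k`). -/
def BranchHasOrder {V : Type*} (T : SimpleGraph V) (r v : V) (k : ℕ) : Prop :=
  IsRootedSubdivision (T.induce (branchSet T r v)) ⟨r, Or.inl rfl⟩ (caterpillar k) (.b 0)

/-- `T` contains a subdivision of a five-crab such that the five subtrees `T_1, …, T_5` of `T`
are subdivisions of caterpillars `Q_{x 0}, …, Q_{x 4}`. Here `T_i = T_{rv}^v + rv`, where `r` is
the node at which the `i`-th leg of the crab is attached and `v` is the neighbour of `r` on this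
leg. -/
def ContainsFiveCrabOfOrders {V : Type*} (T : SimpleGraph V) (x : Fin 5 → ℕ) : Prop :=
  ∃ (l m : ℕ) (f : SubdivisionIn (fiveCrab l m (fun _ => 0)) T),
    ∀ i : Fin 5, BranchHasOrder T (f.node (hub l m _ i)) (f.path (hub_adj l m _ i)).snd (x i)

/-- The multiset of the five values of `x`. -/
def orders (x : Fin 5 → ℕ) : Multiset ℕ := (Finset.univ : Finset (Fin 5)).val.map x

/-- `T` contains, as a subgraph, a subdivision of a five-crab whose attached caterpillars have
the multiset `s` of orders. -/
def ContainsFiveCrabWith {V : Type*} (T : SimpleGraph V) (s : Multiset ℕ) : Prop :=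
  ∃ (l m : ℕ) (k : Fin 5 → ℕ), orders k = s ∧ ContainsSubdivision T (fiveCrab l m k)

end GreedyTree

/-!
A tree is drawn greedily exactly if every edge has, on the side of each of its ends, the vertices
that are closer to that end (`IsGreedyDrawing.step_lt`, `hasGreedyDrawing_of_complex`). Everything
is expressed by the tree distance: `Btw T x y z` says that `y` lies on the path from `x` to `z`, and
`side T r v` is the component of `v` after removing the edge `rv`.

*Triples.* A vertex of degree 3 is terminal if at least two of the subtrees at it are paths. From an
independent family of irreducible triples one gets distinct terminal vertices, one behind each
triple, and the terminal vertices themselves carry an independent family; so `n₃` is the number of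
terminal vertices (`tripleNumber_eq`).

*Necessity.* In a greedy drawing, the directions of the edges behind an edge `xy` occupy an angle
(`Occupies`). A branching gives at least `π / 3` (`Tripod.occupies_base`), the angles of two
branches add up (`Tripod.occupies_add`), a pendant path at the root of a subtree that occupies
`ψ ≤ π / 2` raises the angle to at least `π / 4 + ψ / 2` (`Tripod.occupies_pendant`), and the angles
occupied on the two sides of an edge have a sum below `2π` (`Occupies.add_lt_two_pi`). Hence each
terminal vertex contributes `π / 3`, which excludes six of them, and the caterpillar `Q_k` occupies
`legAngle k = π / 2 - (π / 6) / 2 ^ k`. So a drawn tree that contains a five-crab with legs of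
orders `k i` has `∑ 2 ^ (-k i) > 3` (`IsCrab.sum_legAngle_lt`, `sum_legAngle_lt_iff`). For both
forbidden crabs this sum is equal to 3.

*Sufficiency.* Conversely, `FitsSector T r v c` says that the subtree behind `rv` can be drawn with
all edge directions in a sector of angle `c`. The same bounds, as strict inequalities, suffice for
such drawings: a path fits into every sector, `Q_k` into every sector of an angle between
`legAngle k` and `π / 2`, and for two branches the angles are added; above a right angle, pendant
paths cost nothing
(`Branching.fits_path_path`, `Branching.fits_path_small`, `Branching.fits_path_large`,
`Branching.fits_add`). Three subtrees whose sectors have a sum below `2π` can be joined at a vertex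
(`Claw.hasGreedyDrawing`). With at most four terminal vertices some vertex has at most two of them
behind each of its edges, each of which costs less than a right angle. With five terminal vertices,
there is a centre with two, two and one of them behind its three edges, and the sides behind the two
forks and the centre are five caterpillars; the condition is `∑ 2 ^ (-x i) > 3` again, and it holds
for the admissible orders.

*The two criteria.* Finally, every tree with five terminal vertices contains a five-crab whose legs
are everything behind their first edges (`exists_isCrab`), and orders that are not admissible
dominate `0, 1, 1, 1, 1` or `0, 0, 1, 2, 2` (`orders_cases`), so that one of the forbidden crabs is
obtained by shortening the legs (`IsCrab.mono`). Subdivisions are constructed from the positions of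
their nodes alone, because paths in trees are unique (`IsNodeMap.subdivision`).
-/

namespace GreedyTree

/-! ### Metric betweenness in trees -/

section Tree

variable {V : Type*} {T : SimpleGraph V}

/-- `y` lies on a geodesic from `x` to `z`; in a tree this says that `y` is on the path from `x`
to `z`. -/
def Btw (T : SimpleGraph V) (x y z : V) : Prop := T.dist x y + T.dist y z = T.dist x z

/-- For an edge `rv` of a tree, the vertices on the side of `v`: those closer to `v` than to
`r`. -/
def side (T : SimpleGraph V) (r v : V) : Set V := {t | T.dist v t < T.dist r t}

theorem mem_side {r v t : V} : t ∈ side T r v ↔ T.dist v t < T.dist r t := Iff.rfl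

theorem Btw.symm {x y z : V} (h : Btw T x y z) : Btw T z y x := by
  unfold Btw at *
  rw [T.dist_comm (u := z) (v := y), T.dist_comm (u := y) (v := x), T.dist_comm (u := z) (v := x)]
  omega

theorem btw_left (x z : V) : Btw T x x z := by simp [Btw]

theorem btw_right (x z : V) : Btw T x z z := by simp [Btw]

theorem dist_adj_cases (hT : T.IsTree) {r v : V} (h : T.Adj r v) (t : V) :
    T.dist r t = T.dist v t + 1 ∨ T.dist v t = T.dist r t + 1 := by
  have := hT.dist_eq_dist_add_one_of_adj t h
  rwa [T.dist_comm (u := t) (v := r), T.dist_comm (u := t) (v := v)] at this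

theorem mem_side_iff (hT : T.IsTree) {r v t : V} (h : T.Adj r v) :
    t ∈ side T r v ↔ T.dist r t = T.dist v t + 1 := by
  have := dist_adj_cases hT h t
  rw [mem_side]; omega

theorem not_mem_side_iff (hT : T.IsTree) {r v t : V} (h : T.Adj r v) :
    t ∉ side T r v ↔ t ∈ side T v r := by
  have := dist_adj_cases hT h t
  rw [mem_side, mem_side]; omega

theorem self_mem_side {r v : V} (h : T.Adj r v) : v ∈ side T r v := by
  simp [mem_side, SimpleGraph.dist_eq_one_iff_adj.2 h]

theorem root_notMem_side {r v : V} : r ∉ side T r v := by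
  simp [mem_side]

theorem dist_pos (hT : T.IsTree) {x y : V} (h : x ≠ y) : 0 < T.dist x y :=
  hT.connected.pos_dist_of_ne h

theorem dist_zero_iff (hT : T.IsTree) {x y : V} : T.dist x y = 0 ↔ x = y :=
  hT.connected.dist_eq_zero_iff

theorem exists_step (hT : T.IsTree) {x z : V} (h : x ≠ z) :
    ∃ y, T.Adj x y ∧ z ∈ side T x y := by
  obtain ⟨p, -, hp⟩ := hT.connected.exists_path_of_dist x z
  cases p with
  | nil => exact absurd rfl h
  | cons hadj q =>
    refine ⟨_, hadj, ?_⟩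
    rw [mem_side, ← hp, SimpleGraph.Walk.length_cons]
    exact Nat.lt_succ_of_le (SimpleGraph.dist_le q)

theorem step_unique (hT : T.IsTree) {x y y' z : V} (h : T.Adj x y) (h' : T.Adj x y')
    (hz : z ∈ side T x y) (hz' : z ∈ side T x y') : y = y' := by
  rw [mem_side_iff hT h] at hz
  rw [mem_side_iff hT h'] at hz'
  obtain ⟨p, hp, hpl⟩ := hT.connected.exists_path_of_dist y z
  obtain ⟨p', hp', hpl'⟩ := hT.connected.exists_path_of_dist y' z
  have h1 : (SimpleGraph.Walk.cons h p).IsPath :=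
    SimpleGraph.Walk.isPath_of_length_eq_dist _ (by simp [hpl, hz])
  have h2 : (SimpleGraph.Walk.cons h' p').IsPath :=
    SimpleGraph.Walk.isPath_of_length_eq_dist _ (by simp [hpl', hz'])
  have := (hT.existsUnique_path x z).unique h1 h2
  simp only [SimpleGraph.Walk.cons.injEq] at this
  exact this.1

theorem dist_tri (hT : T.IsTree) (x y z : V) : T.dist x z ≤ T.dist x y + T.dist y z :=
  hT.connected.dist_triangle

/-- If no neighbour of `z` is closer to both `x` and `w`, then `z` lies between them. -/
theorem btw_of_forall_side (hT : T.IsTree) {x z w : V}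
    (h : ∀ u, T.Adj z u → x ∈ side T z u → w ∉ side T z u) : Btw T x z w := by
  unfold Btw
  induction hn : T.dist z w generalizing w with
  | zero =>
    have := (dist_zero_iff hT).1 hn
    subst this; simp
  | succ n ih =>
    have hne : w ≠ z := by rintro rfl; simp at hn
    obtain ⟨w', hadj, hw'⟩ := exists_step hT hne
    rw [mem_side_iff hT hadj, T.dist_comm, hn, T.dist_comm] at hw'
    have hw'n : T.dist z w' = n := by omega
    have hx : T.dist x z + n = T.dist x w' := by
      refine ih (fun u hu hxu hwu => h u hu hxu ?_) hw'n
      rw [mem_side] at hwu ⊢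
      have := dist_tri hT u w' w
      rw [SimpleGraph.dist_eq_one_iff_adj.2 hadj.symm] at this
      omega
    rcases hT.dist_eq_dist_add_one_of_adj x hadj with h1 | h1
    · omega
    · exfalso
      have hxw : x ∈ side T w' w := by
        rw [mem_side, T.dist_comm, T.dist_comm (u := w')]; omega
      by_cases hzw : w' = z
      · subst hzw
        exact h w hadj.symm hxw (self_mem_side hadj.symm)
      · obtain ⟨w'', hadj'', hw''⟩ := exists_step hT hzw
        have hx'' : x ∈ side T w' w'' := by
          rw [mem_side]
          rw [mem_side_iff hT hadj''] at hw''
          have := dist_tri hT w'' z x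
          rw [T.dist_comm (u := z) (v := x)] at this
          rw [T.dist_comm (u := w') (v := x)]
          rw [T.dist_comm (u := w') (v := z)] at hw''
          omega
        have := step_unique hT hadj.symm hadj'' hxw hx''
        subst this
        rw [mem_side_iff hT hadj'', T.dist_comm, T.dist_comm (u := w)] at hw''
        omega

theorem Btw.mem_side (hT : T.IsTree) {x z w u : V} (h : Btw T x z w)
    (hx : x ∈ side T z u) : w ∉ side T z u := by
  intro hw
  rw [GreedyTree.mem_side] at hx hw
  unfold Btw at h
  have := dist_tri hT x u w
  rw [T.dist_comm (u := x) (v := u)] at this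
  rw [T.dist_comm (u := x) (v := z)] at h
  omega

/-- A vertex behind `y`, seen from `z`, lies in the same direction as `y`. -/
theorem Btw.side_mono (hT : T.IsTree) {z y x u : V} (h : Btw T z y x)
    (hy : y ∈ side T z u) : x ∈ side T z u := by
  rw [GreedyTree.mem_side] at *
  unfold Btw at h
  have := dist_tri hT u y x
  omega

theorem Btw.side_of_ne (hT : T.IsTree) {z y x u : V} (h : Btw T z y x) (hzy : z ≠ y)
    (hu : T.Adj z u) (hx : x ∈ side T z u) : y ∈ side T z u := by
  obtain ⟨u', hu', hy⟩ := exists_step hT hzy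
  rwa [step_unique hT hu hu' hx (h.side_mono hT hy)]

/-- Overlapping geodesics in a tree concatenate. -/
theorem Btw.trans (hT : T.IsTree) {x y z w : V} (h : Btw T x y z) (h' : Btw T y z w)
    (hne : y ≠ z) : Btw T x z w := by
  refine btw_of_forall_side hT fun u hu hx hw => ?_
  have hy := h.symm.side_of_ne hT hne.symm hu hx
  exact h'.mem_side hT hy hw

theorem Btw.trans_left (hT : T.IsTree) {x y z w : V} (h : Btw T x y z) (h' : Btw T y z w)
    (hne : y ≠ z) : Btw T x y w := by
  have := h.trans hT h' hne
  unfold Btw at *; omega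

/-- If `y` is between `x` and `z` and `w` between `y` and `z`, then `y` is between `x` and `w`. -/
theorem Btw.sub_right (hT : T.IsTree) {x y z w : V} (h : Btw T x y z) (h' : Btw T y w z) :
    Btw T x w z := by
  have h1 := dist_tri hT x y w
  have h2 := dist_tri hT x w z
  unfold Btw at *; omega

theorem btw_of_mem_side (hT : T.IsTree) {r v t : V} (h : T.Adj r v) (ht : t ∈ side T r v) :
    Btw T r v t := by
  rw [mem_side_iff hT h] at ht
  unfold Btw
  rw [SimpleGraph.dist_eq_one_iff_adj.2 h]; omega

theorem mem_side_of_btw {r v t : V} (h : T.Adj r v) (ht : Btw T r v t) :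
    t ∈ side T r v := by
  unfold Btw at ht
  rw [SimpleGraph.dist_eq_one_iff_adj.2 h] at ht
  rw [mem_side]; omega

theorem btw_antisymm (hT : T.IsTree) {x y z : V} (h : Btw T x y z) (h' : Btw T x z y) :
    y = z := by
  unfold Btw at *
  rw [T.dist_comm (u := z) (v := y)] at h'
  exact (dist_zero_iff hT).1 (by omega)

theorem eq_of_btw_self (hT : T.IsTree) {x y : V} (h : Btw T x y x) : y = x := by
  unfold Btw at *
  rw [T.dist_self] at h
  exact (dist_zero_iff hT).1 (by omega)

/-- The side of a child is contained in the side of its parent. -/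
theorem side_subset_side (hT : T.IsTree) {r v w : V} (hrv : T.Adj r v) (hvw : T.Adj v w)
    (hne : w ≠ r) : side T v w ⊆ side T r v := by
  intro t ht
  by_contra h
  rw [not_mem_side_iff hT hrv] at h
  exact hne (step_unique hT hvw hrv.symm ht h)

theorem exists_child (hT : T.IsTree) {r v t : V} (hrv : T.Adj r v) (ht : t ∈ side T r v)
    (hne : t ≠ v) : ∃ w, T.Adj v w ∧ w ≠ r ∧ t ∈ side T v w := by
  obtain ⟨w, hw, htw⟩ := exists_step hT hne.symm
  refine ⟨w, hw, ?_, htw⟩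
  rintro rfl
  exact (not_mem_side_iff hT hw).2 ht htw

theorem disjoint_side (hT : T.IsTree) {v w w' : V} (h : T.Adj v w) (h' : T.Adj v w')
    (hne : w ≠ w') : Disjoint (side T v w) (side T v w') :=
  Set.disjoint_left.2 fun _ ht ht' => hne (step_unique hT h h' ht ht')

theorem side_ssubset_side (hT : T.IsTree) {r v w : V} (hrv : T.Adj r v) (hvw : T.Adj v w)
    (hne : w ≠ r) : side T v w ⊂ side T r v :=
  (Set.ssubset_iff_of_subset (side_subset_side hT hrv hvw hne)).2
    ⟨v, self_mem_side hrv, root_notMem_side⟩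

/-- Induction along the directed edges of a finite tree, from the leaves inwards. -/
theorem dart_induction [Finite V] (hT : T.IsTree) {P : V → V → Prop}
    (step : ∀ r v, T.Adj r v → (∀ w, T.Adj v w → w ≠ r → P v w) → P r v) :
    ∀ r v, T.Adj r v → P r v := by
  suffices H : ∀ n r v, T.Adj r v → (side T r v).ncard = n → P r v from
    fun r v h => H _ r v h rfl
  intro n
  induction n using Nat.strong_induction_on with
  | _ n ih =>
    intro r v h hn
    refine step r v h fun w hw hne => ih _ ?_ v w hw rfl
    rw [← hn]
    exact Set.ncard_lt_ncard (side_ssubset_side hT h hw hne) (Set.toFinite _)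

/-- `o` is strictly between any two of `x`, `y`, `z`. -/
structure Tripod (T : SimpleGraph V) (o x y z : V) : Prop where
  ne_x : o ≠ x
  ne_y : o ≠ y
  ne_z : o ≠ z
  xy : Btw T x o y
  xz : Btw T x o z
  yz : Btw T y o z

theorem Tripod.swap {o x y z : V} (h : Tripod T o x y z) : Tripod T o x z y :=
  ⟨h.ne_x, h.ne_z, h.ne_y, h.xz, h.xy, h.yz.symm⟩

end Tree

end GreedyTree

namespace GreedyTree

open Complex

/-! ### Angles between vectors of a common half-plane -/

section Angles

/-- The Euclidean inner product of the plane `ℂ`. -/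
def dot (a b : ℂ) : ℝ := a.re * b.re + a.im * b.im

theorem dot_neg_left (a b : ℂ) : dot (-a) b = -dot a b := by simp [dot]; ring

theorem div_re_eq (d h : ℂ) : (d / h).re = dot d h / normSq h := by
  simp [Complex.div_re, dot]; ring

theorem norm_lt_norm_iff (a b : ℂ) :
    ‖a‖ < ‖b‖ ↔ a.re * a.re + a.im * a.im < b.re * b.re + b.im * b.im := by
  rw [← Complex.normSq_apply, ← Complex.normSq_apply, Complex.normSq_eq_norm_sq,
    Complex.normSq_eq_norm_sq]
  exact (sq_lt_sq₀ (norm_nonneg _) (norm_nonneg _)).symm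

theorem ne_zero_of_dot_pos {d h : ℂ} (hd : 0 < dot d h) : d ≠ 0 ∧ h ≠ 0 := by
  constructor <;> rintro rfl <;> simp [dot] at hd

theorem abs_arg_div_lt {d h : ℂ} (hd : 0 < dot d h) : |arg (d / h)| < Real.pi / 2 := by
  rw [Complex.abs_arg_lt_pi_div_two_iff, div_re_eq]
  exact Or.inl (div_pos hd (normSq_pos.2 (ne_zero_of_dot_pos hd).2))

theorem arg_div_eq_sub {d e h : ℂ} (hd : 0 < dot d h) (he : 0 < dot e h) :
    arg (e / d) = arg (e / h) - arg (d / h) := by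
  have h1 := abs_lt.1 (abs_arg_div_lt hd)
  have h2 := abs_lt.1 (abs_arg_div_lt he)
  obtain ⟨hd0, hh0⟩ := ne_zero_of_dot_pos hd
  have he0 := (ne_zero_of_dot_pos he).1
  have hinv : arg (d / h)⁻¹ = -arg (d / h) := by
    rw [arg_inv, if_neg]
    intro h; rw [h] at h1; linarith [Real.pi_pos]
  have heq : e / d = e / h * (d / h)⁻¹ := by field_simp
  rw [heq, Complex.arg_mul (div_ne_zero he0 hh0) (inv_ne_zero (div_ne_zero hd0 hh0)), hinv,
    sub_eq_add_neg]
  rw [hinv]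
  constructor <;> linarith

/-- For two edges leaving a vertex, with directions `d₁` and `d₂`, the angle of the two directions
as seen from the direction `e` of the incoming edge is exact, not only modulo a full turn. -/
theorem arg_sub_arg_eq {d₁ d₂ e h : ℂ} (he : e ≠ 0) (h₁ : 0 < dot (-d₁) h) (h₂ : 0 < dot d₂ h)
    (hle : arg (d₁ / e) ≤ arg (d₂ / e)) :
    arg (d₂ / e) - arg (d₁ / e) = Real.pi + arg (d₂ / (-d₁)) := by
  have hd1 : d₁ ≠ 0 := neg_ne_zero.1 (ne_zero_of_dot_pos h₁).1
  have hd2 := (ne_zero_of_dot_pos h₂).1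
  have ht := arg_div_eq_sub h₁ h₂
  have a1 := abs_lt.1 (abs_arg_div_lt h₁)
  have a2 := abs_lt.1 (abs_arg_div_lt h₂)
  have hc : ((arg (d₂ / e) - arg (d₁ / e) : ℝ) : Real.Angle)
      = ((Real.pi + arg (d₂ / (-d₁)) : ℝ) : Real.Angle) := by
    rw [Real.Angle.coe_sub, ← Complex.arg_div_coe_angle (div_ne_zero hd2 he) (div_ne_zero hd1 he),
      Real.Angle.coe_add, show d₂ / (-d₁) = -(d₂ / d₁) by rw [div_neg],
      Complex.arg_neg_coe_angle (div_ne_zero hd2 hd1)]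
    rw [add_comm (_ : Real.Angle), add_assoc, Real.Angle.coe_pi_add_coe_pi, add_zero]
    congr 2
    field_simp
  rw [Real.Angle.angle_eq_iff_two_pi_dvd_sub] at hc
  obtain ⟨k, hk⟩ := hc
  have b1 := Complex.arg_le_pi (d₂ / e)
  have b2 := Complex.neg_pi_lt_arg (d₁ / e)
  have hk0 : k = 0 := by
    have hp := Real.pi_pos
    have l1 : (k : ℝ) < 1 := by
      by_contra hcon; push Not at hcon; nlinarith
    have l2 : (-1 : ℝ) < k := by
      by_contra hcon; push Not at hcon; nlinarith
    have l1' : k < 1 := by exact_mod_cast l1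
    have l2' : -1 < k := by exact_mod_cast l2
    omega
  rw [hk0] at hk
  simp at hk
  linarith

theorem dot_eq_cos (a b : ℂ) (ha : a ≠ 0) (hb : b ≠ 0) :
    dot a b = ‖a‖ * ‖b‖ * Real.cos (arg (a / b)) := by
  rw [Complex.cos_arg (div_ne_zero ha hb), div_re_eq, norm_div, Complex.normSq_eq_norm_sq]
  have := norm_pos_iff.2 ha
  have := norm_pos_iff.2 hb
  field_simp

/-- In a triangle with apex `0`, if the side `d₁d₂` is the longest one then the angle at the apex
exceeds `π / 3`. -/
theorem cos_arg_lt_half {d₁ d₂ : ℂ} (hd1 : d₁ ≠ 0) (hd2 : d₂ ≠ 0) (h₁ : ‖d₁‖ < ‖d₁ - d₂‖)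
    (h₂ : ‖d₂‖ < ‖d₁ - d₂‖) : Real.cos (arg (d₂ / d₁)) < 1 / 2 := by
  have hd := dot_eq_cos d₂ d₁ hd2 hd1
  have p1 := norm_pos_iff.2 hd1
  have p2 := norm_pos_iff.2 hd2
  have e1 : ‖d₁ - d₂‖ ^ 2 = ‖d₁‖ ^ 2 + ‖d₂‖ ^ 2 - 2 * dot d₂ d₁ := by
    simp only [← Complex.normSq_eq_norm_sq, Complex.normSq_apply, dot, sub_re, sub_im]; ring
  have s1 : ‖d₁‖ ^ 2 < ‖d₁ - d₂‖ ^ 2 := by gcongr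
  have s2 : ‖d₂‖ ^ 2 < ‖d₁ - d₂‖ ^ 2 := by gcongr
  by_contra hcon
  push Not at hcon
  have : ‖d₂‖ * ‖d₁‖ * (1 / 2) ≤ dot d₂ d₁ := by rw [hd]; gcongr
  nlinarith

/-- The trigonometric heart of the pendant edge bound. Here `o = 0`, `p = 1`,
`c = ρ (cos γ, sin γ)` and `q = p + σ (cos b, sin b)`; the hypotheses say that `c` is closer to `p`
than to `q`, that `q` is closer to `o` than to `c`, and that `pc` is the longest side of the
triangle `opc`. -/
theorem pendant_trig {ρ σ γ b : ℝ} (hγ0 : 0 < γ) (hγπ : γ < Real.pi)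
    (hb : b ≤ Real.pi / 2)
    (k1 : ρ * Real.cos (γ - b) - Real.cos b < σ / 2)
    (k2 : Real.cos γ + σ * Real.cos (γ - b) < ρ / 2)
    (k3 : 2 * Real.cos γ < ρ) (k4 : Real.cos γ < 1 / 2) :
    Real.pi / 4 + b / 2 ≤ γ := by
  by_contra hcon
  push Not at hcon
  have hγ : Real.pi / 3 < γ := by
    by_contra h
    push Not at h
    have := Real.cos_le_cos_of_nonneg_of_le_pi hγ0.le (by linarith) h
    rw [Real.cos_pi_div_three] at this
    linarith
  obtain ⟨η, rfl⟩ : ∃ η, γ = b + η := ⟨γ - b, by ring⟩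
  rw [add_sub_cancel_left] at k1 k2
  have hpi := Real.pi_pos
  have hη : Real.cos (Real.pi / 6) ≤ Real.cos η := by
    rw [← Real.cos_abs η]
    refine Real.cos_le_cos_of_nonneg_of_le_pi (abs_nonneg _) (by linarith) ?_
    rw [abs_le]; constructor <;> linarith
  rw [Real.cos_pi_div_six] at hη
  have h3 : (0 : ℝ) ≤ √3 := Real.sqrt_nonneg 3
  have h3' : √3 ^ 2 = 3 := Real.sq_sqrt (by norm_num)
  have hη0 : 0 < Real.cos η := lt_of_lt_of_le (by positivity) hη
  have hη2 : 0 < 2 * Real.cos η ^ 2 - 1 / 2 := by nlinarith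
  have hγ2 : 0 < Real.cos (b + η) := Real.cos_pos_of_mem_Ioo ⟨by linarith, by linarith⟩
  have hpos : 0 < Real.cos (b + 2 * η) := Real.cos_pos_of_mem_Ioo ⟨by linarith, by linarith⟩
  rw [two_mul η, Real.cos_add b (η + η), Real.cos_add η η, Real.sin_add η η] at hpos
  have hs := Real.sin_sq_add_cos_sq η
  rw [Real.cos_add] at *
  set cb := Real.cos b
  set sb := Real.sin b
  set ce := Real.cos η
  set se := Real.sin η
  have m1 : (ρ * ce - cb) * ce < σ / 2 * ce := mul_lt_mul_of_pos_right k1 hη0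
  have m2 : 2 * (cb * ce - sb * se) * (2 * ce ^ 2 - 1 / 2) < ρ * (2 * ce ^ 2 - 1 / 2) :=
    mul_lt_mul_of_pos_right k3 hη2
  have m3 : 0 < (cb * (ce * ce - se * se) - sb * (se * ce + ce * se)) * ce := mul_pos hpos hη0
  have hse : se * se = 1 - ce * ce := by nlinarith
  rw [hse] at m3
  nlinarith

end Angles

end GreedyTree

namespace GreedyTree

open Complex

/-! ### The angle occupied by a rooted subtree of a greedy drawing -/

section Occupied

variable {V : Type*} {T : SimpleGraph V} {z : V → ℂ}

/-- A drawing in `ℂ` along each of whose tree paths the distance to the far end decreases. -/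
def PathDecreasing (T : SimpleGraph V) (z : V → ℂ) : Prop :=
  ∀ x y t, Btw T x y t → x ≠ y → ‖z y - z t‖ < ‖z x - z t‖

/-- The path from `s` to `t` passes through `p` and then through `q`, with `p ≠ q`. -/
def Forward (T : SimpleGraph V) (s t p q : V) : Prop :=
  p ≠ q ∧ T.dist s p + T.dist p q + T.dist q t = T.dist s t

theorem Forward.symm {s t p q : V} (h : Forward T s t p q) : Forward T t s q p := by
  refine ⟨h.1.symm, ?_⟩
  have h2 := h.2
  rw [T.dist_comm (u := t) (v := q), T.dist_comm (u := q) (v := p),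
    T.dist_comm (u := p) (v := s), T.dist_comm (u := t) (v := s)]
  omega

/-- The displacement between two vertices of a path has positive inner product with the
displacement between the ends of the path: the bisector of `pq` separates `s` from `t`. -/
theorem Forward.dot_pos (hT : T.IsTree) (hz : PathDecreasing T z) {s t p q : V}
    (h : Forward T s t p q) : 0 < dot (z q - z p) (z t - z s) := by
  have t1 := dist_tri hT s p t
  have t2 := dist_tri hT p q t
  have t3 := dist_tri hT s q t
  have t4 := dist_tri hT s p q
  have h2 := h.2
  have b1 : Btw T p q t := by unfold Btw; omega
  have b2 : Btw T q p s := by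
    unfold Btw
    rw [T.dist_comm (u := q) (v := p), T.dist_comm (u := p) (v := s),
      T.dist_comm (u := q) (v := s)]; omega
  have i1 := hz p q t b1 h.1
  have i2 := hz q p s b2 h.1.symm
  rw [norm_lt_norm_iff] at i1 i2
  simp only [dot, sub_re, sub_im] at *
  nlinarith

/-- The angle from `xy` to `pq` in the drawing. -/
noncomputable def angleOf (z : V → ℂ) (x y p q : V) : ℝ := arg ((z q - z p) / (z y - z x))

/-- Angles between the segments of a path are additive, without reduction modulo a full turn. -/
theorem angleOf_add (hT : T.IsTree) (hz : PathDecreasing T z) {s t x y p q p' q' : V}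
    (h₁ : Forward T s t x y) (h₂ : Forward T s t p q) (h₃ : Forward T s t p' q') :
    angleOf z x y p q + angleOf z p q p' q' = angleOf z x y p' q' := by
  have h1 := h₁.dot_pos hT hz
  have h2 := h₂.dot_pos hT hz
  have h3 := h₃.dot_pos hT hz
  unfold angleOf
  rw [arg_div_eq_sub h1 h2, arg_div_eq_sub h2 h3, arg_div_eq_sub h1 h3]
  ring

theorem abs_angleOf_lt (hT : T.IsTree) (hz : PathDecreasing T z) {s t x y p q : V}
    (h₁ : Forward T s t x y) (h₂ : Forward T s t p q) :
    |angleOf z x y p q| < Real.pi := by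
  have h1 := h₁.dot_pos hT hz
  have h2 := h₂.dot_pos hT hz
  unfold angleOf
  rw [arg_div_eq_sub h1 h2]
  have a1 := abs_lt.1 (abs_arg_div_lt h1)
  have a2 := abs_lt.1 (abs_arg_div_lt h2)
  rw [abs_lt]; constructor <;> linarith

theorem angleOf_flip (x y p q : V) : angleOf z x y p q = angleOf z y x q p := by
  unfold angleOf
  rw [← neg_sub (z p), ← neg_sub (z x), neg_div_neg_eq]

theorem PathDecreasing.ne (hz : PathDecreasing T z) {x y : V} (h : x ≠ y) : z x ≠ z y := by
  intro he
  have := hz x y y (btw_right x y) h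
  rw [he] at this
  exact lt_irrefl _ this

theorem PathDecreasing.sub_ne (hz : PathDecreasing T z) {x y : V} (h : x ≠ y) : z y - z x ≠ 0 :=
  sub_ne_zero.2 (hz.ne h).symm

theorem angleOf_self (hz : PathDecreasing T z) {x y : V} (h : x ≠ y) : angleOf z x y x y = 0 := by
  unfold angleOf
  rw [div_self (hz.sub_ne h), arg_one]

/-- The pair `(p, q)` is passed, in this order, by a path that starts with `x, y`; either it is
`(x, y)` itself or it is behind `y`. -/
def Outward (T : SimpleGraph V) (x y p q : V) : Prop :=
  (p = x ∧ q = y) ∨ (p ≠ q ∧ T.dist x y + T.dist y p + T.dist p q = T.dist x q)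

theorem Outward.refl (x y : V) : Outward T x y x y := Or.inl ⟨rfl, rfl⟩

theorem Outward.btw (hT : T.IsTree) {x y p q : V} (h : Outward T x y p q) : Btw T x y q := by
  rcases h with ⟨rfl, rfl⟩ | ⟨-, h⟩
  · exact btw_right _ _
  · have h1 := dist_tri hT y p q
    have h2 := dist_tri hT x y q
    unfold Btw; omega

theorem Outward.forward (hT : T.IsTree) {x y p q : V} (hxy : x ≠ y) (h : Outward T x y p q) :
    Forward T x q p q := by
  rcases h with ⟨rfl, rfl⟩ | ⟨hne, h⟩
  · exact ⟨hxy, by simp⟩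
  · have h1 := dist_tri hT x y p
    have h2 := dist_tri hT x p q
    refine ⟨hne, ?_⟩
    rw [T.dist_self]; omega

theorem Outward.trans (hT : T.IsTree) {x y w p q : V} (hxyw : Btw T x y w) (hyw : y ≠ w)
    (h : Outward T y w p q) : Outward T x y p q := by
  have hb : Btw T x y q := hxyw.trans_left hT (h.btw hT) hyw
  unfold Btw at hb
  rcases h with ⟨rfl, rfl⟩ | ⟨hne, h⟩
  · refine Or.inr ⟨hyw, ?_⟩
    rw [T.dist_self]; omega
  · refine Or.inr ⟨hne, ?_⟩
    have h1 := dist_tri hT y w p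
    have h2 := dist_tri hT y p q
    omega

theorem Btw.forward_left (hT : T.IsTree) {s x y t : V} (h : Btw T s x y) (h' : Btw T x y t)
    (hne : x ≠ y) : Forward T s t x y := by
  have := h.trans_left hT h' hne
  unfold Btw at *
  exact ⟨hne, by omega⟩

theorem Forward.extend {s s' t p q : V} (h : Forward T s t p q) (h' : Btw T s' s t)
    (hT : T.IsTree) : Forward T s' t p q := by
  refine ⟨h.1, ?_⟩
  have h2 := h.2
  unfold Btw at h'
  have h3 := dist_tri hT s' s p
  have h4 := dist_tri hT s' p t
  have h5 := dist_tri hT p q t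
  omega

/-- In the drawing `z`, the part of the tree behind `y`, seen from `x`, occupies an angle of at
least `ψ`: among the directions of the outward segments (the segment `xy` included) there is one
to the left and one to the right of `xy`, at an angle of at least `ψ` from each other. -/
def Occupies (T : SimpleGraph V) (z : V → ℂ) (x y : V) (ψ : ℝ) : Prop :=
  ∃ p q p' q', Outward T x y p q ∧ Outward T x y p' q' ∧ 0 ≤ angleOf z x y p q ∧
    angleOf z x y p' q' ≤ 0 ∧ ψ ≤ angleOf z x y p q - angleOf z x y p' q'

theorem Occupies.of_outward (hz : PathDecreasing T z) {x y p q p' q' : V} {ψ : ℝ} (hxy : x ≠ y)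
    (h : Outward T x y p q) (h' : Outward T x y p' q')
    (hψ : ψ ≤ angleOf z x y p q - angleOf z x y p' q') : Occupies T z x y ψ := by
  have h0 := angleOf_self hz hxy
  rcases le_total 0 (angleOf z x y p q) with h1 | h1 <;>
  rcases le_total (angleOf z x y p' q') 0 with h2 | h2
  · exact ⟨p, q, p', q', h, h', h1, h2, hψ⟩
  · exact ⟨p, q, x, y, h, .refl x y, h1, h0.le, by linarith⟩
  · exact ⟨x, y, p', q', .refl x y, h', h0.ge, h2, by linarith⟩
  · exact ⟨x, y, x, y, .refl x y, .refl x y, h0.ge, h0.le, by linarith⟩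

theorem occupies_zero (hz : PathDecreasing T z) {x y : V} (hxy : x ≠ y) : Occupies T z x y 0 :=
  .of_outward hz hxy (.refl x y) (.refl x y) (by simp)

theorem angleOf_outward (hT : T.IsTree) (hz : PathDecreasing T z) {x y w p q : V}
    (hxy : x ≠ y) (hyw : y ≠ w) (hb : Btw T x y w) (h : Outward T y w p q) :
    angleOf z x y p q = angleOf z x y y w + angleOf z y w p q := by
  have hb' : Btw T x y q := hb.trans_left hT (h.btw hT) hyw
  refine (angleOf_add hT hz (s := x) (t := q) ?_ ?_ ?_).symm
  · exact Btw.forward_left hT (btw_left x y) hb' hxy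
  · exact Btw.forward_left hT hb (h.btw hT) hyw
  · exact (h.forward hT hyw).extend hb' hT

theorem Occupies.extend (hT : T.IsTree) (hz : PathDecreasing T z) {x y w : V} {ψ : ℝ}
    (hxy : x ≠ y) (hyw : y ≠ w) (hb : Btw T x y w) (h : Occupies T z y w ψ) :
    Occupies T z x y ψ := by
  obtain ⟨p, q, p', q', h1, h2, -, -, h5⟩ := h
  refine .of_outward hz hxy (h1.trans hT hb hyw) (h2.trans hT hb hyw) ?_
  rw [angleOf_outward hT hz hxy hyw hb h1, angleOf_outward hT hz hxy hyw hb h2]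
  linarith

/-- Two opposite rooted subtrees occupy together less than a full turn. -/
theorem Occupies.add_lt_two_pi (hT : T.IsTree) (hz : PathDecreasing T z) {x y : V} {ψ ψ' : ℝ}
    (hxy : x ≠ y) (h : Occupies T z x y ψ) (h' : Occupies T z y x ψ') :
    ψ + ψ' < 2 * Real.pi := by
  obtain ⟨p₁, q₁, p₂, q₂, h1, h2, -, -, h5⟩ := h
  obtain ⟨p₃, q₃, p₄, q₄, h6, h7, -, -, h10⟩ := h'
  have key : ∀ p q p' q', Outward T x y p q → Outward T y x p' q' →
      |angleOf z x y p q - angleOf z y x p' q'| < Real.pi := by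
    intro p q p' q' h h'
    have hq : Btw T x y q := h.btw hT
    have hq' : Btw T q' x y := (h'.btw hT).symm
    have hxq : Btw T q' x q := hq'.trans_left hT hq hxy
    have hyq : Btw T q y q' := hq.symm.trans_left hT hq'.symm hxy.symm
    have f1 : Forward T q' q q' p' := ((h'.forward hT hxy.symm).extend hyq hT).symm
    have f2 : Forward T q' q p q := (h.forward hT hxy).extend hxq hT
    have f3 : Forward T q' q x y := Btw.forward_left hT hq' hq hxy
    have := angleOf_add hT hz f1 f3 f2
    have e1 := angleOf_add hT hz f3 f1 f3
    rw [angleOf_self hz hxy] at e1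
    have := abs_angleOf_lt hT hz f1 f2
    rw [angleOf_flip y x p' q', show angleOf z x y p q - angleOf z x y q' p'
      = angleOf z q' p' p q by linarith]
    exact this
  have k1 := (abs_lt.1 (key _ _ _ _ h1 h7)).2
  have k2 := (abs_lt.1 (key _ _ _ _ h2 h6)).1
  linarith

section Tripods

variable {o x y w : V}

theorem Tripod.gap (hT : T.IsTree) (hz : PathDecreasing T z) (h : Tripod T o x y w)
    (hle : angleOf z x o o y ≤ angleOf z x o o w) {p q p' q' : V} (h₁ : Outward T o y p q)
    (h₂ : Outward T o w p' q') :
    angleOf z x o o w - angleOf z x o o y = Real.pi + angleOf z y o o w ∧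
      angleOf z x o p q < angleOf z x o p' q' := by
  have hy : Btw T o y q := h₁.btw hT
  have hw : Btw T o w q' := h₂.btw hT
  have b1 : Btw T q o w := (h.yz.symm.trans_left hT hy h.ne_y).symm
  have b3 : Btw T q o q' := b1.trans_left hT hw h.ne_z
  have f1 : Forward T q q' q p := ((h₁.forward hT h.ne_y).extend b3.symm hT).symm
  have f2 : Forward T q q' p' q' := (h₂.forward hT h.ne_z).extend b3 hT
  have f3 : Forward T q q' y o :=
    (Btw.forward_left hT (h.yz.trans_left hT hw h.ne_z).symm hy h.ne_y).symm
  have f4 : Forward T q q' o w := Btw.forward_left hT b1 hw h.ne_z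
  have g := arg_sub_arg_eq (hz.sub_ne h.ne_x.symm) (d₁ := z y - z o) (d₂ := z w - z o)
    (h := z q' - z q) (by rw [neg_sub]; exact f3.dot_pos hT hz) (f4.dot_pos hT hz) hle
  rw [neg_sub] at g
  have e1 := angleOf_add hT hz f1 f3 f4
  have e2 := angleOf_add hT hz f1 f4 f2
  have e3 := angleOf_add hT hz f3 f1 f3
  rw [angleOf_self hz h.ne_y.symm] at e3
  have e4 := (abs_lt.1 (abs_angleOf_lt hT hz f1 f2)).1
  refine ⟨g, ?_⟩
  rw [angleOf_outward hT hz h.ne_x.symm h.ne_y h.xy h₁,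
    angleOf_outward hT hz h.ne_x.symm h.ne_z h.xz h₂]
  have e5 := angleOf_flip (z := z) o y p q
  change angleOf z x o o w - angleOf z x o o y = Real.pi + angleOf z y o o w at g
  linarith

/-- The angles occupied by the two subtrees at a vertex add up. -/
theorem Tripod.occupies_add (hT : T.IsTree) (hz : PathDecreasing T z) (h : Tripod T o x y w)
    {ψ₁ ψ₂ : ℝ} (h₁ : Occupies T z o y ψ₁) (h₂ : Occupies T z o w ψ₂) :
    Occupies T z x o (ψ₁ + ψ₂) := by
  wlog hle : angleOf z x o o y ≤ angleOf z x o o w generalizing y w ψ₁ ψ₂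
  · rw [add_comm]
    exact this h.swap h₂ h₁ (le_of_not_ge hle)
  obtain ⟨p, q, p', q', a1, a2, -, -, a5⟩ := h₁
  obtain ⟨s, t, s', t', c1, c2, -, -, c5⟩ := h₂
  have g := (h.gap hT hz hle a1 c2).2
  refine .of_outward hz h.ne_x.symm (c1.trans hT h.xz h.ne_z) (a2.trans hT h.xy h.ne_y) ?_
  have u1 := angleOf_outward hT hz h.ne_x.symm h.ne_z h.xz c1
  have u2 := angleOf_outward hT hz h.ne_x.symm h.ne_z h.xz c2
  have u3 := angleOf_outward hT hz h.ne_x.symm h.ne_y h.xy a1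
  have u4 := angleOf_outward hT hz h.ne_x.symm h.ne_y h.xy a2
  linarith

/-- Seen from a third vertex, two vertices on different sides of `o` are more than `π / 3`
apart. -/
theorem Tripod.pi_div_three_lt (hT : T.IsTree) (hz : PathDecreasing T z)
    (h : Tripod T o x y w) (hle : angleOf z x o o y ≤ angleOf z x o o w) :
    Real.pi / 3 < angleOf z x o o w - angleOf z x o o y := by
  have g := (h.gap hT hz hle (.refl o y) (.refl o w)).1
  have hy := hz.sub_ne h.ne_y
  have hw := hz.sub_ne h.ne_z
  have hc : Real.cos (arg ((z w - z o) / (z y - z o))) < 1 / 2 := by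
    refine cos_arg_lt_half hy hw ?_ ?_
    · have := hz w o y h.yz.symm h.ne_z.symm
      rw [show z y - z o - (z w - z o) = -(z w - z y) by ring, norm_neg,
        show z y - z o = -(z o - z y) by ring, norm_neg]
      exact this
    · have := hz y o w h.yz h.ne_y.symm
      rw [show z y - z o - (z w - z o) = z y - z w by ring,
        show z w - z o = -(z o - z w) by ring, norm_neg]
      exact this
  rw [g]
  by_contra hcon
  push Not at hcon
  have hpi := Real.pi_pos
  have hpos : 0 ≤ Real.pi + angleOf z y o o w := by
    have := Complex.neg_pi_lt_arg ((z w - z o) / (z o - z y))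
    unfold angleOf; linarith
  have hcos : Real.cos (Real.pi + angleOf z y o o w) =
      Real.cos (arg ((z w - z o) / (z y - z o))) := by
    rw [add_comm, Real.cos_add_pi, angleOf, Complex.cos_arg, Complex.cos_arg]
    · rw [← neg_sub (z y), div_neg, norm_neg, Complex.neg_re]; ring
    · exact div_ne_zero hw hy
    · exact div_ne_zero hw (hz.sub_ne h.ne_y.symm)
  have := Real.cos_le_cos_of_nonneg_of_le_pi hpos (by linarith) hcon
  rw [hcos, Real.cos_pi_div_three] at this
  linarith

theorem Tripod.occupies_base (hT : T.IsTree) (hz : PathDecreasing T z) (h : Tripod T o x y w) :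
    Occupies T z x o (Real.pi / 3) := by
  wlog hle : angleOf z x o o y ≤ angleOf z x o o w generalizing y w
  · exact this h.swap (le_of_not_ge hle)
  have g := h.pi_div_three_lt hT hz hle
  exact .of_outward hz h.ne_x.symm ((Outward.refl o w).trans hT h.xz h.ne_z)
    ((Outward.refl o y).trans hT h.xy h.ne_y) g.le

end Tripods

end Occupied

end GreedyTree

namespace GreedyTree

open Complex

/-! ### The effect of a pendant path -/

section Pendant

variable {V : Type*} {T : SimpleGraph V} {z : V → ℂ}

theorem PathDecreasing.conj (hz : PathDecreasing T z) :
    PathDecreasing T fun v => (starRingEnd ℂ) (z v) := by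
  intro x y t h hne
  have := hz x y t h hne
  simp only [← map_sub, Complex.norm_conj]
  exact this

theorem angleOf_conj {x y p q : V} (h : angleOf z x y p q ≠ Real.pi) :
    angleOf (fun v => (starRingEnd ℂ) (z v)) x y p q = -angleOf z x y p q := by
  unfold angleOf at *
  simp only [← map_sub, ← map_div₀, Complex.arg_conj, if_neg h]

theorem Outward.angleOf_conj (hT : T.IsTree) (hz : PathDecreasing T z) {x y p q : V} (hxy : x ≠ y)
    (h : Outward T x y p q) :
    angleOf (fun v => (starRingEnd ℂ) (z v)) x y p q = -angleOf z x y p q := by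
  refine GreedyTree.angleOf_conj fun he => ?_
  have := abs_angleOf_lt hT hz (Btw.forward_left hT (btw_left x y) (h.btw hT) hxy)
    (h.forward hT hxy)
  rw [he, abs_of_pos Real.pi_pos] at this
  exact lt_irrefl _ this

theorem Occupies.conj (hT : T.IsTree) (hz : PathDecreasing T z) {x y : V} {ψ : ℝ} (hxy : x ≠ y)
    (h : Occupies T z x y ψ) : Occupies T (fun v => (starRingEnd ℂ) (z v)) x y ψ := by
  obtain ⟨p, q, p', q', h1, h2, h3, h4, h5⟩ := h
  refine ⟨p', q', p, q, h2, h1, ?_⟩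
  rw [h1.angleOf_conj hT hz hxy, h2.angleOf_conj hT hz hxy]
  refine ⟨?_, ?_, ?_⟩ <;> linarith

theorem occupies_conj_iff (hT : T.IsTree) (hz : PathDecreasing T z) {x y : V} {ψ : ℝ}
    (hxy : x ≠ y) :
    Occupies T (fun v => (starRingEnd ℂ) (z v)) x y ψ ↔ Occupies T z x y ψ := by
  refine ⟨fun h => ?_, fun h => h.conj hT hz hxy⟩
  simpa using h.conj hT hz.conj hxy

/-- If `o` lies between `c` and `p`, and `p` between `o` and `q`, then the angle `γ` from `op` to
`oc` and the angle `b` from `op` to `pq` satisfy `2 γ ≥ π / 2 + b`. -/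
theorem Tripod.pendant_angle (hT : T.IsTree) (hz : PathDecreasing T z) {o x p c q : V}
    (h : Tripod T o x p c) (hle : angleOf z x o o p ≤ angleOf z x o o c) (hpq : p ≠ q)
    (ho : Btw T o p q) (hb : angleOf z o p p q ≤ Real.pi / 2) :
    Real.pi / 4 + angleOf z o p p q / 2 ≤ angleOf z x o o c - angleOf z x o o p := by
  have hout : Outward T o p p q := (Outward.refl p q).trans hT ho hpq
  have g := (h.gap hT hz hle hout (.refl o c)).1
  have g3 := h.pi_div_three_lt hT hz hle
  set γ := angleOf z x o o c - angleOf z x o o p with hγ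
  have hpi := Real.pi_pos
  by_cases hγπ : Real.pi ≤ γ
  · linarith
  push Not at hγπ
  have hp0 := hz.sub_ne h.ne_y
  have hc0 := hz.sub_ne h.ne_z
  have hq0 := hz.sub_ne hpq
  set C := (z c - z o) / (z p - z o) with hC
  set Q := (z q - z p) / (z p - z o) with hQ
  have hC0 : C ≠ 0 := div_ne_zero hc0 hp0
  have hQ0 : Q ≠ 0 := div_ne_zero hq0 hp0
  have hγC : γ = Real.pi + arg (-C) := by
    rw [g]; unfold angleOf
    rw [hC, ← div_neg, neg_sub]
  have hbQ : angleOf z o p p q = arg Q := rfl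
  rw [hbQ] at hb ⊢
  set b := arg Q
  set ρ := ‖C‖
  set σ := ‖Q‖
  have hρ : 0 < ρ := norm_pos_iff.2 hC0
  have hσ : 0 < σ := norm_pos_iff.2 hQ0
  have c1 : C.re = ρ * Real.cos γ := by
    rw [hγC, add_comm, Real.cos_add_pi, Complex.cos_arg (neg_ne_zero.2 hC0), norm_neg,
      Complex.neg_re]
    field_simp
    rfl
  have c2 : C.im = ρ * Real.sin γ := by
    rw [hγC, add_comm, Real.sin_add_pi, Complex.sin_arg, norm_neg, Complex.neg_im]
    field_simp
    rfl
  have q1 : Q.re = σ * Real.cos b := by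
    rw [Complex.cos_arg hQ0]; field_simp; rfl
  have q2 : Q.im = σ * Real.sin b := by
    rw [Complex.sin_arg]; field_simp; rfl
  have scale : ∀ u v : ℂ, ‖u‖ < ‖v‖ → ‖u / (z p - z o)‖ < ‖v / (z p - z o)‖ := by
    intro u v huv
    rw [norm_div, norm_div]
    have := norm_pos_iff.2 hp0
    gcongr
  have sγ := Real.sin_sq_add_cos_sq γ
  have sb := Real.sin_sq_add_cos_sq b
  have bqc : Btw T q p c := (h.yz.symm.trans hT ho h.ne_y).symm
  have bco : Btw T c o q := h.yz.symm.trans_left hT ho h.ne_y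
  have n1 := scale _ _ (hz q p c bqc hpq.symm)
  have n2 := scale _ _ (hz c o q bco h.ne_z.symm)
  have n3 := scale _ _ (hz c o p h.yz.symm h.ne_z.symm)
  have n4 := scale _ _ (hz p o c h.yz h.ne_y.symm)
  rw [show (z p - z c) / (z p - z o) = 1 - C by rw [hC]; field_simp; ring,
    show (z q - z c) / (z p - z o) = 1 + Q - C by rw [hC, hQ]; field_simp; ring,
    norm_lt_norm_iff] at n1
  rw [show (z o - z q) / (z p - z o) = -(1 + Q) by rw [hQ]; field_simp; ring,
    show (z c - z q) / (z p - z o) = C - 1 - Q by rw [hC, hQ]; field_simp; ring,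
    norm_lt_norm_iff] at n2
  rw [show (z o - z p) / (z p - z o) = -1 by field_simp; ring,
    show (z c - z p) / (z p - z o) = C - 1 by rw [hC]; field_simp; ring,
    norm_lt_norm_iff] at n3
  rw [show (z o - z c) / (z p - z o) = -C by rw [hC]; field_simp; ring,
    show (z p - z c) / (z p - z o) = 1 - C by rw [hC]; field_simp; ring,
    norm_lt_norm_iff] at n4
  simp only [sub_re, sub_im, add_re, add_im, neg_re, neg_im, one_re, one_im, c1, c2, q1, q2]
    at n1 n2 n3 n4
  have hσ2 : σ * Real.cos b * (σ * Real.cos b) + σ * Real.sin b * (σ * Real.sin b) = σ * σ := by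
    linear_combination σ * σ * sb
  have hρ2 : ρ * Real.cos γ * (ρ * Real.cos γ) + ρ * Real.sin γ * (ρ * Real.sin γ) = ρ * ρ := by
    linear_combination ρ * ρ * sγ
  have k3 : 2 * Real.cos γ < ρ := by
    have : 0 < ρ * (ρ - 2 * Real.cos γ) := by linarith
    linarith [pos_of_mul_pos_right this hρ.le]
  have k4 : Real.cos γ < 1 / 2 := by
    have h1 : 2 * ρ * Real.cos γ < 1 := by linarith
    by_contra hcon
    push Not at hcon
    have := mul_le_mul_of_nonneg_left hcon hρ.le
    linarith
  refine pendant_trig (ρ := ρ) (σ := σ) (by linarith) hγπ hb ?_ ?_ k3 k4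
  · rw [Real.cos_sub γ b]
    have : 0 < σ * (σ / 2 - (ρ * (Real.cos γ * Real.cos b + Real.sin γ * Real.sin b)
        - Real.cos b)) := by linarith
    linarith [pos_of_mul_pos_right this hσ.le]
  · rw [Real.cos_sub γ b]
    have : 0 < ρ * (ρ / 2 - (Real.cos γ + σ * (Real.cos γ * Real.cos b
        + Real.sin γ * Real.sin b))) := by linarith
    linarith [pos_of_mul_pos_right this hρ.le]

/-- A pendant edge at `o` increases the occupied angle `ψ ≤ π / 2` of a subtree at `o` to at least
`π / 4 + ψ / 2`. -/
theorem Tripod.occupies_pendant (hT : T.IsTree) (hz : PathDecreasing T z) {o x y c : V}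
    (h : Tripod T o x y c) {ψ : ℝ} (hψ : Occupies T z o y ψ) (hψ2 : ψ ≤ Real.pi / 2) :
    Occupies T z x o (Real.pi / 4 + ψ / 2) := by
  -- By reflecting the drawing, `c` may be assumed to be to the left of `y`.
  wlog hle : angleOf z x o o y ≤ angleOf z x o o c generalizing z
  · rw [← occupies_conj_iff hT hz h.ne_x.symm]
    refine this hz.conj (hψ.conj hT hz h.ne_y) ?_
    rw [((Outward.refl o y).trans hT h.xy h.ne_y).angleOf_conj hT hz h.ne_x.symm,
      ((Outward.refl o c).trans hT h.xz h.ne_z).angleOf_conj hT hz h.ne_x.symm]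
    linarith
  have hpi := Real.pi_pos
  obtain ⟨p, q, p', q', h1, h2, h3, h4, h5⟩ := hψ
  have hc := (Outward.refl o c).trans hT h.xz h.ne_z
  have hxo := h.ne_x.symm
  have g3 := h.pi_div_three_lt hT hz hle
  have e2 := angleOf_outward hT hz hxo h.ne_y h.xy h2
  have o2 := h2.trans hT h.xy h.ne_y
  by_cases hp : p = o ∧ q = y
  · obtain ⟨rfl, rfl⟩ := hp
    rw [angleOf_self hz h.ne_y] at h5
    exact .of_outward hz hxo hc o2 (by linarith)
  have hgap := (h.gap hT hz hle h1 (.refl o c)).2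
  have e1 := angleOf_outward hT hz hxo h.ne_y h.xy h1
  obtain ⟨hpq, hd⟩ := h1.resolve_left hp
  have hoyp : Btw T o y p := by
    have t1 := dist_tri hT o y p
    have t2 := dist_tri hT o p q
    unfold Btw; omega
  have hopq : Btw T o p q := by
    unfold Btw at *; omega
  have hop : o ≠ p := by
    rintro rfl
    exact h.ne_y (eq_of_btw_self hT hoyp).symm
  have hxop : Btw T x o p := h.xy.trans_left hT hoyp h.ne_y
  have hpoc : Btw T p o c := (h.yz.symm.trans_left hT hoyp h.ne_y).symm
  have h' : Tripod T o x p c := ⟨h.ne_x, hop, h.ne_z, hxop, h.xz, hpoc⟩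
  have hxopq : Btw T x o q := h.xy.trans_left hT (h1.btw hT) h.ne_y
  have hout : Outward T o p p q := (Outward.refl p q).trans hT hopq hpq
  -- `op` is a displacement of the subtree at `y`; its angle relative to `oy` is called `β`.
  have eβ : angleOf z o y o p + angleOf z o p p q = angleOf z o y p q :=
    angleOf_add hT hz (s := o) (t := q) (Btw.forward_left hT (btw_left o y) (h1.btw hT) h.ne_y)
      (Btw.forward_left hT (btw_left o p) hopq hop) (h1.forward hT h.ne_y)
  have e3 : angleOf z x o o y + angleOf z o y o p = angleOf z x o o p :=
    angleOf_add hT hz (s := x) (t := q) (Btw.forward_left hT (btw_left x o) hxopq hxo)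
      (Btw.forward_left hT h.xy (h1.btw hT) h.ne_y) (Btw.forward_left hT hxop hopq hop)
  have e4 := angleOf_outward hT hz hxo hop hxop hout
  have hle' : angleOf z x o o p ≤ angleOf z x o o c := by
    by_contra hcon
    push Not at hcon
    have := (h'.swap.gap hT hz hcon.le (.refl o c) hout).2
    linarith
  have hout' := (Outward.refl o p).trans hT hxop hop
  have k := h'.pendant_angle hT hz hle' hpq hopq
  by_cases hb : angleOf z o p p q ≤ Real.pi / 2
  · specialize k hb
    by_cases hβ : 0 ≤ angleOf z o y o p - angleOf z o y p' q'
    · exact .of_outward hz hxo hc o2 (by linarith)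
    · exact .of_outward hz hxo hc hout' (by linarith)
  · exact .of_outward hz hxo hc hout' (by linarith)

end Pendant

/-! ### Greedy drawings and decreasing distances -/

section Greedy

variable {V : Type*} {T : SimpleGraph V}

/-- In a greedy drawing of a tree, the first step of the path to `t` decreases the distance
to `t`. -/
theorem IsGreedyDrawing.step_lt [Finite V] (hT : T.IsTree) {pos : V → EuclideanSpace ℝ (Fin 2)}
    (hpos : IsGreedyDrawing T pos) {s u t : V} (hsu : T.Adj s u) (ht : t ∈ side T s u) :
    dist (pos u) (pos t) < dist (pos s) (pos t) := by
  -- The vertex of the side of `s` closest to `t` has a neighbour even closer to `t`; so it is `s`.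
  have hs : s ∈ side T u s := self_mem_side hsu.symm
  obtain ⟨x, hx, hmin⟩ := Set.exists_min_image (side T u s) (fun x => dist (pos x) (pos t))
    (Set.toFinite _) ⟨s, hs⟩
  have hxt : x ≠ t := by
    rintro rfl
    exact (not_mem_side_iff hT hsu).2 hx ht
  obtain ⟨y, hxy, hy⟩ := hpos x t hxt
  have hyn : y ∉ side T u s := fun h => absurd (hmin y h) (not_le.2 hy)
  have hxs : x = s := by
    by_contra hne
    apply hyn
    rcases dist_adj_cases hT hxy s with h1 | h1
    · by_cases hys : y = s
      · rw [hys]; exact hs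
      · have := btw_of_mem_side hT hsu.symm hx
        obtain ⟨w, hw, hwu, hwx⟩ := exists_child hT hsu.symm hx hne
        have h2 : Btw T s y x := by
          unfold Btw
          rw [T.dist_comm (u := y) (v := x), SimpleGraph.dist_eq_one_iff_adj.2 hxy,
            T.dist_comm (u := s) (v := y), T.dist_comm (u := s) (v := x)]
          omega
        exact side_subset_side hT hsu.symm hw hwu (h2.side_of_ne hT (Ne.symm hys) hw hwx)
    · have h2 : Btw T s x y := by
        unfold Btw
        rw [SimpleGraph.dist_eq_one_iff_adj.2 hxy,
          T.dist_comm (u := s) (v := y), T.dist_comm (u := s) (v := x)]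
        omega
      obtain ⟨w, hw, hwu, hwx⟩ := exists_child hT hsu.symm hx hne
      exact side_subset_side hT hsu.symm hw hwu (h2.side_mono hT hwx)
  subst hxs
  have hyu : y = u := by
    by_contra hne
    exact hyn (side_subset_side hT hsu.symm hxy hne (self_mem_side hxy))
  rwa [hyu] at hy

theorem HasGreedyDrawing.exists_pathDecreasing [Finite V] (hT : T.IsTree)
    (h : HasGreedyDrawing T) : ∃ z : V → ℂ, PathDecreasing T z := by
  obtain ⟨pos, hpos⟩ := h
  refine ⟨fun v => Complex.orthonormalBasisOneI.repr.symm (pos v), ?_⟩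
  intro x y t hb hne
  rw [← dist_eq_norm, ← dist_eq_norm, LinearIsometryEquiv.dist_map, LinearIsometryEquiv.dist_map]
  induction hn : T.dist x y generalizing x with
  | zero => exact absurd ((dist_zero_iff hT).1 hn) hne
  | succ n ih =>
    obtain ⟨u, hu, hyu⟩ := exists_step hT hne
    have h1 := hpos.step_lt hT hu (hb.side_mono hT hyu)
    by_cases huy : u = y
    · rwa [huy] at h1
    · have h2 := btw_of_mem_side hT hu hyu
      have h3 : T.dist u y = n := by
        rw [mem_side_iff hT hu] at hyu; omega
      refine (ih u ?_ huy h3).trans h1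
      have := dist_tri hT x u t
      have := dist_tri hT u y t
      unfold Btw at *
      omega

/-- A drawing in `ℂ` in which every first step of a path decreases the distance to the end of the
path gives a greedy drawing. -/
theorem hasGreedyDrawing_of_complex (hT : T.IsTree) (z : V → ℂ)
    (hz : ∀ x y t, T.Adj x y → t ∈ side T x y → ‖z y - z t‖ < ‖z x - z t‖) :
    HasGreedyDrawing T := by
  refine ⟨fun v => Complex.orthonormalBasisOneI.repr (z v), fun s t hne => ?_⟩
  obtain ⟨u, hu, ht⟩ := exists_step hT hne
  refine ⟨u, hu, ?_⟩
  rw [LinearIsometryEquiv.dist_map, LinearIsometryEquiv.dist_map, dist_eq_norm, dist_eq_norm]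
  exact hz s u t hu ht

end Greedy

end GreedyTree

namespace GreedyTree

open Complex Filter Topology

/-! ### Drawings of rooted subtrees and their amalgamation -/

section Partial

variable {V : Type*} {T : SimpleGraph V}

/-- The vertices `v` and everything behind the neighbours `w ∈ W` of `v`. -/
def region (T : SimpleGraph V) (v : V) (W : Set V) : Set V := {t | t = v ∨ ∃ w ∈ W, t ∈ side T v w}

/-- The convex cone spanned by two vectors of the plane. -/
def cone (a b : ℂ) : Set ℂ := {w | ∃ s t : ℝ, 0 ≤ s ∧ 0 ≤ t ∧ w = s * a + t * b}

/-- There is a drawing of the part of the tree formed by `v` and everything behind the neighbours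
`w ∈ W` of `v`, with `v` at the origin, such that every edge separates (by its bisector) the
vertices on its two sides, and every edge, directed away from `v`, has its direction in `K`. -/
def PartialDrawing (T : SimpleGraph V) (v : V) (W : Set V) (K : Set ℂ) : Prop :=
  ∃ z : V → ℂ, z v = 0 ∧ ∀ x y, T.Adj x y → y ∈ region T v W → Btw T v x y →
    z y - z x ∈ K ∧ ∀ t ∈ region T v W, (t ∈ side T x y → ‖z y - z t‖ < ‖z x - z t‖) ∧
      (t ∉ side T x y → ‖z x - z t‖ < ‖z y - z t‖)

theorem PartialDrawing.mono {v : V} {W : Set V} {K K' : Set ℂ} (h : PartialDrawing T v W K)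
    (hK : K ⊆ K') : PartialDrawing T v W K' := by
  obtain ⟨z, hz, h⟩ := h
  exact ⟨z, hz, fun x y h1 h2 h3 => ⟨hK (h x y h1 h2 h3).1, (h x y h1 h2 h3).2⟩⟩

/-- Rotating (and scaling) a partial drawing. -/
theorem PartialDrawing.mul {v : V} {W : Set V} {K K' : Set ℂ} (h : PartialDrawing T v W K)
    {u : ℂ} (hu : u ≠ 0) (hK : ∀ d ∈ K, u * d ∈ K') : PartialDrawing T v W K' := by
  obtain ⟨z, hz, h⟩ := h
  refine ⟨fun t => u * z t, by simp [hz], fun x y h1 h2 h3 => ?_⟩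
  obtain ⟨h4, h5⟩ := h x y h1 h2 h3
  have hu' := norm_pos_iff.2 hu
  simp only [← mul_sub, norm_mul]
  refine ⟨hK _ h4, fun t ht => ⟨fun hs => ?_, fun hs => ?_⟩⟩
  · exact mul_lt_mul_of_pos_left ((h5 t ht).1 hs) hu'
  · exact mul_lt_mul_of_pos_left ((h5 t ht).2 hs) hu'

theorem region_child (hT : T.IsTree) {v w t : V} (h : T.Adj v w) :
    t ∈ region T w ({u | T.Adj w u} \ {v}) ↔ t ∈ side T v w := by
  constructor
  · rintro (rfl | ⟨u, ⟨hu, huv⟩, ht⟩)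
    · exact self_mem_side h
    · exact side_subset_side hT h hu huv ht
  · intro ht
    by_cases hw : t = w
    · exact Or.inl hw
    · obtain ⟨u, hu, huv, htu⟩ := exists_child hT h ht hw
      exact Or.inr ⟨u, ⟨hu, huv⟩, htu⟩

theorem dot_cone_nonpos {p a b d : ℂ} (ha : dot p a ≤ 0) (hb : dot p b ≤ 0) (hd : d ∈ cone a b) :
    dot p d ≤ 0 := by
  obtain ⟨s, t, hs, ht, rfl⟩ := hd
  have : dot p (s * a + t * b) = s * dot p a + t * dot p b := by
    simp [dot]; ring
  rw [this]
  nlinarith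

theorem eventually_lt_of_continuous {f g : ℝ → ℝ} (hf : Continuous f) (hg : Continuous g)
    (h : f 0 < g 0) : ∀ᶠ ε in 𝓝[>] (0 : ℝ), f ε < g ε :=
  ((hf.tendsto 0).eventually_lt (hg.tendsto 0) h).filter_mono nhdsWithin_le_nhds

@[fun_prop]
theorem continuous_dot {X : Type*} [TopologicalSpace X] {f g : X → ℂ} (hf : Continuous f)
    (hg : Continuous g) : Continuous fun x => dot (f x) (g x) := by
  unfold dot; fun_prop

/-- The amalgamation lemma: partial drawings behind the neighbours `w ∈ W` of `v`, with edge
directions in the cones spanned by `a w` and `b w`, may be shrunk and placed at the points `P w`,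
provided the points form a greedy drawing of the star at `v`, and `v` and the other points lie in
the polar of the cone with apex at `P w`. -/
theorem partialDrawing_star [Finite V] (hT : T.IsTree) {v : V} {W : Set V}
    (hW : ∀ w ∈ W, T.Adj v w) (P a b : V → ℂ)
    (hd : ∀ w ∈ W, PartialDrawing T w ({u | T.Adj w u} \ {v}) (cone (a w) (b w)))
    (hP : ∀ w ∈ W, P w ≠ 0)
    (h1 : ∀ w ∈ W, ∀ w' ∈ W, w ≠ w' → ‖P w‖ < ‖P w - P w'‖)
    (h2 : ∀ w ∈ W, 0 ≤ dot (P w) (a w) ∧ 0 ≤ dot (P w) (b w))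
    (h3 : ∀ w ∈ W, ∀ w' ∈ W, w ≠ w' →
      dot (P w' - P w) (a w) < 0 ∧ dot (P w' - P w) (b w) < 0) :
    PartialDrawing T v W {d | ∃ w ∈ W, d = P w ∨ d ∈ cone (a w) (b w)} := by
  classical
  choose! zz hzz0 hzz using hd
  have E : ∀ᶠ ε : ℝ in 𝓝[>] 0, ∀ w w' t : V, w ∈ W → w' ∈ W →
      ‖(ε : ℂ) * zz w t‖ < ‖P w + ε * zz w t‖ ∧ (w ≠ w' →
        ‖P w' + ε * zz w' t‖ < ‖P w' + ε * zz w' t - P w‖ ∧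
        dot (P w' + ε * zz w' t - P w) (a w) < 0 ∧ dot (P w' + ε * zz w' t - P w) (b w) < 0) := by
    rw [eventually_all]; intro w
    rw [eventually_all]; intro w'
    rw [eventually_all]; intro t
    by_cases hw : w ∈ W
    swap; · exact Eventually.of_forall fun ε h => absurd h hw
    by_cases hw' : w' ∈ W
    swap; · exact Eventually.of_forall fun ε _ h => absurd h hw'
    have e1 : ∀ᶠ ε : ℝ in 𝓝[>] 0, ‖(ε : ℂ) * zz w t‖ < ‖P w + ε * zz w t‖ :=
      eventually_lt_of_continuous (by fun_prop) (by fun_prop) (by simpa using hP w hw)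
    by_cases hne : w = w'
    · filter_upwards [e1] with ε e1 _ _
      exact ⟨e1, fun h => absurd hne h⟩
    have e2 : ∀ᶠ ε : ℝ in 𝓝[>] 0, ‖P w' + ε * zz w' t‖ < ‖P w' + ε * zz w' t - P w‖ :=
      eventually_lt_of_continuous (by fun_prop) (by fun_prop)
        (by simpa using h1 w' hw' w hw (Ne.symm hne))
    have e3 : ∀ᶠ ε : ℝ in 𝓝[>] 0, dot (P w' + ε * zz w' t - P w) (a w) < 0 :=
      eventually_lt_of_continuous (by fun_prop) (by fun_prop)
        (by simpa using (h3 w hw w' hw' hne).1)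
    have e4 : ∀ᶠ ε : ℝ in 𝓝[>] 0, dot (P w' + ε * zz w' t - P w) (b w) < 0 :=
      eventually_lt_of_continuous (by fun_prop) (by fun_prop)
        (by simpa using (h3 w hw w' hw' hne).2)
    filter_upwards [e1, e2, e3, e4] with ε e1 e2 e3 e4 _ _
    exact ⟨e1, fun _ => ⟨e2, e3, e4⟩⟩
  obtain ⟨ε, hE, hε⟩ := (E.and self_mem_nhdsWithin).exists
  have hε : (0 : ℝ) < ε := hε
  set br : V → V := fun t => if h : v ≠ t then (exists_step hT h).choose else v with hbr
  have br_eq : ∀ w t, T.Adj v w → t ∈ side T v w → br t = w := by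
    intro w t hw ht
    have hne : v ≠ t := by rintro rfl; exact root_notMem_side ht
    simp only [hbr, dif_pos hne]
    exact step_unique hT (exists_step hT hne).choose_spec.1 hw (exists_step hT hne).choose_spec.2 ht
  set z : V → ℂ := fun t => if t = v then 0 else P (br t) + ε * zz (br t) t with hz
  have z_eq : ∀ w ∈ W, ∀ t ∈ side T v w, z t = P w + ε * zz w t := by
    intro w hw t ht
    have hne : t ≠ v := by rintro rfl; exact root_notMem_side ht
    simp only [hz, if_neg hne, br_eq w t (hW w hw) ht]
  have zv : z v = 0 := by simp [hz]
  refine ⟨z, zv, fun x y hxy hy hb => ?_⟩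
  obtain ⟨w, hw, hyw⟩ : ∃ w ∈ W, y ∈ side T v w := by
    rcases hy with rfl | h
    · exact absurd (eq_of_btw_self hT hb) hxy.ne
    · exact h
  have hvw := hW w hw
  have sub : side T x y ⊆ side T v w := fun t ht =>
    (hb.trans hT (btw_of_mem_side hT hxy ht) hxy.ne).side_mono hT hyw
  by_cases hxv : x = v
  · subst hxv
    have hyw' : y = w := step_unique hT hxy hvw (self_mem_side hxy) hyw
    subst hyw'
    have zy : z y = P y := by rw [z_eq y hw y hyw, hzz0 y hw]; simp
    rw [zv, zy, sub_zero]
    refine ⟨⟨y, hw, Or.inl rfl⟩, fun t ht => ⟨fun hs => ?_, fun hs => ?_⟩⟩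
    · rw [z_eq y hw t hs, zero_sub, norm_neg, sub_add_cancel_left, norm_neg]
      exact (hE y y t hw hw).1
    · rcases ht with rfl | ⟨w', hw', ht⟩
      · simpa [zv] using hP y hw
      · have hne : y ≠ w' := by rintro rfl; exact hs ht
        rw [z_eq w' hw' t ht, zero_sub, norm_neg, norm_sub_rev]
        exact ((hE y w' t hw hw').2 hne).1
  · have hxw : x ∈ side T v w := hb.side_of_ne hT (Ne.symm hxv) hvw hyw
    have hvwx := btw_of_mem_side hT hvw hxw
    have hwxy : Btw T w x y := by
      have := btw_of_mem_side hT hvw hyw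
      unfold Btw at *; omega
    obtain ⟨hK, hsep⟩ := hzz w hw x y hxy ((region_child hT hvw).2 hyw) hwxy
    have hlt : ‖zz w x‖ < ‖zz w y‖ := by
      have hns : w ∉ side T x y := by
        rw [mem_side, T.dist_comm (u := y) (v := w), T.dist_comm (u := x) (v := w)]
        unfold Btw at hwxy; omega
      have := (hsep w (Or.inl rfl)).2 hns
      rwa [hzz0 w hw, sub_zero, sub_zero] at this
    have zx := z_eq w hw x hxw
    have zy := z_eq w hw y hyw
    have hout : ∀ p : ℂ, dot (p - P w) (a w) ≤ 0 → dot (p - P w) (b w) ≤ 0 →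
        ‖z x - p‖ < ‖z y - p‖ := by
      intro p ha hb
      have hd := dot_cone_nonpos ha hb hK
      rw [zx, zy, norm_lt_norm_iff]
      rw [norm_lt_norm_iff] at hlt
      have h4 := mul_pos (mul_pos hε hε) (sub_pos.2 hlt)
      have h5 := mul_nonneg hε.le (neg_nonneg.2 hd)
      simp only [dot, sub_re, sub_im, add_re, add_im, mul_re, mul_im, ofReal_re, ofReal_im,
        zero_mul, sub_zero, add_zero] at *
      nlinarith
    refine ⟨⟨w, hw, Or.inr ?_⟩, fun t ht => ⟨fun hs => ?_, fun hs => ?_⟩⟩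
    · obtain ⟨s, t, hs, ht, he⟩ := hK
      refine ⟨ε * s, ε * t, by positivity, by positivity, ?_⟩
      rw [zx, zy, add_sub_add_left_eq_sub, ← mul_sub, he]
      push_cast; ring
    · have htw := sub hs
      rw [zx, zy, z_eq w hw t htw, add_sub_add_left_eq_sub, add_sub_add_left_eq_sub, ← mul_sub,
        ← mul_sub, norm_mul, norm_mul]
      have := (hsep t ((region_child hT hvw).2 htw)).1 hs
      have h5 : (0 : ℝ) < ‖(ε : ℂ)‖ := by simpa using hε.ne'
      gcongr
    · by_cases htw : t ∈ side T v w
      · rw [zx, zy, z_eq w hw t htw, add_sub_add_left_eq_sub, add_sub_add_left_eq_sub, ← mul_sub,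
          ← mul_sub, norm_mul, norm_mul]
        have := (hsep t ((region_child hT hvw).2 htw)).2 hs
        have h5 : (0 : ℝ) < ‖(ε : ℂ)‖ := by simpa using hε.ne'
        gcongr
      · rcases ht with rfl | ⟨w', hw', ht⟩
        · rw [zv]
          have := h2 w hw
          refine hout 0 ?_ ?_ <;> rw [zero_sub, dot_neg_left] <;> linarith
        · have hne : w ≠ w' := by rintro rfl; exact htw ht
          have := (hE w w' t hw hw').2 hne
          rw [z_eq w' hw' t ht]
          exact hout _ this.2.1.le this.2.2.le

end Partial

end GreedyTree

namespace GreedyTree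

open Complex

/-! ### Opening sectors of rooted subtrees -/

section Rooted

variable {V : Type*} {T : SimpleGraph V}

/-- The unit vector of argument `θ`. -/
noncomputable def dir (θ : ℝ) : ℂ := ⟨Real.cos θ, Real.sin θ⟩

theorem dir_mul (a b : ℝ) : dir a * dir b = dir (a + b) := by
  apply Complex.ext <;> simp [dir, Real.cos_add, Real.sin_add]; ring

theorem dir_ne_zero (a : ℝ) : dir a ≠ 0 := by
  intro h
  have h1 := congrArg re h
  have h2 := congrArg im h
  simp only [dir, zero_re, zero_im] at h1 h2
  have := Real.sin_sq_add_cos_sq a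
  rw [h1, h2] at this; norm_num at this

theorem dot_smul_dir (ρ θ α : ℝ) : dot (ρ * dir θ) (dir α) = ρ * Real.cos (θ - α) := by
  rw [Real.cos_sub]; simp [dot, dir]; ring

theorem dot_sub_left (a b c : ℂ) : dot (a - b) c = dot a c - dot b c := by
  simp [dot]; ring

theorem norm_smul_dir_lt {ρ₁ ρ₂ θ₁ θ₂ : ℝ} (h₂ : 0 < ρ₂)
    (h : 2 * ρ₁ * Real.cos (θ₁ - θ₂) < ρ₂) :
    ‖(ρ₁ : ℂ) * dir θ₁‖ < ‖(ρ₁ : ℂ) * dir θ₁ - ρ₂ * dir θ₂‖ := by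
  rw [norm_lt_norm_iff]
  have s := Real.sin_sq_add_cos_sq θ₂
  have h' := mul_lt_mul_of_pos_right h h₂
  rw [Real.cos_sub] at h'
  simp only [dir, sub_re, sub_im, mul_re, mul_im, ofReal_re, ofReal_im, zero_mul, sub_zero,
    add_zero]
  have : ρ₂ * ρ₂ = ρ₂ * ρ₂ * (Real.sin θ₂ ^ 2 + Real.cos θ₂ ^ 2) := by rw [s, mul_one]
  nlinarith

theorem smul_dir_mem_cone {ρ α β θ : ℝ} (hρ : 0 ≤ ρ) (h1 : α ≤ θ) (h2 : θ ≤ β)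
    (h3 : β < α + Real.pi) : (ρ : ℂ) * dir θ ∈ cone (dir α) (dir β) := by
  rcases eq_or_lt_of_le (h1.trans h2) with h | h
  · have h4 : θ = α := by linarith
    exact ⟨ρ, 0, hρ, le_rfl, by rw [h4]; simp⟩
  · have hs : 0 < Real.sin (β - α) := Real.sin_pos_of_pos_of_lt_pi (by linarith) (by linarith)
    have h5 : 0 ≤ Real.sin (β - θ) := Real.sin_nonneg_of_nonneg_of_le_pi (by linarith) (by linarith)
    have h6 : 0 ≤ Real.sin (θ - α) := Real.sin_nonneg_of_nonneg_of_le_pi (by linarith) (by linarith)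
    refine ⟨ρ * (Real.sin (β - θ) / Real.sin (β - α)), ρ * (Real.sin (θ - α) / Real.sin (β - α)),
      by positivity, by positivity, ?_⟩
    rw [Real.sin_sub] at hs
    have sα := Real.sin_sq_add_cos_sq α
    apply Complex.ext
    · simp only [dir, mul_re, add_re, ofReal_re, ofReal_im, zero_mul, sub_zero, Real.sin_sub]
      field_simp
      ring
    · simp only [dir, mul_im, add_im, ofReal_re, ofReal_im, zero_mul, add_zero, Real.sin_sub]
      field_simp
      ring

theorem dir_mem_cone {α β θ : ℝ} (h1 : α ≤ θ) (h2 : θ ≤ β) (h3 : β < α + Real.pi) :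
    dir θ ∈ cone (dir α) (dir β) := by
  simpa using smul_dir_mem_cone zero_le_one h1 h2 h3

theorem cone_subset {a b a' b' : ℂ} (ha : a ∈ cone a' b') (hb : b ∈ cone a' b') :
    cone a b ⊆ cone a' b' := by
  obtain ⟨s, t, hs, ht, rfl⟩ := ha
  obtain ⟨s', t', hs', ht', rfl⟩ := hb
  rintro _ ⟨x, y, hx, hy, rfl⟩
  refine ⟨x * s + y * s', x * t + y * t', by positivity, by positivity, ?_⟩
  push_cast; ring

/-- The subtree at `v` of the tree rooted at `r` can be drawn with the directions of all edges,
taken away from the root, in a sector of angle `c`; its opening angle is then `π - c`. -/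
def FitsSector (T : SimpleGraph V) (r v : V) (c : ℝ) : Prop :=
  PartialDrawing T v ({u | T.Adj v u} \ {r}) (cone (dir 0) (dir c))

theorem FitsSector.rotate {r v : V} {c : ℝ} (h : FitsSector T r v c) (α : ℝ) :
    PartialDrawing T v ({u | T.Adj v u} \ {r}) (cone (dir α) (dir (α + c))) := by
  refine PartialDrawing.mul h (dir_ne_zero α) ?_
  rintro _ ⟨s, t, hs, ht, rfl⟩
  refine ⟨s, t, hs, ht, ?_⟩
  have h0 : dir 0 = 1 := by apply Complex.ext <;> simp [dir]
  rw [← dir_mul α c, h0]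
  ring

theorem fitsSector_of_leaf (hT : T.IsTree) {r v : V} (h : ∀ w, T.Adj v w → w = r) (c : ℝ) :
    FitsSector T r v c := by
  refine ⟨0, rfl, fun x y hxy hy hb => ?_⟩
  rcases hy with rfl | ⟨w, ⟨hw, hwr⟩, -⟩
  · exact absurd (eq_of_btw_self hT hb) hxy.ne
  · exact absurd (h w hw) hwr

theorem fitsSector_of_unary [Finite V] (hT : T.IsTree) {r v w : V} {c : ℝ} (hw : T.Adj v w)
    (hwr : w ≠ r) (h : ∀ u, T.Adj v u → u = r ∨ u = w) (h0 : 0 ≤ c) (hc : c < Real.pi)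
    (hf : FitsSector T v w c) : FitsSector T r v c := by
  have hW : {u | T.Adj v u} \ {r} = {w} := by
    ext u
    constructor
    · rintro ⟨hu, hur⟩
      exact (h u hu).resolve_left hur
    · rintro rfl
      exact ⟨hw, hwr⟩
  have hcos : 0 ≤ Real.cos (c / 2) := Real.cos_nonneg_of_mem_Icc ⟨by linarith, by linarith⟩
  unfold FitsSector
  rw [hW]
  refine (partialDrawing_star hT (v := v) (W := {w}) ?_ (fun _ => dir (c / 2)) (fun _ => dir 0)
    (fun _ => dir c) ?_ ?_ ?_ ?_ ?_).mono ?_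
  · rintro _ rfl; exact hw
  · rintro _ rfl; exact hf
  · rintro _ rfl; exact dir_ne_zero _
  · rintro _ rfl _ rfl hne; exact absurd rfl hne
  · rintro _ rfl
    have h1 := dot_smul_dir 1 (c / 2) 0
    have h2 := dot_smul_dir 1 (c / 2) c
    rw [ofReal_one, one_mul, one_mul] at h1 h2
    rw [h1, h2, sub_zero, show c / 2 - c = -(c / 2) by ring, Real.cos_neg]
    exact ⟨hcos, hcos⟩
  · rintro _ rfl _ rfl hne; exact absurd rfl hne
  · rintro d ⟨_, -, rfl | hd⟩
    · exact dir_mem_cone (by linarith) (by linarith) (by linarith)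
    · exact hd

/-- Two subtrees at `v`, in sectors `[α₁, α₁ + c₁]` and `[α₂, α₂ + c₂]` of `[0, c]`, are placed at
the points with polar coordinates `(ρ₁, θ₁)` and `(ρ₂, θ₂)`. -/
theorem fitsSector_of_binary [Finite V] (hT : T.IsTree) {r v w₁ w₂ : V} {c c₁ c₂ : ℝ}
    (hw₁ : T.Adj v w₁) (hw₂ : T.Adj v w₂) (hr₁ : w₁ ≠ r) (hr₂ : w₂ ≠ r) (hne : w₁ ≠ w₂)
    (h : ∀ u, T.Adj v u → u = r ∨ u = w₁ ∨ u = w₂) (hc : c < Real.pi)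
    (hf₁ : FitsSector T v w₁ c₁) (hf₂ : FitsSector T v w₂ c₂) (h0₁ : 0 ≤ c₁) (h0₂ : 0 ≤ c₂)
    (α₁ α₂ ρ₁ ρ₂ θ₁ θ₂ : ℝ)
    (ha₁ : 0 ≤ α₁) (ha₁' : α₁ + c₁ ≤ c) (ha₂ : 0 ≤ α₂) (ha₂' : α₂ + c₂ ≤ c)
    (hρ₁ : 0 < ρ₁) (hρ₂ : 0 < ρ₂) (hθ₁ : 0 ≤ θ₁) (hθ₁' : θ₁ ≤ c) (hθ₂ : 0 ≤ θ₂) (hθ₂' : θ₂ ≤ c)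
    (k₁ : 2 * ρ₁ * Real.cos (θ₁ - θ₂) < ρ₂) (k₂ : 2 * ρ₂ * Real.cos (θ₂ - θ₁) < ρ₁)
    (l₁ : 0 ≤ Real.cos (θ₁ - α₁)) (l₁' : 0 ≤ Real.cos (θ₁ - (α₁ + c₁)))
    (l₂ : 0 ≤ Real.cos (θ₂ - α₂)) (l₂' : 0 ≤ Real.cos (θ₂ - (α₂ + c₂)))
    (m₁ : ρ₂ * Real.cos (θ₂ - α₁) < ρ₁ * Real.cos (θ₁ - α₁))
    (m₁' : ρ₂ * Real.cos (θ₂ - (α₁ + c₁)) < ρ₁ * Real.cos (θ₁ - (α₁ + c₁)))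
    (m₂ : ρ₁ * Real.cos (θ₁ - α₂) < ρ₂ * Real.cos (θ₂ - α₂))
    (m₂' : ρ₁ * Real.cos (θ₁ - (α₂ + c₂)) < ρ₂ * Real.cos (θ₂ - (α₂ + c₂))) :
    FitsSector T r v c := by
  classical
  have hW : {u | T.Adj v u} \ {r} = {w₁, w₂} := by
    ext u
    constructor
    · rintro ⟨hu, hur⟩
      exact (h u hu).resolve_left hur
    · rintro (rfl | rfl)
      · exact ⟨hw₁, hr₁⟩
      · exact ⟨hw₂, hr₂⟩
  unfold FitsSector
  rw [hW]
  refine (partialDrawing_star hT (v := v) (W := {w₁, w₂}) ?_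
    (fun w => if w = w₁ then ρ₁ * dir θ₁ else ρ₂ * dir θ₂)
    (fun w => if w = w₁ then dir α₁ else dir α₂)
    (fun w => if w = w₁ then dir (α₁ + c₁) else dir (α₂ + c₂)) ?_ ?_ ?_ ?_ ?_).mono ?_
  · rintro _ (rfl | rfl)
    · exact hw₁
    · exact hw₂
  · rintro _ (rfl | rfl)
    · simpa using hf₁.rotate α₁
    · simpa [hne.symm] using hf₂.rotate α₂
  · rintro _ (rfl | rfl)
    · simp [dir_ne_zero, hρ₁.ne']
    · simp [dir_ne_zero, hρ₂.ne', hne.symm]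
  · rintro _ (rfl | rfl) _ (rfl | rfl) hne'
    · exact absurd rfl hne'
    · simp only [if_true, if_neg hne.symm]
      exact norm_smul_dir_lt hρ₂ k₁
    · simp only [if_true, if_neg hne.symm]
      exact norm_smul_dir_lt hρ₁ k₂
    · exact absurd rfl hne'
  · rintro _ (rfl | rfl)
    · simp only [if_true, dot_smul_dir]
      exact ⟨mul_nonneg hρ₁.le l₁, mul_nonneg hρ₁.le l₁'⟩
    · simp only [if_neg hne.symm, dot_smul_dir]
      exact ⟨mul_nonneg hρ₂.le l₂, mul_nonneg hρ₂.le l₂'⟩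
  · rintro _ (rfl | rfl) _ (rfl | rfl) hne'
    · exact absurd rfl hne'
    · simp only [if_true, if_neg hne.symm, dot_smul_dir, dot_sub_left]
      constructor <;> linarith
    · simp only [if_true, if_neg hne.symm, dot_smul_dir, dot_sub_left]
      constructor <;> linarith
    · exact absurd rfl hne'
  · rintro d ⟨_, rfl | rfl, hd⟩
    · simp only [if_true] at hd
      rcases hd with rfl | hd
      · exact smul_dir_mem_cone hρ₁.le hθ₁ hθ₁' (by linarith)
      · exact cone_subset (dir_mem_cone (by linarith) (by linarith) (by linarith))
          (dir_mem_cone (by linarith) (by linarith) (by linarith)) hd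
    · simp only [if_neg hne.symm] at hd
      rcases hd with rfl | hd
      · exact smul_dir_mem_cone hρ₂.le hθ₂ hθ₂' (by linarith)
      · exact cone_subset (dir_mem_cone (by linarith) (by linarith) (by linarith))
          (dir_mem_cone (by linarith) (by linarith) (by linarith)) hd

/-- The edge from `r` to `v` branches at `v` into the edges to `w₁` and `w₂`. -/
structure Branching (T : SimpleGraph V) (r v w₁ w₂ : V) : Prop where
  adj₁ : T.Adj v w₁
  adj₂ : T.Adj v w₂
  ne₁ : w₁ ≠ r
  ne₂ : w₂ ≠ r
  ne : w₁ ≠ w₂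
  eq : ∀ u, T.Adj v u → u = r ∨ u = w₁ ∨ u = w₂

theorem Branching.swap {r v w₁ w₂ : V} (h : Branching T r v w₁ w₂) : Branching T r v w₂ w₁ :=
  ⟨h.adj₂, h.adj₁, h.ne₂, h.ne₁, h.ne.symm, fun u hu => (h.eq u hu).imp_right Or.symm⟩

section

variable [Finite V] {r v w₁ w₂ : V}

theorem Branching.fits_path_path (hB : Branching T r v w₁ w₂) (hT : T.IsTree) {c : ℝ}
    (h₁ : FitsSector T v w₁ 0) (h₂ : FitsSector T v w₂ 0) (hc : Real.pi / 3 < c)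
    (hc' : c < Real.pi) : FitsSector T r v c := by
  have hpi := Real.pi_pos
  have hcos : Real.cos c < 1 / 2 := by
    rw [← Real.cos_pi_div_three]
    exact Real.cos_lt_cos_of_nonneg_of_le_pi (by linarith) hc'.le hc
  refine fitsSector_of_binary hT hB.adj₁ hB.adj₂ hB.ne₁ hB.ne₂ hB.ne hB.eq hc' h₁ h₂ le_rfl le_rfl
    0 c 1 1 0 c le_rfl ?_ ?_ ?_ one_pos one_pos ?_ ?_ ?_ ?_ ?_ ?_ ?_ ?_ ?_ ?_ ?_ ?_ ?_ ?_
  all_goals first | linarith | simp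
  all_goals linarith

/-- Adding a path to a subtree in a sector of angle less than `π / 2`. -/
theorem Branching.fits_path_small (hB : Branching T r v w₁ w₂) (hT : T.IsTree) {c c₀ : ℝ}
    (h₁ : FitsSector T v w₁ 0) (h₂ : FitsSector T v w₂ c₀) (hc₀ : Real.pi / 3 ≤ c₀)
    (hc : Real.pi / 4 + c₀ / 2 < c) (hc' : c < Real.pi / 2) :
    FitsSector T r v c := by
  have hpi := Real.pi_pos
  have p1 : 0 < Real.cos c := Real.cos_pos_of_mem_Ioo ⟨by linarith, by linarith⟩
  have p2 : 0 < Real.cos (c - c₀) := Real.cos_pos_of_mem_Ioo ⟨by linarith, by linarith⟩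
  have p3 : 0 < Real.cos c₀ := Real.cos_pos_of_mem_Ioo ⟨by linarith, by linarith⟩
  have hcos : Real.cos c < 1 / 2 := by
    rw [← Real.cos_pi_div_three]
    exact Real.cos_lt_cos_of_nonneg_of_le_pi (by linarith) (by linarith) (by linarith)
  have hneg : Real.cos (2 * c - c₀) < 0 :=
    Real.cos_neg_of_pi_div_two_lt_of_lt (by linarith) (by linarith)
  have hid : 2 * Real.cos c * Real.cos (c - c₀) = Real.cos (2 * c - c₀) + Real.cos c₀ := by
    rw [show 2 * c - c₀ = c + (c - c₀) by ring]
    conv_rhs => rw [show Real.cos c₀ = Real.cos (c - (c - c₀)) by congr 1; ring]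
    rw [Real.cos_add, Real.cos_sub c (c - c₀)]; ring
  -- The path starts at distance `ρ` from `v`, the subtree at distance `1`.
  obtain ⟨ρ, hρ1, hρ2⟩ : ∃ ρ, 2 * Real.cos c < ρ ∧
      ρ < min (Real.cos c₀ / Real.cos (c - c₀)) (1 / (2 * Real.cos c)) := by
    refine exists_between (lt_min ?_ ?_)
    · rw [lt_div_iff₀ p2]; linarith
    · rw [lt_div_iff₀ (by linarith)]; nlinarith
  obtain ⟨hρ3, hρ4⟩ := lt_min_iff.1 hρ2
  rw [lt_div_iff₀ p2] at hρ3
  rw [lt_div_iff₀ (by linarith)] at hρ4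
  refine fitsSector_of_binary hT hB.adj₁ hB.adj₂ hB.ne₁ hB.ne₂ hB.ne hB.eq (by linarith) h₁ h₂
    le_rfl (by linarith)
    c 0 ρ 1 c 0 ?_ ?_ ?_ ?_ ?_ one_pos ?_ ?_ ?_ ?_ ?_ ?_ ?_ ?_ ?_ ?_ ?_ ?_ ?_ ?_
  all_goals first | linarith | (simp; done) | (simp; linarith)

/-- Adding a path to a subtree in a sector of angle at least `π / 2`: the sector need only be
enlarged by an arbitrarily small amount. -/
theorem Branching.fits_path_large (hB : Branching T r v w₁ w₂) (hT : T.IsTree) {c c₀ : ℝ}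
    (h₁ : FitsSector T v w₁ 0) (h₂ : FitsSector T v w₂ c₀) (hc₀ : Real.pi / 2 ≤ c₀)
    (hc : c₀ < c) (hc' : c < Real.pi) : FitsSector T r v c := by
  have hpi := Real.pi_pos
  obtain ⟨α, hα⟩ : ∃ α, α = (c₀ + c) / 2 - Real.pi / 2 := ⟨_, rfl⟩
  have p1 : 0 < Real.cos α := Real.cos_pos_of_mem_Ioo ⟨by linarith, by linarith⟩
  have p2 : 0 < Real.cos (α - c₀) := Real.cos_pos_of_mem_Ioo ⟨by linarith, by linarith⟩
  have p3 : Real.cos (c - α) < 0 :=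
    Real.cos_neg_of_pi_div_two_lt_of_lt (by linarith) (by linarith)
  have p4 : Real.cos (α - c) < 0 := by rwa [← Real.cos_neg, neg_sub]
  -- The path starts at a very small distance `τ` from `v`.
  obtain ⟨τ, hτ, hτ'⟩ : ∃ τ, 0 < τ ∧ τ < min (Real.cos α) (Real.cos (α - c₀)) :=
    exists_between (lt_min p1 p2)
  obtain ⟨hτ1, hτ2⟩ := lt_min_iff.1 hτ'
  have q1 := mul_le_of_le_one_right hτ.le (Real.cos_le_one c)
  have q2 := mul_le_of_le_one_right hτ.le (Real.cos_le_one (c - c₀))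
  have q3 := mul_neg_of_pos_of_neg hτ p3
  have p5 : 0 ≤ Real.cos α := p1.le
  refine fitsSector_of_binary hT hB.adj₁ hB.adj₂ hB.ne₁ hB.ne₂ hB.ne hB.eq hc' h₁ h₂
    le_rfl (by linarith)
    c 0 τ 1 c α ?_ ?_ ?_ ?_ hτ one_pos ?_ ?_ ?_ ?_ ?_ ?_ ?_ ?_ ?_ ?_ ?_ ?_ ?_ ?_
  all_goals first | linarith | (simp; done) | (simp; linarith)

/-- Two subtrees in sectors of angles at least `π / 3`. -/
theorem Branching.fits_add (hB : Branching T r v w₁ w₂) (hT : T.IsTree) {c c₁ c₂ : ℝ}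
    (h₁ : FitsSector T v w₁ c₁) (h₂ : FitsSector T v w₂ c₂) (hc₁ : Real.pi / 3 ≤ c₁)
    (hc₂ : Real.pi / 3 ≤ c₂) (hc : c₁ + c₂ < c) (hc' : c < Real.pi) : FitsSector T r v c := by
  have hpi := Real.pi_pos
  obtain ⟨ε, rfl⟩ : ∃ ε, c = c₁ + c₂ + ε := ⟨c - (c₁ + c₂), by ring⟩
  obtain ⟨m, hm⟩ : ∃ m, m = c₁ + ε / 2 := ⟨_, rfl⟩
  have hP : Real.cos (Real.pi / 2) = 0 := Real.cos_pi_div_two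
  -- The two subtrees are placed on the unit circle, at a right angle.
  have key : ∀ x, 0 < Real.sin x →
      Real.cos (x + Real.pi / 4) < Real.cos (x - Real.pi / 4) := by
    intro x hx
    rw [Real.cos_add, Real.cos_sub]
    have : 0 < Real.sin x * Real.sin (Real.pi / 4) := mul_pos hx
      (Real.sin_pos_of_pos_of_lt_pi (by linarith) (by linarith))
    linarith
  have s1 : 0 < Real.sin m := Real.sin_pos_of_pos_of_lt_pi (by linarith) (by linarith)
  have s2 : 0 < Real.sin (ε / 2) := Real.sin_pos_of_pos_of_lt_pi (by linarith) (by linarith)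
  have s3 : 0 < Real.sin (c₂ + ε / 2) := Real.sin_pos_of_pos_of_lt_pi (by linarith) (by linarith)
  refine fitsSector_of_binary hT hB.adj₁ hB.adj₂ hB.ne₁ hB.ne₂ hB.ne hB.eq hc' h₁ h₂
    (by linarith) (by linarith)
    0 (c₁ + ε) 1 1 (m - Real.pi / 4) (m + Real.pi / 4)
    ?_ ?_ ?_ ?_ one_pos one_pos ?_ ?_ ?_ ?_ ?_ ?_ ?_ ?_ ?_ ?_ ?_ ?_ ?_ ?_
  any_goals linarith
  · rw [show m - Real.pi / 4 - (m + Real.pi / 4) = -(Real.pi / 2) by ring, Real.cos_neg, hP]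
    norm_num
  · rw [show m + Real.pi / 4 - (m - Real.pi / 4) = Real.pi / 2 by ring, hP]
    norm_num
  · exact Real.cos_nonneg_of_mem_Icc ⟨by linarith, by linarith⟩
  · exact Real.cos_nonneg_of_mem_Icc ⟨by linarith, by linarith⟩
  · exact Real.cos_nonneg_of_mem_Icc ⟨by linarith, by linarith⟩
  · exact Real.cos_nonneg_of_mem_Icc ⟨by linarith, by linarith⟩
  · simpa using key m s1
  · rw [one_mul, one_mul, show m + Real.pi / 4 - (0 + c₁) = ε / 2 + Real.pi / 4 by rw [hm]; ring,
      show m - Real.pi / 4 - (0 + c₁) = ε / 2 - Real.pi / 4 by rw [hm]; ring]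
    exact key _ s2
  · rw [one_mul, one_mul, ← Real.cos_neg, ← Real.cos_neg (m + _ - _),
      show -(m - Real.pi / 4 - (c₁ + ε)) = ε / 2 + Real.pi / 4 by rw [hm]; ring,
      show -(m + Real.pi / 4 - (c₁ + ε)) = ε / 2 - Real.pi / 4 by rw [hm]; ring]
    exact key _ s2
  · rw [one_mul, one_mul, ← Real.cos_neg, ← Real.cos_neg (m + _ - _),
      show -(m - Real.pi / 4 - (c₁ + ε + c₂)) = c₂ + ε / 2 + Real.pi / 4 by rw [hm]; ring,
      show -(m + Real.pi / 4 - (c₁ + ε + c₂)) = c₂ + ε / 2 - Real.pi / 4 by rw [hm]; ring]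
    exact key _ s3

end

end Rooted

end GreedyTree

namespace GreedyTree

open Complex

/-! ### Joining three rooted subtrees at a vertex -/

section Join

variable {V : Type*} {T : SimpleGraph V}

theorem PartialDrawing.hasGreedyDrawing (hT : T.IsTree) {v : V} {W : Set V} {K : Set ℂ}
    (hW : ∀ u, T.Adj v u → u ∈ W) (h : PartialDrawing T v W K) : HasGreedyDrawing T := by
  obtain ⟨z, -, hz⟩ := h
  have hreg : ∀ t, t ∈ region T v W := by
    intro t
    by_cases ht : v = t
    · exact Or.inl ht.symm
    · obtain ⟨w, hw, htw⟩ := exists_step hT ht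
      exact Or.inr ⟨w, hW w hw, htw⟩
  refine hasGreedyDrawing_of_complex hT z fun x y t hxy ht => ?_
  by_cases hv : v ∈ side T x y
  · have hb : Btw T v y x := (btw_of_mem_side hT hxy hv).symm
    exact ((hz y x hxy.symm (hreg x) hb).2 t (hreg t)).2 ((not_mem_side_iff hT hxy.symm).2 ht)
  · rw [not_mem_side_iff hT hxy] at hv
    have hb : Btw T v x y := (btw_of_mem_side hT hxy.symm hv).symm
    exact ((hz x y hxy (hreg y) hb).2 t (hreg t)).1 ht

/-- `v` has exactly the three neighbours `w₁`, `w₂`, `w₃`. -/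
structure Claw (T : SimpleGraph V) (v w₁ w₂ w₃ : V) : Prop where
  adj₁ : T.Adj v w₁
  adj₂ : T.Adj v w₂
  adj₃ : T.Adj v w₃
  ne₁₂ : w₁ ≠ w₂
  ne₁₃ : w₁ ≠ w₃
  ne₂₃ : w₂ ≠ w₃
  eq : ∀ u, T.Adj v u → u = w₁ ∨ u = w₂ ∨ u = w₃

theorem Claw.rotate {v w₁ w₂ w₃ : V} (h : Claw T v w₁ w₂ w₃) : Claw T v w₂ w₃ w₁ :=
  ⟨h.adj₂, h.adj₃, h.adj₁, h.ne₂₃, h.ne₁₂.symm, h.ne₁₃.symm, fun u hu => by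
    have := h.eq u hu; tauto⟩

theorem Claw.swap {v w₁ w₂ w₃ : V} (h : Claw T v w₁ w₂ w₃) : Claw T v w₁ w₃ w₂ :=
  ⟨h.adj₁, h.adj₃, h.adj₂, h.ne₁₃, h.ne₁₂, h.ne₂₃.symm, fun u hu => by
    have := h.eq u hu; tauto⟩

variable {v w₁ w₂ w₃ : V}

theorem Claw.draw_of_points [Finite V] (hw : Claw T v w₁ w₂ w₃) (hT : T.IsTree) {c₁ c₂ c₃ : ℝ}
    (hf₁ : FitsSector T v w₁ c₁) (hf₂ : FitsSector T v w₂ c₂) (hf₃ : FitsSector T v w₃ c₃)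
    (P₁ P₂ P₃ : ℂ) (α₁ α₂ α₃ : ℝ)
    (h₁ : P₁ ≠ 0 ∧ 0 ≤ dot P₁ (dir α₁) ∧ 0 ≤ dot P₁ (dir (α₁ + c₁)))
    (h₂ : P₂ ≠ 0 ∧ 0 ≤ dot P₂ (dir α₂) ∧ 0 ≤ dot P₂ (dir (α₂ + c₂)))
    (h₃ : P₃ ≠ 0 ∧ 0 ≤ dot P₃ (dir α₃) ∧ 0 ≤ dot P₃ (dir (α₃ + c₃)))
    (h₁₂ : ‖P₁‖ < ‖P₁ - P₂‖ ∧ dot (P₂ - P₁) (dir α₁) < 0 ∧ dot (P₂ - P₁) (dir (α₁ + c₁)) < 0)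
    (h₁₃ : ‖P₁‖ < ‖P₁ - P₃‖ ∧ dot (P₃ - P₁) (dir α₁) < 0 ∧ dot (P₃ - P₁) (dir (α₁ + c₁)) < 0)
    (h₂₁ : ‖P₂‖ < ‖P₂ - P₁‖ ∧ dot (P₁ - P₂) (dir α₂) < 0 ∧ dot (P₁ - P₂) (dir (α₂ + c₂)) < 0)
    (h₂₃ : ‖P₂‖ < ‖P₂ - P₃‖ ∧ dot (P₃ - P₂) (dir α₂) < 0 ∧ dot (P₃ - P₂) (dir (α₂ + c₂)) < 0)
    (h₃₁ : ‖P₃‖ < ‖P₃ - P₁‖ ∧ dot (P₁ - P₃) (dir α₃) < 0 ∧ dot (P₁ - P₃) (dir (α₃ + c₃)) < 0)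
    (h₃₂ : ‖P₃‖ < ‖P₃ - P₂‖ ∧ dot (P₂ - P₃) (dir α₃) < 0 ∧ dot (P₂ - P₃) (dir (α₃ + c₃)) < 0) :
    HasGreedyDrawing T := by
  classical
  have n1 := hw.ne₁₂.symm
  have n2 := hw.ne₁₃.symm
  have n3 := hw.ne₂₃.symm
  refine (partialDrawing_star hT (v := v) (W := {w₁, w₂, w₃}) ?_
    (fun w => if w = w₁ then P₁ else if w = w₂ then P₂ else P₃)
    (fun w => dir (if w = w₁ then α₁ else if w = w₂ then α₂ else α₃))
    (fun w => dir (if w = w₁ then α₁ + c₁ else if w = w₂ then α₂ + c₂ else α₃ + c₃))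
    ?_ ?_ ?_ ?_ ?_).hasGreedyDrawing hT fun u hu => hw.eq u hu
  · rintro _ (rfl | rfl | rfl)
    · exact hw.adj₁
    · exact hw.adj₂
    · exact hw.adj₃
  · rintro _ (rfl | rfl | rfl)
    · simpa using hf₁.rotate α₁
    · simpa [n1] using hf₂.rotate α₂
    · simpa [n2, n3] using hf₃.rotate α₃
  · rintro _ (rfl | rfl | rfl)
    · simpa using h₁.1
    · simpa [n1] using h₂.1
    · simpa [n2, n3] using h₃.1
  · rintro _ (rfl | rfl | rfl) _ (rfl | rfl | rfl) hne
    · exact absurd rfl hne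
    · simpa [n1] using h₁₂.1
    · simpa [n2, n3] using h₁₃.1
    · simpa [n1] using h₂₁.1
    · exact absurd rfl hne
    · simpa [n1, n2, n3] using h₂₃.1
    · simpa [n2, n3] using h₃₁.1
    · simpa [n1, n2, n3] using h₃₂.1
    · exact absurd rfl hne
  · rintro _ (rfl | rfl | rfl)
    · simpa using h₁.2
    · simpa [n1] using h₂.2
    · simpa [n2, n3] using h₃.2
  · rintro _ (rfl | rfl | rfl) _ (rfl | rfl | rfl) hne
    · exact absurd rfl hne
    · simpa [n1] using h₁₂.2
    · simpa [n2, n3] using h₁₃.2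
    · simpa [n1] using h₂₁.2
    · exact absurd rfl hne
    · simpa [n1, n2, n3] using h₂₃.2
    · simpa [n2, n3] using h₃₁.2
    · simpa [n1, n2, n3] using h₃₂.2
    · exact absurd rfl hne

theorem sin_le_sin_of_add_lt_pi {a c : ℝ} (h : c ≤ a) (hc : 0 ≤ c) (hac : a + c < Real.pi) :
    Real.sin c ≤ Real.sin a := by
  have h1 : Real.sin a - Real.sin c = 2 * Real.sin ((a - c) / 2) * Real.cos ((a + c) / 2) :=
    Real.sin_sub_sin a c
  have h2 : 0 ≤ Real.sin ((a - c) / 2) :=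
    Real.sin_nonneg_of_nonneg_of_le_pi (by linarith) (by linarith)
  have h3 : 0 ≤ Real.cos ((a + c) / 2) := Real.cos_nonneg_of_mem_Icc ⟨by linarith, by linarith⟩
  nlinarith [mul_nonneg h2 h3]

/-- The three subtrees are placed at the vertices of a triangle with angles `a`, `b`, `c`, the
vertex `v` inside the triangle and very close to the vertex with the largest angle. -/
theorem Claw.draw_of_triangle [Finite V] (hw : Claw T v w₁ w₂ w₃) (hT : T.IsTree)
    {a b c c₁ c₂ c₃ : ℝ}
    (hf₁ : FitsSector T v w₁ c₁) (hf₂ : FitsSector T v w₂ c₂) (hf₃ : FitsSector T v w₃ c₃)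
    (ha : 0 < a) (hb : 0 < b) (hc : 0 < c) (hsum : a + b + c = Real.pi) (hba : b ≤ a) (hca : c ≤ a)
    (h₁ : 0 ≤ c₁) (h₂ : 0 ≤ c₂) (h₃ : 0 ≤ c₃)
    (k₁ : a + c₁ < Real.pi) (k₂ : b + c₂ < Real.pi) (k₃ : c + c₃ < Real.pi) :
    HasGreedyDrawing T := by
  have sb : 0 < Real.sin b := Real.sin_pos_of_pos_of_lt_pi hb (by linarith)
  have sc : 0 < Real.sin c := Real.sin_pos_of_pos_of_lt_pi hc (by linarith)
  have sa : 0 < Real.sin a := Real.sin_pos_of_pos_of_lt_pi ha (by linarith)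
  have sba := sin_le_sin_of_add_lt_pi hba hb.le (by linarith)
  have sca := sin_le_sin_of_add_lt_pi hca hc.le (by linarith)
  have hcos : ∀ x y : ℝ, 0 < x → 0 ≤ y → x + y < Real.pi →
      0 < Real.cos (x / 2 + y / 2) ∧ 0 < Real.cos (x / 2 - y / 2) := fun x y hx hy hxy =>
    ⟨Real.cos_pos_of_mem_Ioo ⟨by linarith, by linarith⟩,
      Real.cos_pos_of_mem_Ioo ⟨by linarith, by linarith⟩⟩
  obtain ⟨A1, A2⟩ := hcos a c₁ ha h₁ k₁
  obtain ⟨B1, B2⟩ := hcos b c₂ hb h₂ k₂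
  obtain ⟨C1, C2⟩ := hcos c c₃ hc h₃ k₃
  have A0 : 0 < Real.cos (a / 2) := Real.cos_pos_of_mem_Ioo ⟨by linarith, by linarith⟩
  have A3 : 0 ≤ Real.cos (c₁ / 2) := Real.cos_nonneg_of_mem_Icc ⟨by linarith, by linarith⟩
  obtain ⟨τ, hτ, hτ'⟩ : ∃ τ, 0 < τ ∧ τ < min (min (min (Real.sin c) (Real.sin b))
      (min (Real.sin c * Real.cos (a / 2)) (Real.sin b * Real.cos (a / 2))))
      (min (min (Real.sin c * Real.cos (b / 2 + c₂ / 2)) (Real.sin c * Real.cos (b / 2 - c₂ / 2)))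
        (min (Real.sin b * Real.cos (c / 2 + c₃ / 2)) (Real.sin b * Real.cos (c / 2 - c₃ / 2)))) :=
    exists_between (by simp only [lt_min_iff]; refine ⟨⟨⟨?_, ?_⟩, ?_, ?_⟩, ⟨?_, ?_⟩, ?_, ?_⟩ <;>
      positivity)
  simp only [lt_min_iff] at hτ'
  obtain ⟨⟨⟨t1, t2⟩, t3, t4⟩, ⟨t5, t6⟩, t7, t8⟩ := hτ'
  have hd0 : dir 0 = 1 := by apply Complex.ext <;> simp [dir]
  obtain ⟨u, hu⟩ : ∃ u : ℂ, u = (τ : ℂ) * dir (a / 2) := ⟨_, rfl⟩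
  have hbs : Real.sin b = Real.sin a * Real.cos c + Real.cos a * Real.sin c := by
    rw [show b = Real.pi - (a + c) by linarith, Real.sin_pi_sub, Real.sin_add]
  have hBC : (Real.sin b : ℂ) * dir a - (Real.sin c : ℂ) * dir 0
      = (Real.sin a : ℂ) * dir (a + c) := by
    have s := Real.sin_sq_add_cos_sq a
    rw [hd0, hbs]
    apply Complex.ext
    · simp only [dir, sub_re, mul_re, ofReal_re, ofReal_im, one_re, one_im, Real.cos_add]
      linear_combination Real.sin c * s
    · simp only [dir, sub_im, mul_im, ofReal_re, ofReal_im, one_re, one_im, Real.sin_add]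
      ring
  have nn : ∀ ρ θ : ℝ, 0 < ρ → ‖(ρ : ℂ) * dir θ‖ = ρ := by
    intro ρ θ hρ
    rw [norm_mul, Complex.norm_real, Real.norm_of_nonneg hρ.le]
    have : ‖dir θ‖ = 1 := by
      have h : ‖dir θ‖ ^ 2 = 1 := by
        rw [← Complex.normSq_eq_norm_sq, Complex.normSq_apply]
        simp only [dir]
        linarith [Real.sin_sq_add_cos_sq θ]
      exact (pow_eq_one_iff_of_nonneg (norm_nonneg _) two_ne_zero).1 h
    rw [this, mul_one]
  have near : ∀ ρ θ : ℝ, 0 < ρ → τ < ρ * Real.cos (a / 2 - θ) →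
      ‖(ρ : ℂ) * dir θ - u‖ < ρ := by
    intro ρ θ hρ h
    refine lt_of_lt_of_eq ?_ (nn ρ θ hρ)
    rw [norm_lt_norm_iff, hu]
    rw [Real.cos_sub] at h
    have s := Real.sin_sq_add_cos_sq (a / 2)
    have h' := mul_lt_mul_of_pos_left h hτ
    simp only [dir, sub_re, sub_im, mul_re, mul_im, ofReal_re, ofReal_im, zero_mul, sub_zero,
      add_zero]
    have : τ * τ = τ * τ * (Real.sin (a / 2) ^ 2 + Real.cos (a / 2) ^ 2) := by rw [s, mul_one]
    nlinarith [mul_pos hτ hτ]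
  have pos : ∀ ρ θ φ : ℝ, τ < ρ * Real.cos (θ - φ) → 0 ≤ dot ((ρ : ℂ) * dir θ - u) (dir φ) := by
    intro ρ θ φ h
    rw [dot_sub_left, hu, dot_smul_dir, dot_smul_dir]
    have := mul_le_of_le_one_right hτ.le (Real.cos_le_one (a / 2 - φ))
    linarith
  have neg : ∀ ρ θ φ x : ℝ, 0 < ρ → 0 < Real.cos x → θ - φ = x - Real.pi →
      dot ((ρ : ℂ) * dir θ) (dir φ) < 0 := by
    intro ρ θ φ x hρ hx h
    rw [dot_smul_dir, h, Real.cos_sub_pi]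
    linarith [mul_pos hρ hx]
  have neg' : ∀ ρ θ φ x : ℝ, 0 < ρ → 0 < Real.cos x → θ - φ = x →
      dot (-((ρ : ℂ) * dir θ)) (dir φ) < 0 := by
    intro ρ θ φ x hρ hx h
    rw [dot_neg_left, dot_smul_dir, h]
    linarith [mul_pos hρ hx]
  have nB := near (Real.sin c) 0 sc (by rwa [sub_zero])
  have nC := near (Real.sin b) a sb (by
    rwa [show a / 2 - a = -(a / 2) by ring, Real.cos_neg])
  have nA : ‖-u‖ = τ := by rw [norm_neg, hu, nn τ _ hτ]
  have ne_of_norm : ∀ (ρ θ : ℝ), τ < ρ → (ρ : ℂ) * dir θ - u ≠ 0 := by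
    intro ρ θ h h0
    rw [sub_eq_zero] at h0
    have := congrArg norm h0
    rw [nn ρ θ (hτ.trans h), hu, nn τ _ hτ] at this
    exact h.ne' this
  refine hw.draw_of_points hT hf₁ hf₂ hf₃ (-u) ((Real.sin c : ℂ) * dir 0 - u)
    ((Real.sin b : ℂ) * dir a - u) (a / 2 + Real.pi - c₁ / 2) (-b / 2 - c₂ / 2)
    (a + c / 2 - c₃ / 2) ⟨?_, ?_, ?_⟩ ⟨ne_of_norm _ _ t1, ?_, ?_⟩ ⟨ne_of_norm _ _ t2, ?_, ?_⟩
    ⟨?_, ?_, ?_⟩ ⟨?_, ?_, ?_⟩ ⟨?_, ?_, ?_⟩ ⟨?_, ?_, ?_⟩ ⟨?_, ?_, ?_⟩ ⟨?_, ?_, ?_⟩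
  all_goals try simp only [sub_neg_eq_add, sub_add_cancel, sub_sub_sub_cancel_right, hBC]
  · rw [← norm_ne_zero_iff, nA]; exact hτ.ne'
  · rw [dot_neg_left, hu, dot_smul_dir,
      show a / 2 - (a / 2 + Real.pi - c₁ / 2) = c₁ / 2 - Real.pi by ring, Real.cos_sub_pi]
    linarith [mul_nonneg hτ.le A3]
  · rw [dot_neg_left, hu, dot_smul_dir,
      show a / 2 - (a / 2 + Real.pi - c₁ / 2 + c₁) = -(c₁ / 2) - Real.pi by ring, Real.cos_sub_pi,
      Real.cos_neg]
    linarith [mul_nonneg hτ.le A3]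
  · refine pos _ _ _ ?_
    rwa [show 0 - (-b / 2 - c₂ / 2) = b / 2 + c₂ / 2 by ring]
  · refine pos _ _ _ ?_
    rwa [show 0 - (-b / 2 - c₂ / 2 + c₂) = b / 2 - c₂ / 2 by ring]
  · refine pos _ _ _ ?_
    rwa [show a - (a + c / 2 - c₃ / 2) = -(c / 2 - c₃ / 2) by ring, Real.cos_neg]
  · refine pos _ _ _ ?_
    rwa [show a - (a + c / 2 - c₃ / 2 + c₃) = -(c / 2 + c₃ / 2) by ring, Real.cos_neg]
  · rw [nA, show -u - ((Real.sin c : ℂ) * dir 0 - u) = -((Real.sin c : ℂ) * dir 0) by ring,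
      norm_neg, nn _ _ sc]
    exact t1
  · exact neg _ _ _ (-(a / 2 - c₁ / 2)) sc (by rwa [Real.cos_neg]) (by ring)
  · exact neg _ _ _ (-(a / 2 + c₁ / 2)) sc (by rwa [Real.cos_neg]) (by ring)
  · rw [nA, show -u - ((Real.sin b : ℂ) * dir a - u) = -((Real.sin b : ℂ) * dir a) by ring,
      norm_neg, nn _ _ sb]
    exact t2
  · exact neg _ _ _ (a / 2 + c₁ / 2) sb A1 (by ring)
  · exact neg _ _ _ (a / 2 - c₁ / 2) sb A2 (by ring)
  · rwa [nn _ _ sc]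
  · rw [show -u - ((Real.sin c : ℂ) * dir 0 - u) = -((Real.sin c : ℂ) * dir 0) by ring]
    exact neg' _ _ _ _ sc B1 (by ring)
  · rw [show -u - ((Real.sin c : ℂ) * dir 0 - u) = -((Real.sin c : ℂ) * dir 0) by ring]
    exact neg' _ _ _ _ sc B2 (by ring)
  · rw [← neg_sub ((Real.sin b : ℂ) * dir a), norm_neg, hBC, nn _ _ sa]
    exact nB.trans_le sca
  · rw [dot_smul_dir, show a + c - (-b / 2 - c₂ / 2) = Real.pi - (b / 2 - c₂ / 2) by linarith,
      Real.cos_pi_sub]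
    linarith [mul_pos sa B2]
  · rw [dot_smul_dir, show a + c - (-b / 2 - c₂ / 2 + c₂) = Real.pi - (b / 2 + c₂ / 2) by linarith,
      Real.cos_pi_sub]
    linarith [mul_pos sa B1]
  · rwa [nn _ _ sb]
  · rw [show -u - ((Real.sin b : ℂ) * dir a - u) = -((Real.sin b : ℂ) * dir a) by ring]
    exact neg' _ _ _ (-(c / 2 - c₃ / 2)) sb (by rwa [Real.cos_neg]) (by ring)
  · rw [show -u - ((Real.sin b : ℂ) * dir a - u) = -((Real.sin b : ℂ) * dir a) by ring]
    exact neg' _ _ _ (-(c / 2 + c₃ / 2)) sb (by rwa [Real.cos_neg]) (by ring)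
  · rw [nn _ _ sa]
    exact nC.trans_le sba
  · rw [← neg_sub ((Real.sin b : ℂ) * dir a), hBC]
    exact neg' _ _ _ (c / 2 + c₃ / 2) sa C1 (by ring)
  · rw [← neg_sub ((Real.sin b : ℂ) * dir a), hBC]
    exact neg' _ _ _ (c / 2 - c₃ / 2) sa C2 (by ring)

/-- Three rooted subtrees at a vertex can be drawn together if the sectors that they need add up to
less than a full turn. -/
theorem Claw.hasGreedyDrawing [Finite V] (hw : Claw T v w₁ w₂ w₃) (hT : T.IsTree) {c₁ c₂ c₃ : ℝ}
    (hf₁ : FitsSector T v w₁ c₁) (hf₂ : FitsSector T v w₂ c₂) (hf₃ : FitsSector T v w₃ c₃)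
    (h₁ : 0 ≤ c₁) (h₂ : 0 ≤ c₂) (h₃ : 0 ≤ c₃) (k₁ : c₁ < Real.pi) (k₂ : c₂ < Real.pi)
    (k₃ : c₃ < Real.pi) (hsum : c₁ + c₂ + c₃ < 2 * Real.pi) : HasGreedyDrawing T := by
  have hpi := Real.pi_pos
  -- The triangle has angles proportional to the opening angles `π - cᵢ`.
  obtain ⟨t, ht⟩ : ∃ t, t = Real.pi / (3 * Real.pi - (c₁ + c₂ + c₃)) := ⟨_, rfl⟩
  have hS : Real.pi < 3 * Real.pi - (c₁ + c₂ + c₃) := by linarith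
  have ht0 : 0 < t := by rw [ht]; exact div_pos hpi (by linarith)
  have ht1 : t < 1 := by rw [ht, div_lt_one (by linarith)]; exact hS
  have hts : t * (Real.pi - c₁) + t * (Real.pi - c₂) + t * (Real.pi - c₃) = Real.pi := by
    have : t * (3 * Real.pi - (c₁ + c₂ + c₃)) = Real.pi := by
      rw [ht]; exact div_mul_cancel₀ _ (by linarith)
    linarith
  have p₁ : 0 < t * (Real.pi - c₁) := mul_pos ht0 (by linarith)
  have p₂ : 0 < t * (Real.pi - c₂) := mul_pos ht0 (by linarith)
  have p₃ : 0 < t * (Real.pi - c₃) := mul_pos ht0 (by linarith)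
  have q₁ : t * (Real.pi - c₁) + c₁ < Real.pi := by nlinarith
  have q₂ : t * (Real.pi - c₂) + c₂ < Real.pi := by nlinarith
  have q₃ : t * (Real.pi - c₃) + c₃ < Real.pi := by nlinarith
  rcases le_total c₁ c₂ with l | l
  · rcases le_total c₁ c₃ with l' | l'
    · exact hw.draw_of_triangle hT hf₁ hf₂ hf₃ p₁ p₂ p₃ (by linarith) (by gcongr) (by gcongr)
        h₁ h₂ h₃ q₁ q₂ q₃
    · exact hw.rotate.rotate.draw_of_triangle hT hf₃ hf₁ hf₂ p₃ p₁ p₂ (by linarith) (by gcongr)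
        (by gcongr; linarith) h₃ h₁ h₂ q₃ q₁ q₂
  · rcases le_total c₂ c₃ with l' | l'
    · exact hw.rotate.draw_of_triangle hT hf₂ hf₃ hf₁ p₂ p₃ p₁ (by linarith) (by gcongr)
        (by gcongr) h₂ h₃ h₁ q₂ q₃ q₁
    · exact hw.rotate.rotate.draw_of_triangle hT hf₃ hf₁ hf₂ p₃ p₁ p₂ (by linarith)
        (by gcongr; linarith) (by gcongr) h₃ h₁ h₂ q₃ q₁ q₂

end Join

end GreedyTree

namespace GreedyTree

/-! ### Terminal vertices and independent triples -/

section Terminal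

variable {V : Type*} {T : SimpleGraph V}

/-- No vertex of the side of `v` of the edge `rv` has degree 3; when no degree exceeds 3, the side
is then a path hanging at `r`. -/
def PathSide (T : SimpleGraph V) (r v : V) : Prop := ∀ t ∈ side T r v, (T.neighborSet t).ncard ≠ 3

/-- A vertex of degree 3 at which at least two paths hang: an end of the smallest subtree that
contains all the vertices of degree 3. -/
def IsTerminal (T : SimpleGraph V) (x : V) : Prop :=
  (T.neighborSet x).ncard = 3 ∧
    ∃ w w', w ≠ w' ∧ T.Adj x w ∧ T.Adj x w' ∧ PathSide T x w ∧ PathSide T x w'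

/-- The number of terminal vertices on the side of `v` of the edge `rv`. -/
noncomputable def terminalCount (T : SimpleGraph V) (r v : V) : ℕ :=
  ({x | IsTerminal T x} ∩ side T r v).ncard

theorem Claw.ncard {v w₁ w₂ w₃ : V} (h : Claw T v w₁ w₂ w₃) : (T.neighborSet v).ncard = 3 := by
  rw [Set.ncard_eq_three]
  refine ⟨w₁, w₂, w₃, h.ne₁₂, h.ne₁₃, h.ne₂₃, ?_⟩
  ext u
  constructor
  · exact fun hu => h.eq u hu
  · rintro (rfl | rfl | rfl)
    exacts [h.adj₁, h.adj₂, h.adj₃]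

theorem exists_claw {v : V} (h : (T.neighborSet v).ncard = 3) : ∃ w₁ w₂ w₃, Claw T v w₁ w₂ w₃ := by
  obtain ⟨x, y, z, h1, h2, h3, he⟩ := Set.ncard_eq_three.1 h
  have hmem : ∀ u, T.Adj v u ↔ u = x ∨ u = y ∨ u = z := fun u => by
    rw [← SimpleGraph.mem_neighborSet, he]; rfl
  exact ⟨x, y, z, (hmem x).2 (by tauto), (hmem y).2 (by tauto), (hmem z).2 (by tauto), h1, h2, h3,
    fun u hu => (hmem u).1 hu⟩

theorem Claw.branching {r v w₁ w₂ : V} (h : Claw T v r w₁ w₂) : Branching T r v w₁ w₂ :=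
  ⟨h.adj₂, h.adj₃, h.ne₁₂.symm, h.ne₁₃.symm, h.ne₂₃, h.eq⟩

theorem Branching.claw {r v w₁ w₂ : V} (h : Branching T r v w₁ w₂) (hr : T.Adj r v) :
    Claw T v r w₁ w₂ :=
  ⟨hr.symm, h.adj₁, h.adj₂, h.ne₁.symm, h.ne₂.symm, h.ne, h.eq⟩

theorem exists_branching {r v : V} (h : (T.neighborSet v).ncard = 3) (hr : T.Adj r v) :
    ∃ w₁ w₂, Branching T r v w₁ w₂ := by
  obtain ⟨x, y, z, hc⟩ := exists_claw h
  rcases hc.eq r hr.symm with rfl | rfl | rfl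
  · exact ⟨_, _, hc.branching⟩
  · exact ⟨_, _, hc.rotate.branching⟩
  · exact ⟨_, _, hc.rotate.rotate.branching⟩

/-- A directed edge of a tree of maximum degree 3 ends at a leaf, at a vertex of degree 2 or at a
branching. -/
theorem dart_cases [Finite V] (hdeg : ∀ v : V, (T.neighborSet v).ncard ≤ 3) {r v : V}
    (hr : T.Adj r v) :
    (((T.neighborSet v).ncard ≠ 3 ∧ ∀ u, T.Adj v u → u = r) ∨
      ((T.neighborSet v).ncard ≠ 3 ∧ ∃ w, T.Adj v w ∧ w ≠ r ∧ ∀ u, T.Adj v u → u = r ∨ u = w)) ∨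
      ∃ w₁ w₂, Branching T r v w₁ w₂ := by
  by_cases h3 : (T.neighborSet v).ncard = 3
  · exact Or.inr (exists_branching h3 hr)
  refine Or.inl ?_
  by_cases hl : ∀ u, T.Adj v u → u = r
  · exact Or.inl ⟨h3, hl⟩
  push Not at hl
  obtain ⟨w, hw, hwr⟩ := hl
  refine Or.inr ⟨h3, w, hw, hwr, fun u hu => ?_⟩
  by_contra hcon
  push Not at hcon
  have hsub : ({r, w, u} : Set V) ⊆ T.neighborSet v := by
    rintro _ (rfl | rfl | rfl)
    exacts [hr.symm, hw, hu]
  have h4 := Set.ncard_le_ncard hsub (Set.toFinite _)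
  rw [Set.ncard_eq_three.2 ⟨r, w, u, hwr.symm, hcon.1.symm, hcon.2.symm, rfl⟩] at h4
  have := hdeg v
  omega

theorem btw_of_sides (hT : T.IsTree) {x v p t : V} (hp : T.Adj v p) (hx : x ∈ side T v p)
    (ht : t ∉ side T v p) : Btw T x v t :=
  btw_of_forall_side hT fun u hu hxu => by rwa [step_unique hT hu hp hxu hx]

theorem side_eq_of_branching (hT : T.IsTree) {r v w₁ w₂ : V} (hr : T.Adj r v)
    (h : Branching T r v w₁ w₂) : side T r v = insert v (side T v w₁ ∪ side T v w₂) := by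
  ext t
  constructor
  · intro ht
    by_cases htv : t = v
    · exact Or.inl htv
    · obtain ⟨w, hw, hwr, htw⟩ := exists_child hT hr ht htv
      rcases (h.eq w hw).resolve_left hwr with rfl | rfl
      · exact Or.inr (Or.inl htw)
      · exact Or.inr (Or.inr htw)
  · rintro (rfl | ht | ht)
    · exact self_mem_side hr
    · exact side_subset_side hT hr h.adj₁ h.ne₁ ht
    · exact side_subset_side hT hr h.adj₂ h.ne₂ ht

theorem side_eq_of_unary (hT : T.IsTree) {r v w : V} (hr : T.Adj r v) (hw : T.Adj v w)
    (hwr : w ≠ r) (h : ∀ u, T.Adj v u → u = r ∨ u = w) : side T r v = insert v (side T v w) := by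
  ext t
  constructor
  · intro ht
    by_cases htv : t = v
    · exact Or.inl htv
    · obtain ⟨u, hu, hur, htu⟩ := exists_child hT hr ht htv
      exact Or.inr ((h u hu).resolve_left hur ▸ htu)
  · rintro (rfl | ht)
    · exact self_mem_side hr
    · exact side_subset_side hT hr hw hwr ht

theorem side_eq_of_leaf (hT : T.IsTree) {r v : V} (hr : T.Adj r v)
    (h : ∀ u, T.Adj v u → u = r) : side T r v = {v} := by
  ext t
  constructor
  · intro ht
    by_contra htv
    obtain ⟨u, hu, hur, -⟩ := exists_child hT hr ht htv
    exact hur (h u hu)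
  · rintro rfl
    exact self_mem_side hr

/-- Counting the elements of a set on the side of a branching. -/
theorem Branching.ncard_inter [Finite V] (hT : T.IsTree) {r v w₁ w₂ : V} (hr : T.Adj r v)
    (h : Branching T r v w₁ w₂) (S : Set V) :
    (S ∩ side T r v).ncard = (S ∩ {v}).ncard + (S ∩ side T v w₁).ncard
      + (S ∩ side T v w₂).ncard := by
  have hd := disjoint_side hT h.adj₁ h.adj₂ h.ne
  have h1 : S ∩ side T r v = S ∩ {v} ∪ (S ∩ side T v w₁ ∪ S ∩ side T v w₂) := by
    rw [side_eq_of_branching hT hr h, ← Set.inter_union_distrib_left,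
      ← Set.inter_union_distrib_left, Set.singleton_union]
  rw [h1, Set.ncard_union_eq, Set.ncard_union_eq, add_assoc]
  · exact hd.mono Set.inter_subset_right Set.inter_subset_right
  · rw [← Set.inter_union_distrib_left]
    refine Set.disjoint_left.2 fun t ht ht' => ?_
    obtain rfl : t = v := ht.2
    rcases ht'.2 with h | h <;> exact root_notMem_side h

theorem PathSide.child (hT : T.IsTree) {r v w : V} (hr : T.Adj r v) (hw : T.Adj v w) (hwr : w ≠ r)
    (h : PathSide T r v) : PathSide T v w := fun t ht =>
  h t (side_subset_side hT hr hw hwr ht)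

theorem exists_terminal [Finite V] (hT : T.IsTree) {r v : V} (hr : T.Adj r v)
    (h : ¬PathSide T r v) : ∃ x ∈ side T r v, IsTerminal T x := by
  -- A vertex of degree 3 as far as possible from `r` is terminal.
  unfold PathSide at h
  push Not at h
  obtain ⟨x, ⟨hx, hx3⟩, hmax⟩ := Set.exists_max_image
    {t | t ∈ side T r v ∧ (T.neighborSet t).ncard = 3} (fun t => T.dist r t) (Set.toFinite _) h
  have hxr : x ≠ r := by rintro rfl; exact root_notMem_side hx
  obtain ⟨p, hp, hrp⟩ := exists_step hT hxr
  obtain ⟨w₁, w₂, hB⟩ := exists_branching hx3 hp.symm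
  have key : ∀ w, T.Adj x w → w ≠ p → PathSide T x w := by
    intro w hw hwp t ht h3
    have hb : Btw T r x t := btw_of_sides hT hp hrp
      (Set.disjoint_left.1 (disjoint_side hT hw hp hwp) ht)
    have hbv := btw_of_mem_side hT hr hx
    have htv : t ∈ side T r v := by
      refine mem_side_of_btw hr ?_
      have := dist_tri hT v x t
      have := dist_tri hT r v t
      unfold Btw at *; omega
    have := hmax t ⟨htv, h3⟩
    have htx : x ≠ t := by rintro rfl; exact root_notMem_side ht
    have := dist_pos hT htx
    unfold Btw at hb
    omega
  exact ⟨x, hx, hx3, w₁, w₂, hB.ne, hB.adj₁, hB.adj₂, key _ hB.adj₁ hB.ne₁, key _ hB.adj₂ hB.ne₂⟩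

theorem terminalCount_eq_zero_iff [Finite V] (hT : T.IsTree) {r v : V} (hr : T.Adj r v) :
    terminalCount T r v = 0 ↔ PathSide T r v := by
  unfold terminalCount
  rw [Set.ncard_eq_zero (Set.toFinite _)]
  constructor
  · intro h
    by_contra hcon
    obtain ⟨x, hx, hxt⟩ := exists_terminal hT hr hcon
    exact Set.eq_empty_iff_forall_notMem.1 h x ⟨hxt, hx⟩
  · intro h
    refine Set.eq_empty_iff_forall_notMem.2 fun x hx => h x hx.2 hx.1.1

theorem terminalCount_add_reverse [Finite V] (hT : T.IsTree) {r v : V} (hr : T.Adj r v) :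
    terminalCount T r v + terminalCount T v r = {x | IsTerminal T x}.ncard := by
  unfold terminalCount
  rw [← Set.ncard_union_eq, ← Set.inter_union_distrib_left]
  · congr 1
    refine Set.inter_eq_left.2 fun t _ => ?_
    by_cases h : t ∈ side T r v
    · exact Or.inl h
    · exact Or.inr ((not_mem_side_iff hT hr).1 h)
  · exact Set.disjoint_left.2 fun t h h' => (not_mem_side_iff hT hr.symm).2 h.2 h'.2

theorem terminalCount_of_unary (hT : T.IsTree) {r v w : V} (hr : T.Adj r v) (hw : T.Adj v w)
    (hwr : w ≠ r) (h3 : (T.neighborSet v).ncard ≠ 3) (h : ∀ u, T.Adj v u → u = r ∨ u = w) :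
    terminalCount T r v = terminalCount T v w := by
  unfold terminalCount
  rw [side_eq_of_unary hT hr hw hwr h, Set.inter_insert_of_notMem]
  exact fun hv => h3 hv.1

theorem Branching.terminalCount_le [Finite V] (hT : T.IsTree) {r v w₁ w₂ : V} (hr : T.Adj r v)
    (h : Branching T r v w₁ w₂) :
    terminalCount T v w₁ + terminalCount T v w₂ ≤ terminalCount T r v := by
  have := h.ncard_inter hT hr {x | IsTerminal T x}
  unfold terminalCount
  omega

theorem Branching.terminalCount_of_not_terminal [Finite V] (hT : T.IsTree) {r v w₁ w₂ : V}
    (hr : T.Adj r v) (h : Branching T r v w₁ w₂) (hv : ¬IsTerminal T v) :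
    terminalCount T r v = terminalCount T v w₁ + terminalCount T v w₂ := by
  have := h.ncard_inter hT hr {x | IsTerminal T x}
  have h0 : ({x | IsTerminal T x} ∩ {v}).ncard = 0 := by
    rw [Set.ncard_eq_zero (Set.toFinite _)]
    exact Set.eq_empty_iff_forall_notMem.2 fun x hx => hv (hx.2 ▸ hx.1)
  unfold terminalCount
  omega

theorem Branching.terminalCount_of_terminal [Finite V] (hT : T.IsTree) {r v w₁ w₂ : V}
    (hr : T.Adj r v) (h : Branching T r v w₁ w₂) (hv : IsTerminal T v) :
    terminalCount T r v = 1 + terminalCount T v w₁ + terminalCount T v w₂ := by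
  have := h.ncard_inter hT hr {x | IsTerminal T x}
  have h0 : ({x | IsTerminal T x} ∩ {v}).ncard = 1 := by
    rw [Set.inter_eq_right.2 (by simpa using hv), Set.ncard_singleton]
  unfold terminalCount
  omega

/-- If the edge `rv` has a vertex of degree 3 on the side of `r`, then `v` is terminal if and only
if the two edges behind it lead to paths. -/
theorem Branching.isTerminal_iff {r v w₁ w₂ : V} (hr : T.Adj r v)
    (h : Branching T r v w₁ w₂) (hrev : ¬PathSide T v r) :
    IsTerminal T v ↔ PathSide T v w₁ ∧ PathSide T v w₂ := by
  constructor
  · rintro ⟨-, w, w', hne, hw, hw', hp, hp'⟩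
    have h1 : w ≠ r := by rintro rfl; exact hrev hp
    have h2 : w' ≠ r := by rintro rfl; exact hrev hp'
    rcases (h.eq w hw).resolve_left h1 with rfl | rfl <;>
    rcases (h.eq w' hw').resolve_left h2 with rfl | rfl
    · exact absurd rfl hne
    · exact ⟨hp, hp'⟩
    · exact ⟨hp', hp⟩
    · exact absurd rfl hne
  · rintro ⟨h1, h2⟩
    exact ⟨(h.claw hr).ncard, w₁, w₂, h.ne, h.adj₁, h.adj₂, h1, h2⟩

theorem eq_of_adj_of_side (hT : T.IsTree) {r v a b : V} (hr : T.Adj r v) (hab : T.Adj a b)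
    (ha : a ∈ side T r v) (hb : b ∉ side T r v) : a = v ∧ b = r := by
  have h1 := (btw_of_mem_side hT hr ha).symm
  have h2 := btw_of_mem_side hT hr.symm ((not_mem_side_iff hT hr).1 hb)
  have h3 := h1.trans_left hT h2 hr.ne.symm
  have h4 := SimpleGraph.dist_eq_one_iff_adj.2 hr.symm
  have h5 := SimpleGraph.dist_eq_one_iff_adj.2 hab
  unfold Btw at *
  exact ⟨(dist_zero_iff hT).1 (by omega), ((dist_zero_iff hT).1 (by omega)).symm⟩

theorem side_iff_of_reachable (hT : T.IsTree) {r v a b : V} (hr : T.Adj r v) {E : Set (Sym2 V)}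
    (hE : s(r, v) ∈ E) (h : (T.deleteEdges E).Reachable a b) :
    a ∈ side T r v ↔ b ∈ side T r v := by
  obtain ⟨p⟩ := h
  induction p with
  | nil => rfl
  | cons hadj p ih =>
    refine Iff.trans ?_ ih
    rw [SimpleGraph.deleteEdges_adj] at hadj
    constructor
    · intro ha
      by_contra hb
      obtain ⟨rfl, rfl⟩ := eq_of_adj_of_side hT hr hadj.1 ha hb
      exact hadj.2 (Sym2.eq_swap ▸ hE)
    · intro ha
      by_contra hb
      obtain ⟨rfl, rfl⟩ := eq_of_adj_of_side hT hr hadj.1.symm ha hb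
      exact hadj.2 hE

theorem reachable_of_side_iff (hT : T.IsTree) {a b : V} {E : Set (Sym2 V)}
    (h : ∀ r v, T.Adj r v → s(r, v) ∈ E → (a ∈ side T r v ↔ b ∈ side T r v)) :
    (T.deleteEdges E).Reachable a b := by
  induction hn : T.dist a b generalizing a with
  | zero =>
    obtain rfl := (dist_zero_iff hT).1 hn
    exact SimpleGraph.Reachable.refl _
  | succ n ih =>
    have hab : a ≠ b := by rintro rfl; simp at hn
    obtain ⟨u, hu, hbu⟩ := exists_step hT hab
    have hE : s(a, u) ∉ E := fun hE => root_notMem_side ((h a u hu hE).2 hbu)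
    have h1 : (T.deleteEdges E).Adj a u := SimpleGraph.deleteEdges_adj.2 ⟨hu, hE⟩
    refine h1.reachable.trans (ih (fun r v hrv hE' => ?_) ?_)
    · rw [← h r v hrv hE']
      constructor
      · intro ha
        by_contra hb
        obtain ⟨rfl, rfl⟩ := eq_of_adj_of_side hT hrv hu.symm ha hb
        exact hE hE'
      · intro ha
        by_contra hb
        obtain ⟨rfl, rfl⟩ := eq_of_adj_of_side hT hrv hu ha hb
        exact hE (Sym2.eq_swap ▸ hE')
    · rw [mem_side_iff hT hu] at hbu; omega

theorem IndependentTriples.notMem_side (hT : T.IsTree) {b x : V × V × V} {w : V}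
    (h : IndependentTriples T b x) (hw : T.Adj b.1 w) (hE : s(b.1, w) ∈ tripleBranches b) :
    x.1 ∉ side T b.1 w := fun hx =>
  root_notMem_side ((side_iff_of_reachable hT hw (Or.inl hE) h.2).2 hx)

theorem IndependentTriples.symm {b x : V × V × V} (h : IndependentTriples T b x) :
    IndependentTriples T x b :=
  ⟨h.1.symm, by rw [Set.union_comm]; exact h.2.symm⟩

/-- The maximum number of pairwise independent irreducible triples is the number of terminal
vertices. -/
theorem tripleNumber_eq [Fintype V] (hT : T.IsTree) :
    tripleNumber T = {x | IsTerminal T x}.ncard := by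
  classical
  have := hT.connected.nonempty
  apply le_antisymm
  · refine Finset.sup_le fun S hS => ?_
    obtain ⟨hirr, hind⟩ := (Finset.mem_filter.1 hS).2
    -- Each triple of the family is assigned a terminal vertex on its own side.
    have H : ∀ b ∈ S, ∃ t y, T.Adj t b.1 ∧ Branching T t b.1 b.2.1 b.2.2 ∧ y ∈ side T t b.1 ∧
        IsTerminal T y := by
      intro b hb
      obtain ⟨h3, hne, ha1, ha2, -⟩ := hirr b hb
      obtain ⟨u₁, u₂, hB⟩ := exists_branching h3 ha1.symm
      have hC := hB.claw ha1.symm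
      obtain ⟨t, hCt⟩ : ∃ t, Claw T b.1 t b.2.1 b.2.2 := by
        rcases hC.eq _ ha2 with h | h | h
        · exact absurd h.symm hne
        · exact ⟨u₂, h ▸ hC.rotate.rotate⟩
        · exact ⟨u₁, h ▸ hC.swap.rotate.rotate⟩
      have hnp : ¬PathSide T t b.1 := fun hp => hp b.1 (self_mem_side hCt.adj₁.symm) h3
      obtain ⟨y, hy, hyt⟩ := exists_terminal hT hCt.adj₁.symm hnp
      exact ⟨t, y, hCt.adj₁.symm, hCt.branching, hy, hyt⟩
    choose! t y ht hB hy hyt using H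
    have hinj : Set.InjOn y (S : Set (V × V × V)) := by
      intro b hb x hx hbx
      by_contra hne
      have hi := hind b hb x hx hne
      have hne1 : b.1 ≠ x.1 := fun h =>
        Set.disjoint_left.1 hi.1 (Or.inl rfl) (by rw [h]; exact Or.inl rfl)
      have key : ∀ b x, b ∈ S → x ∈ S → IndependentTriples T b x → b.1 ≠ x.1 →
          Btw T x.1 b.1 (y b) := by
        intro b x hb hx hi hne
        refine btw_of_sides hT (ht b hb).symm (p := t b) ?_
          ((not_mem_side_iff hT (ht b hb).symm).2 (hy b hb))
        obtain ⟨w, hw, hxw⟩ := exists_step hT hne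
        rcases (hB b hb).eq w hw with rfl | rfl | rfl
        · exact hxw
        · exact absurd hxw (hi.notMem_side hT hw (Or.inl rfl))
        · exact absurd hxw (hi.notMem_side hT hw (Or.inr rfl))
      have k1 := key b x hb hx hi hne1
      have k2 := key x b hx hb hi.symm hne1.symm
      rw [← hbx] at k2
      have := dist_pos hT hne1
      have := T.dist_comm (u := b.1) (v := x.1)
      unfold Btw at *
      omega
    rw [Set.ncard_eq_toFinset_card' {x | IsTerminal T x}]
    refine Finset.card_le_card_of_injOn y ?_ hinj
    intro b hb
    simpa using hyt b hb
  · choose! w w' hne hw hw' hp hp' using fun x (hx : IsTerminal T x) => hx.2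
    set f : V → V × V × V := fun x => (x, w x, w' x) with hf
    have hfinj : Function.Injective f := fun x x' h => congrArg Prod.fst h
    have hsides : ∀ x, IsTerminal T x → ∀ e ∈ tripleBranches (f x), ∃ u, T.Adj x u ∧
        PathSide T x u ∧ e = s(x, u) := by
      intro x hx e he
      rcases he with rfl | rfl
      · exact ⟨w x, hw x hx, hp x hx, rfl⟩
      · exact ⟨w' x, hw' x hx, hp' x hx, rfl⟩
    -- No vertex of degree 3 is separated from `x` by a branch of the triple at `x`.
    have hsep : ∀ x, IsTerminal T x → ∀ z, (T.neighborSet z).ncard = 3 → ∀ r v, T.Adj r v →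
        s(r, v) ∈ tripleBranches (f x) → (x ∈ side T r v ↔ z ∈ side T r v) := by
      intro x hx z hz r v hrv he
      obtain ⟨u, hu, hpu, he⟩ := hsides x hx _ he
      have hzu : z ∉ side T x u := fun h => hpu z h hz
      rcases Sym2.eq_iff.1 he with ⟨rfl, rfl⟩ | ⟨rfl, rfl⟩
      · exact ⟨fun h => absurd h root_notMem_side, fun h => absurd h hzu⟩
      · exact ⟨fun _ => (not_mem_side_iff hT hrv.symm).1 hzu, fun _ => self_mem_side hrv⟩
    have hnode : ∀ x, IsTerminal T x → ∀ n ∈ tripleNodes (f x), n = x ∨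
        (T.Adj x n ∧ PathSide T x n) := by
      rintro x hx n (rfl | rfl | rfl)
      · exact Or.inl rfl
      · exact Or.inr ⟨hw x hx, hp x hx⟩
      · exact Or.inr ⟨hw' x hx, hp' x hx⟩
    rw [Set.ncard_eq_toFinset_card' {x | IsTerminal T x},
      ← Finset.card_image_of_injective _ hfinj]
    refine Finset.le_sup (f := Finset.card) (Finset.mem_filter.2 ⟨Finset.mem_univ _, ?_, ?_⟩)
    · intro b hb
      obtain ⟨x, hx, rfl⟩ := Finset.mem_image.1 hb
      have hx : IsTerminal T x := by simpa using hx
      refine ⟨hx.1, hne x hx, hw x hx, hw' x hx, fun e he hcon => ?_⟩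
      obtain ⟨u, hu, -, rfl⟩ := hsides x hx e he
      exact root_notMem_side
        ((side_iff_of_reachable hT hu (Set.mem_singleton _) (hcon.preconnected x u)).2
          (self_mem_side hu))
    · intro b hb c hc hbc
      obtain ⟨x, hx, rfl⟩ := Finset.mem_image.1 hb
      obtain ⟨z, hz, rfl⟩ := Finset.mem_image.1 hc
      have hx : IsTerminal T x := by simpa using hx
      have hz : IsTerminal T z := by simpa using hz
      have hxz : x ≠ z := fun h => hbc (by rw [h])
      refine ⟨Set.disjoint_left.2 fun n hn hn' => ?_, reachable_of_side_iff hT ?_⟩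
      · rcases hnode x hx n hn with rfl | ⟨h1, h2⟩ <;> rcases hnode z hz n hn' with rfl | ⟨h3, h4⟩
        · exact hxz rfl
        · exact h4 n (self_mem_side h3) hx.1
        · exact h2 n (self_mem_side h1) hz.1
        · have hzn : z ∉ side T x n := fun h => h2 z h hz.1
          exact hxz (eq_of_adj_of_side hT h1 h3.symm (self_mem_side h1) hzn).2.symm
      · intro r v hrv he
        rcases he with he | he
        · exact hsep x hx z hz.1 r v hrv he
        · exact (hsep z hz x hx.1 r v hrv he).symm

end Terminal

end GreedyTree

namespace GreedyTree

/-! ### Drawing trees with few terminal vertices -/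

section Drawing

variable {V : Type*} {T : SimpleGraph V}

/-- Vertices separated from `r` by an edge `pq` which is itself separated from `r` by an edge
`rv`. -/
theorem side_subset_of_btw (hT : T.IsTree) {r v p q : V} (hr : T.Adj r v) (hp : T.Adj p q)
    (hq : q ∈ side T r v) (hb : Btw T r p q) : side T p q ⊆ side T r v := by
  intro t ht
  have h1 := btw_of_mem_side hT hp ht
  have h2 := hb.trans hT h1 hp.ne
  have h3 := btw_of_mem_side hT hr hq
  refine mem_side_of_btw hr ?_
  have := dist_tri hT v q t
  have := dist_tri hT r v t
  unfold Btw at *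
  omega

theorem side_subset_of_btw_reverse (hT : T.IsTree) {r v p q : V} (hr : T.Adj r v) (hp : T.Adj p q)
    (hq : q ∈ side T r v) (hb : Btw T r p q) : side T v r ⊆ side T q p := by
  intro t ht
  rw [← not_mem_side_iff hT hp]
  exact fun h => (not_mem_side_iff hT hr).2 ht (side_subset_of_btw hT hr hp hq hb h)

theorem PathSide.mono {r v p q : V} (h : PathSide T r v) (hs : side T p q ⊆ side T r v) :
    PathSide T p q := fun t ht => h t (hs ht)

theorem not_pathSide_of_ncard {v w : V} (h3 : (T.neighborSet v).ncard = 3) (hw : T.Adj v w) :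
    ¬PathSide T w v := fun h => h v (self_mem_side hw.symm) h3

theorem Claw.not_pathSide {v w₁ w₂ w₃ w : V} (h : Claw T v w₁ w₂ w₃) (hw : T.Adj v w) :
    ¬PathSide T w v := not_pathSide_of_ncard h.ncard hw

/-- The number of vertices of degree 3 on the side of `v` of the edge `rv`. -/
noncomputable def forkCount (T : SimpleGraph V) (r v : V) : ℕ :=
  ({x | (T.neighborSet x).ncard = 3} ∩ side T r v).ncard

theorem forkCount_of_unary (hT : T.IsTree) {r v w : V} (hr : T.Adj r v) (hw : T.Adj v w)
    (hwr : w ≠ r) (h3 : (T.neighborSet v).ncard ≠ 3) (h : ∀ u, T.Adj v u → u = r ∨ u = w) :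
    forkCount T r v = forkCount T v w := by
  unfold forkCount
  rw [side_eq_of_unary hT hr hw hwr h, Set.inter_insert_of_notMem]
  exact h3

variable [Finite V]

theorem terminalCount_mono {r v p q : V} (hs : side T p q ⊆ side T r v) :
    terminalCount T p q ≤ terminalCount T r v :=
  Set.ncard_le_ncard (Set.inter_subset_inter_right _ hs) (Set.toFinite _)

theorem Claw.terminalCount_le (hT : T.IsTree) {v w₁ w₂ w₃ : V} (h : Claw T v w₁ w₂ w₃) :
    terminalCount T v w₁ + terminalCount T v w₂ + terminalCount T v w₃ ≤
      {x | IsTerminal T x}.ncard := by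
  have h1 := terminalCount_add_reverse hT h.adj₁
  have h2 := h.branching.terminalCount_le hT h.adj₁.symm
  omega

/-- A property of directed edges that holds for `(r, v)` holds for an edge behind it such that it
holds for none of the next edges. -/
theorem exists_last_dart (hT : T.IsTree) (P : V → V → Prop) {r v : V} (hr : T.Adj r v)
    (h : P r v) : ∃ p q, T.Adj p q ∧ q ∈ side T r v ∧ Btw T r p q ∧ P p q ∧
      ∀ w, T.Adj q w → w ≠ p → ¬P q w := by
  refine dart_induction hT (P := fun r v => P r v → ∃ p q, T.Adj p q ∧ q ∈ side T r v ∧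
    Btw T r p q ∧ P p q ∧ ∀ w, T.Adj q w → w ≠ p → ¬P q w) ?_ r v hr h
  intro r v hr ih h
  by_cases hw : ∃ w, T.Adj v w ∧ w ≠ r ∧ P v w
  · obtain ⟨w, hw, hwr, hP⟩ := hw
    obtain ⟨p, q, h1, h2, h3, h4, h5⟩ := ih w hw hwr hP
    have h6 := side_subset_side hT hr hw hwr h2
    exact ⟨p, q, h1, h6, (btw_of_mem_side hT hr h6).sub_right hT h3, h4, h5⟩
  · push Not at hw
    exact ⟨r, v, hr, self_mem_side hr, btw_left r v, h, hw⟩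

theorem PathSide.fitsSector (hT : T.IsTree) (hdeg : ∀ v : V, (T.neighborSet v).ncard ≤ 3)
    {r v : V} (hr : T.Adj r v) (h : PathSide T r v) : FitsSector T r v 0 := by
  refine dart_induction hT (P := fun r v => PathSide T r v → FitsSector T r v 0) ?_ r v hr h
  intro r v hr ih h
  rcases dart_cases hdeg hr with (⟨-, hl⟩ | ⟨-, w, hw, hwr, hu⟩) | ⟨w₁, w₂, hB⟩
  · exact fitsSector_of_leaf hT hl 0
  · exact fitsSector_of_unary hT hw hwr hu le_rfl Real.pi_pos (ih w hw hwr (h.child hT hr hw hwr))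
  · exact absurd (hB.claw hr).ncard (h v (self_mem_side hr))

theorem forkCount_eq_zero {r v : V} (h : PathSide T r v) : forkCount T r v = 0 := by
  unfold forkCount
  rw [Set.ncard_eq_zero (Set.toFinite _)]
  exact Set.eq_empty_iff_forall_notMem.2 fun x hx => h x hx.2 hx.1

theorem Branching.forkCount (hT : T.IsTree) {r v w₁ w₂ : V} (hr : T.Adj r v)
    (h : Branching T r v w₁ w₂) :
    forkCount T r v = 1 + forkCount T v w₁ + forkCount T v w₂ := by
  have := h.ncard_inter hT hr {x | (T.neighborSet x).ncard = 3}
  have h0 : ({x | (T.neighborSet x).ncard = 3} ∩ {v}).ncard = 1 := by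
    rw [Set.inter_eq_right.2 (by simpa using (h.claw hr).ncard), Set.ncard_singleton]
  unfold GreedyTree.forkCount
  omega

/-- The angle that the edges of a subdivision of the caterpillar `Q_k` need: it is `π / 3` for
`k = 0`, and `legAngle (k + 1) = π / 4 + legAngle k / 2`. -/
noncomputable def legAngle (k : ℕ) : ℝ := Real.pi / 2 - Real.pi / 6 * (1 / 2) ^ k

theorem legAngle_zero : legAngle 0 = Real.pi / 3 := by unfold legAngle; ring

theorem legAngle_succ (k : ℕ) : legAngle (k + 1) = Real.pi / 4 + legAngle k / 2 := by
  unfold legAngle; ring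

theorem legAngle_lt (k : ℕ) : legAngle k < Real.pi / 2 := by
  unfold legAngle
  have : 0 < Real.pi / 6 * (1 / 2) ^ k := by have := Real.pi_pos; positivity
  linarith

theorem pi_div_three_le_legAngle (k : ℕ) : Real.pi / 3 ≤ legAngle k := by
  induction k with
  | zero => exact legAngle_zero.ge
  | succ k ih => rw [legAngle_succ]; linarith [legAngle_lt k, Real.pi_pos]

/-- A side with one terminal vertex is a caterpillar: it is drawn by adding its pendant paths one
by one. -/
theorem fitsSector_of_terminalCount_eq_one (hT : T.IsTree)
    (hdeg : ∀ v : V, (T.neighborSet v).ncard ≤ 3) {r v : V} (hr : T.Adj r v)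
    (hrev : ¬PathSide T v r) (h : terminalCount T r v = 1) {k : ℕ} (hk : forkCount T r v = k + 1)
    {c : ℝ} (hc : legAngle k < c) (hc' : c < Real.pi / 2) : FitsSector T r v c := by
  refine dart_induction hT (P := fun r v => ∀ k c, ¬PathSide T v r → terminalCount T r v = 1 →
    forkCount T r v = k + 1 → legAngle k < c → c < Real.pi / 2 → FitsSector T r v c) ?_ r v hr
    k c hrev h hk hc hc'
  clear! r v k c
  intro r v hr ih k c hrev h hk hc hc'
  have hpi := Real.pi_pos
  rcases dart_cases hdeg hr with (⟨h3, hl⟩ | ⟨h3, w, hw, hwr, hu⟩) | ⟨w₁, w₂, hB⟩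
  · exact fitsSector_of_leaf hT hl c
  · refine fitsSector_of_unary hT hw hwr hu (by linarith [pi_div_three_le_legAngle k])
      (by linarith) (ih w hw hwr k c (fun hp => hrev (hp.mono ?_)) ?_ ?_ hc hc')
    · exact side_subset_side hT hw.symm hr.symm hwr.symm
    · rw [← terminalCount_of_unary hT hr hw hwr h3 hu, h]
    · rw [← forkCount_of_unary hT hr hw hwr h3 hu, hk]
  · have h3 := (hB.claw hr).ncard
    by_cases hv : IsTerminal T v
    · obtain ⟨h1, h2⟩ := (hB.isTerminal_iff hr hrev).1 hv
      have h0 : k = 0 := by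
        have := hB.forkCount hT hr
        rw [forkCount_eq_zero h1, forkCount_eq_zero h2] at this
        omega
      subst h0
      rw [legAngle_zero] at hc
      exact hB.fits_path_path hT (h1.fitsSector hT hdeg hB.adj₁) (h2.fitsSector hT hdeg hB.adj₂) hc
        (by linarith)
    · have hsum := hB.terminalCount_of_not_terminal hT hr hv
      wlog h0 : terminalCount T v w₁ = 0 generalizing w₁ w₂
      · exact this w₂ w₁ hB.swap (by omega) (by omega)
      have hp := (terminalCount_eq_zero_iff hT hB.adj₁).1 h0
      have hf := hB.forkCount hT hr
      rw [forkCount_eq_zero hp] at hf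
      have hk0 : k ≠ 0 := by
        rintro rfl
        have : PathSide T v w₂ := fun t ht ht3 => by
          have : forkCount T v w₂ ≠ 0 := by
            unfold GreedyTree.forkCount
            rw [Ne, Set.ncard_eq_zero (Set.toFinite _)]
            exact Set.Nonempty.ne_empty ⟨t, ht3, ht⟩
          omega
        rw [← terminalCount_eq_zero_iff hT hB.adj₂] at this
        omega
      obtain ⟨k, rfl⟩ := Nat.exists_eq_succ_of_ne_zero hk0
      have hs := legAngle_succ k
      have h3k := pi_div_three_le_legAngle k
      simp only [Nat.succ_eq_add_one] at *
      refine hB.fits_path_small hT (hp.fitsSector hT hdeg hB.adj₁)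
        (ih w₂ hB.adj₂ hB.ne₂ k (c + legAngle (k + 1) - Real.pi / 2)
          (not_pathSide_of_ncard h3 hB.adj₂) (by omega) (by omega) ?_ ?_) ?_ ?_ hc' <;> linarith

/-- If all the terminal vertices behind the edge `rv` are behind an edge `pq` further away, then
only paths have to be added at the vertices between the two edges. -/
theorem fitsSector_of_terminalCount_eq (hT : T.IsTree)
    (hdeg : ∀ v : V, (T.neighborSet v).ncard ≤ 3) {r v p q : V} (hr : T.Adj r v)
    (hrev : ¬PathSide T v r) (hp : T.Adj p q) (hq : q ∈ side T r v) (hb : Btw T r p q)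
    (h : terminalCount T p q = terminalCount T r v) (hpq : ¬PathSide T p q) {c₀ : ℝ}
    (hc₀ : Real.pi / 2 ≤ c₀) (hf : ∀ c, c₀ < c → c < Real.pi → FitsSector T p q c) :
    ∀ c, c₀ < c → c < Real.pi → FitsSector T r v c := by
  refine dart_induction hT (P := fun r v => ¬PathSide T v r → q ∈ side T r v → Btw T r p q →
    terminalCount T p q = terminalCount T r v → ∀ c, c₀ < c → c < Real.pi → FitsSector T r v c) ?_
    r v hr hrev hq hb h
  clear! r v
  intro r v hr ih hrev hq hb h c hc hc'
  have hpi := Real.pi_pos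
  have hrp : Btw T r v q := btw_of_mem_side hT hr hq
  by_cases hqv : q = v
  · subst hqv
    rcases (by
      unfold Btw at hb
      rw [SimpleGraph.dist_eq_one_iff_adj.2 hr, SimpleGraph.dist_eq_one_iff_adj.2 hp] at hb
      exact (dist_zero_iff hT).1 (by omega) : r = p) with rfl
    exact hf c hc hc'
  obtain ⟨u, hu, hur, hqu⟩ := exists_child hT hr hq hqv
  have hvp : Btw T v p q := by
    have h1 := btw_of_mem_side hT hp (self_mem_side hp)
    unfold Btw at *
    rw [SimpleGraph.dist_eq_one_iff_adj.2 hr, SimpleGraph.dist_eq_one_iff_adj.2 hp] at *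
    have := dist_tri hT v p q
    have := dist_tri hT r v p
    have h2 := dist_adj_cases hT hr p
    rw [SimpleGraph.dist_eq_one_iff_adj.2 hp] at *
    rcases h2 with h2 | h2
    · omega
    · -- otherwise `p` is on the side of `r`, and `pq` is the edge `rv`
      exfalso
      have : p ∈ side T v r := by rw [mem_side_iff hT hr.symm]; exact h2
      exact hqv (eq_of_adj_of_side hT hr hp.symm hq ((not_mem_side_iff hT hr).2 this)).1
  have hle : terminalCount T p q ≤ terminalCount T v u :=
    terminalCount_mono (side_subset_of_btw hT hu hp hqu hvp)
  have hpos : terminalCount T v u ≠ 0 := by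
    have : terminalCount T p q ≠ 0 := fun h0 => hpq ((terminalCount_eq_zero_iff hT hp).1 h0)
    omega
  rcases dart_cases hdeg hr with (⟨h3, hl⟩ | ⟨h3, w, hw, hwr, hu'⟩) | ⟨w₁, w₂, hB⟩
  · exact fitsSector_of_leaf hT hl c
  · obtain rfl := (hu' u hu).resolve_left hur
    refine fitsSector_of_unary hT hw hwr hu' (by linarith) hc'
      (ih u hw hwr (fun hp => hrev (hp.mono ?_)) hqu hvp ?_ c hc hc')
    · exact side_subset_side hT hw.symm hr.symm hwr.symm
    · rw [h, terminalCount_of_unary hT hr hw hwr h3 hu']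
  · have h3 := (hB.claw hr).ncard
    wlog hw : u = w₂ generalizing w₁ w₂
    · exact this w₂ w₁ hB.swap ((hB.eq u hu).resolve_left hur |>.resolve_right hw)
    subst hw
    have hnt : terminalCount T r v = terminalCount T v w₁ + terminalCount T v u :=
      hB.terminalCount_of_not_terminal hT hr fun ht =>
        hpos ((terminalCount_eq_zero_iff hT hu).2 ((hB.isTerminal_iff hr hrev).1 ht).2)
    have hp1 := (terminalCount_eq_zero_iff hT hB.adj₁).1 (by omega)
    refine hB.fits_path_large hT (c₀ := (c₀ + c) / 2) (hp1.fitsSector hT hdeg hB.adj₁)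
      (ih u hu hur (not_pathSide_of_ncard h3 hu) hqu hvp (by omega) _ ?_ ?_) ?_ ?_ hc' <;> linarith

/-- The vertex `p`, reached from the neighbour `u` of `e`, branches into two sides with one terminal
vertex each, and there are no other terminal vertices behind the edge `eu`. -/
structure Fork (T : SimpleGraph V) (e u p a b : V) : Prop where
  adj : T.Adj e u
  mem : p ∈ side T e u
  adj_left : T.Adj p a
  adj_right : T.Adj p b
  ne : a ≠ b
  notMem_left : e ∉ side T p a
  notMem_right : e ∉ side T p b
  count : terminalCount T e u = 2
  count_left : terminalCount T p a = 1
  count_right : terminalCount T p b = 1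

theorem Fork.exists_branching (hT : T.IsTree) (hdeg : ∀ v : V, (T.neighborSet v).ncard ≤ 3)
    {e u p a b : V} (h : Fork T e u p a b) :
    ∃ t, T.Adj t p ∧ Btw T e t p ∧ Branching T t p a b := by
  have hpe : p ≠ e := by rintro rfl; exact root_notMem_side h.mem
  obtain ⟨t, ht, het⟩ := exists_step hT hpe
  have hta : a ≠ t := by rintro rfl; exact h.notMem_left het
  have htb : b ≠ t := by rintro rfl; exact h.notMem_right het
  refine ⟨t, ht.symm, (btw_of_mem_side hT ht het).symm, h.adj_left, h.adj_right, hta, htb, h.ne, ?_⟩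
  have h3 : ({t, a, b} : Set V) = T.neighborSet p := by
    refine Set.eq_of_subset_of_ncard_le ?_ ?_ (Set.toFinite _)
    · rintro _ (rfl | rfl | rfl)
      exacts [ht, h.adj_left, h.adj_right]
    · rw [Set.ncard_eq_three.2 ⟨t, a, b, hta.symm, htb.symm, h.ne, rfl⟩]
      exact hdeg p
  intro w hw
  have hw : w ∈ T.neighborSet p := hw
  rw [← h3] at hw
  exact hw

theorem Fork.fitsSector (hT : T.IsTree) (hdeg : ∀ v : V, (T.neighborSet v).ncard ≤ 3)
    {e u p a b : V} (h : Fork T e u p a b) (hrev : ¬PathSide T u e) {i j : ℕ}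
    (hi : forkCount T p a = i + 1) (hj : forkCount T p b = j + 1) :
    ∀ c, legAngle i + legAngle j < c → c < Real.pi → FitsSector T e u c := by
  obtain ⟨t, ht, hb, hB⟩ := h.exists_branching hT hdeg
  have h3 := (hB.claw ht).ncard
  have hi3 := pi_div_three_le_legAngle i
  have hj3 := pi_div_three_le_legAngle j
  have hi2 := legAngle_lt i
  have hj2 := legAngle_lt j
  have hpi := Real.pi_pos
  refine fitsSector_of_terminalCount_eq hT hdeg h.adj hrev ht h.mem hb ?_ ?_ (by linarith) ?_
  · have h1 := hB.terminalCount_le hT ht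
    have h2 := terminalCount_mono (side_subset_of_btw hT h.adj ht h.mem hb)
    rw [h.count_left, h.count_right] at h1
    rw [h.count] at *
    omega
  · exact not_pathSide_of_ncard h3 ht.symm
  · intro c hc hc'
    obtain ⟨ε, hε0, hε1, hε2, hε3⟩ : ∃ ε, 0 < ε ∧ 2 * ε < c - (legAngle i + legAngle j) ∧
        ε < Real.pi / 2 - legAngle i ∧ ε < Real.pi / 2 - legAngle j := by
      obtain ⟨ε, h0, h1⟩ := exists_between (a₁ := 0)
        (a₂ := min ((c - (legAngle i + legAngle j)) / 2)
        (min (Real.pi / 2 - legAngle i) (Real.pi / 2 - legAngle j)))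
        (lt_min (by linarith) (lt_min (by linarith) (by linarith)))
      rw [lt_min_iff, lt_min_iff] at h1
      exact ⟨ε, h0, by linarith [h1.1], h1.2.1, h1.2.2⟩
    refine hB.fits_add hT (c₁ := legAngle i + ε) (c₂ := legAngle j + ε)
      (fitsSector_of_terminalCount_eq_one hT hdeg h.adj_left
        (not_pathSide_of_ncard h3 h.adj_left) h.count_left hi ?_ ?_)
      (fitsSector_of_terminalCount_eq_one hT hdeg h.adj_right
        (not_pathSide_of_ncard h3 h.adj_right) h.count_right hj ?_ ?_) ?_ ?_ ?_ hc' <;> linarith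

theorem exists_forkCount (hT : T.IsTree) {r v : V} (hr : T.Adj r v)
    (h : terminalCount T r v ≠ 0) : ∃ k, forkCount T r v = k + 1 := by
  refine Nat.exists_eq_succ_of_ne_zero fun h0 => h ?_
  rw [terminalCount_eq_zero_iff hT hr]
  intro t ht h3
  unfold forkCount at h0
  rw [Set.ncard_eq_zero (Set.toFinite _)] at h0
  exact Set.eq_empty_iff_forall_notMem.1 h0 t ⟨h3, ht⟩

theorem exists_fork (hT : T.IsTree) (hdeg : ∀ v : V, (T.neighborSet v).ncard ≤ 3) {e u : V}
    (hu : T.Adj e u) (hrev : ¬PathSide T u e) (h : terminalCount T e u = 2) :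
    ∃ p a b, Fork T e u p a b := by
  obtain ⟨t, p, ht, hp, hb, h2, hlast⟩ :=
    exists_last_dart hT (fun r v => terminalCount T r v = 2) hu h
  have hrev' : ¬PathSide T p t := fun hps =>
    hrev (hps.mono (side_subset_of_btw_reverse hT hu ht hp hb))
  rcases dart_cases hdeg ht with (⟨h3, hl⟩ | ⟨h3, w, hw, hwr, hu'⟩) | ⟨w₁, w₂, hB⟩
  · have : PathSide T t p := by
      intro x hx
      rw [side_eq_of_leaf hT ht hl] at hx
      exact hx ▸ h3
    rw [← terminalCount_eq_zero_iff hT ht] at this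
    omega
  · exact absurd (terminalCount_of_unary hT ht hw hwr h3 hu' ▸ h2) (hlast w hw hwr)
  · have hnt : ¬IsTerminal T p := fun hp => by
      have := hB.terminalCount_of_terminal hT ht hp
      obtain ⟨h1, h2⟩ := (hB.isTerminal_iff ht hrev').1 hp
      rw [← terminalCount_eq_zero_iff hT hB.adj₁] at h1
      rw [← terminalCount_eq_zero_iff hT hB.adj₂] at h2
      omega
    have hsum := hB.terminalCount_of_not_terminal hT ht hnt
    have h1 := hlast w₁ hB.adj₁ hB.ne₁
    have h2 := hlast w₂ hB.adj₂ hB.ne₂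
    have he : e ∈ side T p t := mem_side_of_btw ht.symm hb.symm
    exact ⟨p, w₁, w₂, hu, hp, hB.adj₁, hB.adj₂, hB.ne,
      Set.disjoint_left.1 (disjoint_side hT ht.symm hB.adj₁ hB.ne₁.symm) he,
      Set.disjoint_left.1 (disjoint_side hT ht.symm hB.adj₂ hB.ne₂.symm) he, h, by omega, by omega⟩

/-- A side with at most two terminal vertices needs less than a right angle for each of them. -/
theorem exists_fitsSector (hT : T.IsTree) (hdeg : ∀ v : V, (T.neighborSet v).ncard ≤ 3) {r v : V}
    (hr : T.Adj r v) (hrev : ¬PathSide T v r) (h : terminalCount T r v ≤ 2) :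
    ∃ c, FitsSector T r v c ∧ 0 ≤ c ∧ c < Real.pi ∧ c ≤ terminalCount T r v * (Real.pi / 2) ∧
      (terminalCount T r v ≠ 0 → c < terminalCount T r v * (Real.pi / 2)) := by
  have hpi := Real.pi_pos
  obtain h | h | h : terminalCount T r v = 0 ∨ terminalCount T r v = 1 ∨
      terminalCount T r v = 2 := by omega
  · exact ⟨0, ((terminalCount_eq_zero_iff hT hr).1 h).fitsSector hT hdeg hr, le_rfl, hpi,
      by simp [h], fun h0 => absurd h h0⟩
  · obtain ⟨k, hk⟩ := exists_forkCount hT hr (by omega)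
    obtain ⟨c, h1, h2⟩ := exists_between (legAngle_lt k)
    have := pi_div_three_le_legAngle k
    refine ⟨c, fitsSector_of_terminalCount_eq_one hT hdeg hr hrev h hk h1 h2, ?_⟩
    rw [h]
    refine ⟨?_, ?_, ?_, fun _ => ?_⟩ <;> push_cast <;> linarith
  · obtain ⟨p, a, b, hF⟩ := exists_fork hT hdeg hr hrev h
    obtain ⟨i, hi⟩ := exists_forkCount hT hF.adj_left (by rw [hF.count_left]; omega)
    obtain ⟨j, hj⟩ := exists_forkCount hT hF.adj_right (by rw [hF.count_right]; omega)
    have hi2 := legAngle_lt i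
    have hj2 := legAngle_lt j
    have := pi_div_three_le_legAngle i
    have := pi_div_three_le_legAngle j
    obtain ⟨c, h1, h2⟩ := exists_between (show legAngle i + legAngle j < Real.pi by linarith)
    refine ⟨c, hF.fitsSector hT hdeg hrev hi hj c h1 h2, ?_⟩
    rw [h]
    refine ⟨?_, ?_, ?_, fun _ => ?_⟩ <;> push_cast <;> linarith

/-- A path is drawn on a line. -/
theorem hasGreedyDrawing_of_ncard_ne (hT : T.IsTree) (hdeg : ∀ v : V, (T.neighborSet v).ncard ≤ 3)
    (h : ∀ v, (T.neighborSet v).ncard ≠ 3) : HasGreedyDrawing T := by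
  obtain ⟨o⟩ := hT.connected.nonempty
  obtain ⟨r, -, hmax⟩ := Set.exists_max_image Set.univ (fun t => T.dist o t) (Set.toFinite _)
    ⟨o, trivial⟩
  -- A vertex `r` at maximal distance from some vertex has at most one neighbour.
  have hleaf : ∀ u, T.Adj r u → o ∈ side T r u := by
    intro u hu
    rw [mem_side, T.dist_comm (v := o), T.dist_comm (v := o)]
    have h1 : T.dist o u ≤ T.dist o r := hmax u trivial
    have h2 := dist_adj_cases hT hu o
    rw [T.dist_comm (v := o), T.dist_comm (u := u) (v := o)] at h2
    omega
  refine PartialDrawing.hasGreedyDrawing hT (v := r) (W := T.neighborSet r) (fun u hu => hu)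
    (partialDrawing_star hT (fun w hw => hw) (fun _ => 1) (fun _ => dir 0) (fun _ => dir 0) ?_ ?_
      ?_ ?_ ?_)
  · intro w hw
    exact PathSide.fitsSector hT hdeg hw (fun t _ => h t)
  · intro w _; exact one_ne_zero
  · intro w hw w' hw' hne
    exact absurd (step_unique hT hw hw' (hleaf w hw) (hleaf w' hw')) hne
  · intro w _
    have h0 : 0 ≤ dot 1 (dir 0) := by simp [dot, dir]
    exact ⟨h0, h0⟩
  · intro w hw w' hw' hne
    exact absurd (step_unique hT hw hw' (hleaf w hw) (hleaf w' hw')) hne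

/-- If there are at least three terminal vertices behind an edge, some vertex branches behind it
into two sides with at most two terminal vertices each. -/
theorem exists_centre (hT : T.IsTree) (hdeg : ∀ v : V, (T.neighborSet v).ncard ≤ 3) {r v : V}
    (hr : T.Adj r v) (h : 3 ≤ terminalCount T r v) :
    ∃ p q w₁ w₂, T.Adj p q ∧ Branching T p q w₁ w₂ ∧ 3 ≤ terminalCount T p q ∧
      terminalCount T q w₁ ≤ 2 ∧ terminalCount T q w₂ ≤ 2 := by
  obtain ⟨p, q, hp, -, -, h3, hlast⟩ :=
    exists_last_dart hT (fun r v => 3 ≤ terminalCount T r v) hr h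
  rcases dart_cases hdeg hp with (⟨hd, hl⟩ | ⟨hd, w, hw, hwr, hu'⟩) | ⟨w₁, w₂, hB⟩
  · have : PathSide T p q := by
      intro x hx
      rw [side_eq_of_leaf hT hp hl] at hx
      exact hx ▸ hd
    rw [← terminalCount_eq_zero_iff hT hp] at this
    omega
  · exact absurd (terminalCount_of_unary hT hp hw hwr hd hu' ▸ h3) (hlast w hw hwr)
  · have h1 := hlast w₁ hB.adj₁ hB.ne₁
    have h2 := hlast w₂ hB.adj₂ hB.ne₂
    exact ⟨p, q, w₁, w₂, hp, hB, h3, by omega, by omega⟩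

theorem hasGreedyDrawing_of_ncard_le_four (hT : T.IsTree)
    (hdeg : ∀ v : V, (T.neighborSet v).ncard ≤ 3) (hn : {x | IsTerminal T x}.ncard ≤ 4) :
    HasGreedyDrawing T := by
  by_cases h3 : ∀ v, (T.neighborSet v).ncard ≠ 3
  · exact hasGreedyDrawing_of_ncard_ne hT hdeg h3
  push Not at h3
  obtain ⟨v₀, hv₀⟩ := h3
  obtain ⟨v, w₁, w₂, w₃, hC, c1, c2, c3, hsum⟩ : ∃ v w₁ w₂ w₃, Claw T v w₁ w₂ w₃ ∧
      terminalCount T v w₁ ≤ 2 ∧ terminalCount T v w₂ ≤ 2 ∧ terminalCount T v w₃ ≤ 2 ∧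
      terminalCount T v w₁ + terminalCount T v w₂ + terminalCount T v w₃ ≤ 4 := by
    have hsum : ∀ v w₁ w₂ w₃, Claw T v w₁ w₂ w₃ →
        terminalCount T v w₁ + terminalCount T v w₂ + terminalCount T v w₃ ≤ 4 :=
      fun v w₁ w₂ w₃ hC => (hC.terminalCount_le hT).trans hn
    by_cases hbig : ∃ r v, T.Adj r v ∧ 3 ≤ terminalCount T r v
    · obtain ⟨r, v, hr, h⟩ := hbig
      obtain ⟨p, q, w₁, w₂, hp, hB, h3, h1, h2⟩ := exists_centre hT hdeg hr h
      have h4 := terminalCount_add_reverse hT hp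
      exact ⟨q, p, w₁, w₂, hB.claw hp, by omega, h1, h2, hsum _ _ _ _ (hB.claw hp)⟩
    · push Not at hbig
      obtain ⟨w₁, w₂, w₃, hC⟩ := exists_claw hv₀
      exact ⟨v₀, w₁, w₂, w₃, hC, Nat.le_of_lt_succ (hbig _ _ hC.adj₁),
        Nat.le_of_lt_succ (hbig _ _ hC.adj₂), Nat.le_of_lt_succ (hbig _ _ hC.adj₃), hsum _ _ _ _ hC⟩
  obtain ⟨a, ha, ha0, ha1, ha2, ha3⟩ :=
    exists_fitsSector hT hdeg hC.adj₁ (hC.not_pathSide hC.adj₁) c1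
  obtain ⟨b, hb, hb0, hb1, hb2, hb3⟩ :=
    exists_fitsSector hT hdeg hC.adj₂ (hC.not_pathSide hC.adj₂) c2
  obtain ⟨c, hc, hc0, hc1, hc2, hc3⟩ :=
    exists_fitsSector hT hdeg hC.adj₃ (hC.not_pathSide hC.adj₃) c3
  refine hC.hasGreedyDrawing hT ha hb hc ha0 hb0 hc0 ha1 hb1 hc1 ?_
  have hpi := Real.pi_pos
  have hs : (terminalCount T v w₁ : ℝ) + terminalCount T v w₂ + terminalCount T v w₃ ≤ 4 := by
    exact_mod_cast hsum
  have hs' := mul_le_mul_of_nonneg_right hs (show 0 ≤ Real.pi / 2 by linarith)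
  by_cases h0 : terminalCount T v w₁ = 0
  · by_cases h0' : terminalCount T v w₂ = 0
    · rw [h0] at ha2
      rw [h0'] at hb2
      push_cast at *
      linarith
    · have := hb3 h0'
      linarith
  · have := ha3 h0
    linarith

/-- Five caterpillars which need an angle of less than `2π` in total can be drawn around a centre
that has two of them behind each of two edges and the fifth behind the third edge. -/
theorem Claw.hasGreedyDrawing_of_forks (hT : T.IsTree)
    (hdeg : ∀ v : V, (T.neighborSet v).ncard ≤ 3) {e u₁ u₂ u₃ p₁ a₁ b₁ p₂ a₂ b₂ : V}
    (hC : Claw T e u₁ u₂ u₃) (h₁ : Fork T e u₁ p₁ a₁ b₁) (h₂ : Fork T e u₂ p₂ a₂ b₂)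
    (h₃ : terminalCount T e u₃ = 1) {i₁ j₁ i₂ j₂ k : ℕ} (hi₁ : forkCount T p₁ a₁ = i₁ + 1)
    (hj₁ : forkCount T p₁ b₁ = j₁ + 1) (hi₂ : forkCount T p₂ a₂ = i₂ + 1)
    (hj₂ : forkCount T p₂ b₂ = j₂ + 1) (hk : forkCount T e u₃ = k + 1)
    (hsum : legAngle i₁ + legAngle j₁ + legAngle i₂ + legAngle j₂ + legAngle k < 2 * Real.pi) :
    HasGreedyDrawing T := by
  have hpi := Real.pi_pos
  have l1 := legAngle_lt i₁
  have l2 := legAngle_lt j₁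
  have l3 := legAngle_lt i₂
  have l4 := legAngle_lt j₂
  have l5 := legAngle_lt k
  have m1 := pi_div_three_le_legAngle i₁
  have m2 := pi_div_three_le_legAngle j₁
  have m3 := pi_div_three_le_legAngle i₂
  have m4 := pi_div_three_le_legAngle j₂
  have m5 := pi_div_three_le_legAngle k
  obtain ⟨ε, h0, hε⟩ := exists_between (a₁ := 0) (a₂ := min
    ((2 * Real.pi - (legAngle i₁ + legAngle j₁ + legAngle i₂ + legAngle j₂ + legAngle k)) / 3)
    (min (Real.pi - (legAngle i₁ + legAngle j₁)) (min (Real.pi - (legAngle i₂ + legAngle j₂))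
      (Real.pi / 2 - legAngle k))))
    (lt_min (by linarith) (lt_min (by linarith) (lt_min (by linarith) (by linarith))))
  rw [lt_min_iff, lt_min_iff, lt_min_iff] at hε
  obtain ⟨e1, e2, e3, e4⟩ := hε
  refine hC.hasGreedyDrawing hT
    (h₁.fitsSector hT hdeg (hC.not_pathSide hC.adj₁) hi₁ hj₁ (legAngle i₁ + legAngle j₁ + ε) ?_ ?_)
    (h₂.fitsSector hT hdeg (hC.not_pathSide hC.adj₂) hi₂ hj₂ (legAngle i₂ + legAngle j₂ + ε) ?_ ?_)
    (fitsSector_of_terminalCount_eq_one hT hdeg hC.adj₃ (hC.not_pathSide hC.adj₃) h₃ hk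
      (c := legAngle k + ε) ?_ ?_) ?_ ?_ ?_ ?_ ?_ ?_ ?_ <;> linarith

end Drawing

end GreedyTree

namespace GreedyTree

/-! ### Angles occupied by a five-crab -/

section Necessity

variable {V : Type*} {T : SimpleGraph V} {z : V → ℂ}

theorem btw_of_adj_adj (hT : T.IsTree) {v a b : V} (ha : T.Adj v a) (hb : T.Adj v b) (h : a ≠ b) :
    Btw T a v b :=
  btw_of_sides hT ha (self_mem_side ha) fun h' => h (step_unique hT ha hb h' (self_mem_side hb))

theorem Claw.tripod (hT : T.IsTree) {v w₁ w₂ w₃ : V} (h : Claw T v w₁ w₂ w₃) :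
    Tripod T v w₁ w₂ w₃ :=
  ⟨h.adj₁.ne, h.adj₂.ne, h.adj₃.ne, btw_of_adj_adj hT h.adj₁ h.adj₂ h.ne₁₂,
    btw_of_adj_adj hT h.adj₁ h.adj₃ h.ne₁₃, btw_of_adj_adj hT h.adj₂ h.adj₃ h.ne₂₃⟩

/-- Every terminal vertex behind an edge contributes an angle of `π / 3`. -/
theorem occupies_terminalCount [Finite V] (hT : T.IsTree) (hz : PathDecreasing T z)
    (hdeg : ∀ v : V, (T.neighborSet v).ncard ≤ 3) {r v : V} (hr : T.Adj r v)
    (hrev : ¬PathSide T v r) : Occupies T z r v (terminalCount T r v * (Real.pi / 3)) := by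
  refine dart_induction hT (P := fun r v => ¬PathSide T v r →
    Occupies T z r v (terminalCount T r v * (Real.pi / 3))) ?_ r v hr hrev
  clear! r v
  intro r v hr ih hrev
  have h0 : ∀ r v, T.Adj r v → PathSide T r v → terminalCount T r v = 0 := fun r v hr =>
    (terminalCount_eq_zero_iff hT hr).2
  rcases dart_cases hdeg hr with (⟨h3, hl⟩ | ⟨h3, w, hw, hwr, hu⟩) | ⟨w₁, w₂, hB⟩
  · have : PathSide T r v := by
      intro x hx
      rw [side_eq_of_leaf hT hr hl] at hx
      exact hx ▸ h3
    rw [h0 r v hr this]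
    simpa using occupies_zero hz hr.ne
  · rw [terminalCount_of_unary hT hr hw hwr h3 hu]
    exact (ih w hw hwr fun hp => hrev
      (hp.mono (side_subset_side hT hw.symm hr.symm hwr.symm))).extend hT hz hr.ne hw.ne
      (btw_of_adj_adj hT hr.symm hw hwr.symm)
  · have h3 := (hB.claw hr).ncard
    have ht := (hB.claw hr).tripod hT
    by_cases hv : IsTerminal T v
    · obtain ⟨h1, h2⟩ := (hB.isTerminal_iff hr hrev).1 hv
      rw [hB.terminalCount_of_terminal hT hr hv, h0 _ _ hB.adj₁ h1, h0 _ _ hB.adj₂ h2]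
      simpa using ht.occupies_base hT hz
    · have := ht.occupies_add hT hz (ih w₁ hB.adj₁ hB.ne₁ (not_pathSide_of_ncard h3 hB.adj₁))
        (ih w₂ hB.adj₂ hB.ne₂ (not_pathSide_of_ncard h3 hB.adj₂))
      rw [hB.terminalCount_of_not_terminal hT hr hv]
      push_cast
      rwa [add_mul]

theorem PathDecreasing.ncard_terminal_le [Finite V] (hT : T.IsTree) (hz : PathDecreasing T z)
    (hdeg : ∀ v : V, (T.neighborSet v).ncard ≤ 3) : {x | IsTerminal T x}.ncard ≤ 5 := by
  by_contra hcon
  obtain ⟨v, hv⟩ : {x | IsTerminal T x}.Nonempty := by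
    rw [Set.nonempty_iff_ne_empty]
    intro h
    rw [h, Set.ncard_empty] at hcon
    omega
  obtain ⟨h3, w, w', hne, hw, hw', hp, hp'⟩ := id hv
  obtain ⟨t, u, hB⟩ := exists_branching h3 hw.symm
  -- The third neighbour `t` of `v`.
  obtain ⟨t, ht, hB⟩ : ∃ t, T.Adj t v ∧ Branching T t v w w' := by
    have hC := hB.claw hw.symm
    rcases (hC.eq w' hw').resolve_left hne.symm with rfl | rfl
    · exact ⟨u, hC.adj₃.symm, hC.rotate.rotate.branching⟩
    · exact ⟨t, hC.adj₂.symm, hC.swap.rotate.rotate.branching⟩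
  have h1 := hB.terminalCount_of_terminal hT ht hv
  rw [(terminalCount_eq_zero_iff hT hw).2 hp, (terminalCount_eq_zero_iff hT hw').2 hp'] at h1
  have h2 := terminalCount_add_reverse hT ht
  have h4 := occupies_terminalCount hT hz hdeg ht.symm (not_pathSide_of_ncard h3 ht.symm)
  have h5 := h4.add_lt_two_pi hT hz ht.ne.symm (((hB.claw ht).tripod hT).occupies_base hT hz)
  have h6 : (5 : ℝ) ≤ terminalCount T v t := by exact_mod_cast (by omega : 5 ≤ terminalCount T v t)
  nlinarith [Real.pi_pos]

/-- The vertices `b 0, …, b (k + 2)` and `c 0, …, c k` are placed like the vertices of `Q_k`. -/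
def IsLeg (T : SimpleGraph V) (k : ℕ) (b c : ℕ → V) : Prop :=
  ∀ j ≤ k, Tripod T (b (j + 1)) (b j) (b (j + 2)) (c j)

theorem IsLeg.occupies (hT : T.IsTree) (hz : PathDecreasing T z) {k : ℕ} {b c : ℕ → V}
    (h : IsLeg T k b c) : Occupies T z (b 0) (b 1) (legAngle k) := by
  induction k generalizing b c with
  | zero =>
    rw [legAngle_zero]
    exact (h 0 le_rfl).occupies_base hT hz
  | succ k ih =>
    have h1 : IsLeg T k (fun j => b (j + 1)) (fun j => c (j + 1)) := fun j hj =>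
      h (j + 1) (by omega)
    rw [legAngle_succ]
    exact (h 0 (by omega)).occupies_pendant hT hz (ih h1) (legAngle_lt k).le

/-- The position in `T` of the nodes of a five-crab with centre `e`, hubs `p` and `q` and legs
`b i`, `c i`. The pendant edges of the arms are left out. -/
structure IsCrab (T : SimpleGraph V) (k : Fin 5 → ℕ) (e p q : V) (b c : Fin 5 → ℕ → V) : Prop where
  root : b 0 0 = p ∧ b 1 0 = p ∧ b 2 0 = q ∧ b 3 0 = q ∧ b 4 0 = e
  leg : ∀ i, IsLeg T (k i) (b i) (c i)
  left : Tripod T p e (b 0 1) (b 1 1)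
  right : Tripod T q e (b 2 1) (b 3 1)
  centre : Tripod T e p q (b 4 1)

theorem IsCrab.mono {k k' : Fin 5 → ℕ} {e p q : V} {b c : Fin 5 → ℕ → V}
    (h : IsCrab T k e p q b c) (hk : ∀ i, k' i ≤ k i) : IsCrab T k' e p q b c :=
  ⟨h.root, fun i j hj => h.leg i j (hj.trans (hk i)), h.left, h.right, h.centre⟩

theorem IsCrab.sum_legAngle_lt (hT : T.IsTree) (hz : PathDecreasing T z) {k : Fin 5 → ℕ}
    {e p q : V} {b c : Fin 5 → ℕ → V} (h : IsCrab T k e p q b c) :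
    ∑ i, legAngle (k i) < 2 * Real.pi := by
  obtain ⟨h0, h1, h2, h3, h4⟩ := h.root
  have o0 := (h.leg 0).occupies hT hz
  have o1 := (h.leg 1).occupies hT hz
  have o2 := (h.leg 2).occupies hT hz
  have o3 := (h.leg 3).occupies hT hz
  have o4 := (h.leg 4).occupies hT hz
  rw [h0] at o0
  rw [h1] at o1
  rw [h2] at o2
  rw [h3] at o3
  rw [h4] at o4
  have := (h.left.occupies_add hT hz o0 o1).add_lt_two_pi hT hz h.left.ne_x.symm
    (h.centre.occupies_add hT hz (h.right.occupies_add hT hz o2 o3) o4)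
  rw [Fin.sum_univ_five]
  linarith

theorem sum_legAngle_lt_iff (k : Fin 5 → ℕ) :
    ∑ i, legAngle (k i) < 2 * Real.pi ↔ 3 < ∑ i, (1 / 2 : ℝ) ^ k i := by
  have hpi := Real.pi_pos
  have h : ∑ i, legAngle (k i) = 5 * (Real.pi / 2) - Real.pi / 6 * ∑ i, (1 / 2 : ℝ) ^ k i := by
    simp only [legAngle, Finset.sum_sub_distrib, Finset.mul_sum]
    simp
  rw [h]
  constructor
  · intro h; nlinarith
  · intro h; nlinarith

theorem sum_eq_of_orders {k : Fin 5 → ℕ} {s : Multiset ℕ} (h : orders k = s) (f : ℕ → ℝ) :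
    ∑ i, f (k i) = (s.map f).sum := by
  rw [← h, orders, Multiset.map_map]
  rfl

end Necessity

/-! ### Subdivisions in trees -/

section Subdivision

variable {V W : Type*} {T : SimpleGraph V} {H : SimpleGraph W}

theorem path_unique (hT : T.IsTree) {x y : V} {p q : T.Walk x y} (hp : p.IsPath) (hq : q.IsPath) :
    p = q :=
  congrArg Subtype.val ((hT.isAcyclic.subsingleton_path x y).elim ⟨p, hp⟩ ⟨q, hq⟩)

theorem length_eq_dist (hT : T.IsTree) {x y : V} (p : T.Walk x y) (hp : p.IsPath) :
    p.length = T.dist x y := by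
  obtain ⟨q, hq, hql⟩ := hT.connected.exists_path_of_dist x y
  rw [← hql, path_unique hT hp hq]

theorem mem_support_iff (hT : T.IsTree) {x y w : V} (p : T.Walk x y) (hp : p.IsPath) :
    w ∈ p.support ↔ Btw T x w y := by
  classical
  constructor
  · intro hw
    have h1 := congrArg SimpleGraph.Walk.length (p.take_spec hw)
    rw [SimpleGraph.Walk.length_append, length_eq_dist hT p hp,
      length_eq_dist hT _ (hp.takeUntil hw), length_eq_dist hT _ (hp.dropUntil hw)] at h1
    exact h1
  · intro h
    obtain ⟨q, -, hql⟩ := hT.connected.exists_path_of_dist x w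
    obtain ⟨r, -, hrl⟩ := hT.connected.exists_path_of_dist w y
    have h1 : (q.append r).IsPath := by
      apply SimpleGraph.Walk.isPath_of_length_eq_dist
      rw [SimpleGraph.Walk.length_append, hql, hrl]
      exact h
    rw [path_unique hT hp h1]
    simp [SimpleGraph.Walk.mem_support_append_iff]

theorem mem_edges_iff (hT : T.IsTree) {x y u w : V} (p : T.Walk x y) (hp : p.IsPath)
    (h : T.Adj u w) : s(u, w) ∈ p.edges ↔ Btw T x u y ∧ Btw T x w y := by
  constructor
  · intro he
    exact ⟨(mem_support_iff hT p hp).1 (p.fst_mem_support_of_mem_edges he),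
      (mem_support_iff hT p hp).1 (p.snd_mem_support_of_mem_edges he)⟩
  · rintro ⟨hu, hw⟩
    have hd := dist_adj_cases hT h x
    rw [T.dist_comm (u := u), T.dist_comm (u := w)] at hd
    wlog hlt : T.dist x w = T.dist x u + 1 generalizing u w
    · rw [Sym2.eq_swap]
      exact this h.symm hw hu hd.symm (hd.resolve_right hlt)
    obtain ⟨q, -, hql⟩ := hT.connected.exists_path_of_dist x u
    obtain ⟨r, -, hrl⟩ := hT.connected.exists_path_of_dist w y
    have h1 : (q.append (.cons h r)).IsPath := by
      apply SimpleGraph.Walk.isPath_of_length_eq_dist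
      rw [SimpleGraph.Walk.length_append, SimpleGraph.Walk.length_cons, hql, hrl]
      unfold Btw at hw
      omega
    rw [path_unique hT hp h1]
    simp

theorem SubdivisionIn.btw (hT : T.IsTree) (f : SubdivisionIn H T) {a b c : W} (hab : H.Adj a b)
    (hbc : H.Adj b c) (hac : a ≠ c) : Btw T (f.node a) (f.node b) (f.node c) := by
  refine btw_of_forall_side hT fun u hu ha hc => ?_
  -- The two paths at `b` would share the vertex `u`.
  have h1 : u ∈ (f.path hab).support :=
    (mem_support_iff hT _ (f.isPath hab)).2 (btw_of_mem_side hT hu ha).symm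
  have h2 : u ∈ (f.path hbc).support :=
    (mem_support_iff hT _ (f.isPath hbc)).2 (btw_of_mem_side hT hu hc)
  have hne : s(a, b) ≠ s(b, c) := by
    intro h
    rcases Sym2.eq_iff.1 h with ⟨h, -⟩ | ⟨h, -⟩
    · exact hab.ne h
    · exact hac h
  obtain ⟨x, rfl⟩ := f.disjoint hab hbc hne u h1 h2
  have hxb : x ≠ b := by rintro rfl; exact hu.ne rfl
  rcases f.node_mem hab x h1 with h | h
  · rcases f.node_mem hbc x h2 with h' | h'
    · exact hxb h'
    · exact hac (h.symm.trans h')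
  · exact hxb h

end Subdivision

end GreedyTree

namespace GreedyTree

/-! ### The nodes of a subdivided five-crab -/

section CrabSubdivision

variable {V W : Type*} {T : SimpleGraph V} {H : SimpleGraph W}

theorem btw_chain (hT : T.IsTree) (v : ℕ → V) (n : ℕ) (hne : ∀ j ≤ n, v j ≠ v (j + 1))
    (hb : ∀ j < n, Btw T (v j) (v (j + 1)) (v (j + 2))) :
    Btw T (v 0) (v 1) (v (n + 1)) ∧ Btw T (v 0) (v n) (v (n + 1)) := by
  induction n with
  | zero => exact ⟨btw_right _ _, btw_left _ _⟩
  | succ n ih =>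
    obtain ⟨h1, h2⟩ := ih (fun j hj => hne j (by omega)) (fun j hj => hb j (by omega))
    have h3 := h2.trans hT (hb n (by omega)) (hne n (by omega))
    refine ⟨?_, h3⟩
    have := dist_tri hT (v 1) (v (n + 1)) (v (n + 2))
    have := dist_tri hT (v 0) (v 1) (v (n + 2))
    change Btw T (v 0) (v 1) (v (n + 2))
    unfold Btw at *
    omega

theorem SubdivisionIn.btw_chain (hT : T.IsTree) (f : SubdivisionIn H T) (s : ℕ → W) (n : ℕ)
    (hadj : ∀ j ≤ n, H.Adj (s j) (s (j + 1))) (hne : ∀ j < n, s j ≠ s (j + 2)) :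
    Btw T (f.node (s 0)) (f.node (s 1)) (f.node (s (n + 1))) ∧
      Btw T (f.node (s 0)) (f.node (s n)) (f.node (s (n + 1))) :=
  GreedyTree.btw_chain hT (fun j => f.node (s j)) n
    (fun j hj h => (hadj j hj).ne (f.node_injective h))
    (fun j hj => f.btw hT (hadj j hj.le) (hadj (j + 1) hj) (hne j hj))

/-- In a subdivision, an arm `u 0, …, u l, e` of the body of a crab is a path. -/
theorem SubdivisionIn.btw_arm (hT : T.IsTree) (f : SubdivisionIn H T) {l : ℕ}
    (u : Fin (l + 1) → W) (hu : Function.Injective u) (e : W) (he : ∀ i, u i ≠ e)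
    (hadj : ∀ i : Fin l, H.Adj (u i.castSucc) (u i.succ)) (hlast : H.Adj (u (Fin.last l)) e) :
    Btw T (f.node (u 0)) (f.node (u (Fin.last l))) (f.node e) ∧
      ∀ x, H.Adj x (u 0) → (∀ i, u i ≠ x) → e ≠ x →
        Btw T (f.node x) (f.node (u 0)) (f.node e) := by
  set s : ℕ → W := fun j => if h : j < l + 1 then u ⟨j, h⟩ else e with hs
  have s0 : s 0 = u 0 := by simp [hs]
  have sl : s l = u (Fin.last l) := by simp [hs, Fin.last]
  have se : s (l + 1) = e := by simp [hs]
  have hsadj : ∀ j ≤ l, H.Adj (s j) (s (j + 1)) := by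
    intro j hj
    rcases hj.lt_or_eq with hj | rfl
    · have h1 := hadj ⟨j, hj⟩
      simp only [hs, show j < l + 1 by omega, show j + 1 < l + 1 by omega, dif_pos]
      exact h1
    · rw [sl, se]; exact hlast
  have hsne : ∀ j < l, s j ≠ s (j + 2) := by
    intro j hj
    by_cases h2 : j + 2 < l + 1
    · simp only [hs, show j < l + 1 by omega, h2, dif_pos]
      exact fun h => by simpa using hu h
    · simp only [hs, show j < l + 1 by omega, h2, dif_pos, dif_neg, not_false_iff]
      exact he _
  refine ⟨?_, fun x hx hxu hxe => ?_⟩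
  · have := (f.btw_chain hT s l hsadj hsne).2
    rwa [s0, sl, se] at this
  · have := (f.btw_chain hT (fun j => Nat.casesOn j x s) (l + 1) ?_ ?_).1
    · simpa [s0, se] using this
    · rintro (_ | j) hj
      · simpa [s0] using hx
      · exact hsadj j (by omega)
    · rintro (_ | j) hj
      · show x ≠ s 1
        by_cases h1 : 1 < l + 1
        · simp only [hs, h1, dif_pos]
          exact (hxu _).symm
        · simp only [hs, h1, dif_neg, not_false_iff]
          exact hxe.symm
      · exact hsne j (by omega)

section Adjacency

variable {l m : ℕ} {k : Fin 5 → ℕ}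

theorem CrabEdge.adj {x y : CrabVertex l m k} (h : CrabEdge l m k x y) (hne : x ≠ y) :
    (fiveCrab l m k).Adj x y :=
  (SimpleGraph.fromRel_adj _ _ _).2 ⟨hne, Or.inl h⟩

theorem adj_leg (i : Fin 5) (j : Fin (k i + 1)) :
    (fiveCrab l m k).Adj (.leg i j.castSucc) (.leg i j.succ) :=
  (CrabEdge.leg i j).adj (by simp [Fin.ext_iff])

theorem adj_legLeaf (i : Fin 5) (j : Fin (k i + 1)) :
    (fiveCrab l m k).Adj (.leg i j.castSucc) (.legLeaf i j) :=
  (CrabEdge.legPendant i j).adj (by simp)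

end Adjacency

/-- The vertex `b_j` of the `i`-th leg of a five-crab; the value is meaningless for
`j > k i + 2`. -/
def legNode (l m : ℕ) (k : Fin 5 → ℕ) (i : Fin 5) : ℕ → CrabVertex l m k
  | 0 => hub l m k i
  | j + 1 => if h : j < k i + 2 then .leg i ⟨j, h⟩ else .centre

/-- The vertex `c_{j+1}` of the `i`-th leg of a five-crab; the value is meaningless for
`j > k i`. -/
def legLeafNode (l m : ℕ) (k : Fin 5 → ℕ) (i : Fin 5) (j : ℕ) : CrabVertex l m k :=
  if h : j < k i + 1 then .legLeaf i ⟨j, h⟩ else .centre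

theorem SubdivisionIn.isCrab (hT : T.IsTree) {l m : ℕ} {k : Fin 5 → ℕ}
    (f : SubdivisionIn (fiveCrab l m k) T) :
    IsCrab T k (f.node .centre) (f.node (.left 0)) (f.node (.right 0))
      (fun i j => f.node (legNode l m k i j)) (fun i j => f.node (legLeafNode l m k i j)) := by
  have hne : ∀ {x y}, x ≠ y → f.node x ≠ f.node y := fun h h' => h (f.node_injective h')
  have hub_ne : ∀ i j, hub l m k i ≠ .leg i j := fun i j => by unfold hub; split_ifs <;> simp
  have hub_ne' : ∀ i j, hub l m k i ≠ .legLeaf i j := fun i j => by unfold hub; split_ifs <;> simp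
  have h0 : (fiveCrab l m k).Adj (.left 0) (.leg 0 0) := hub_adj l m k 0
  have h1 : (fiveCrab l m k).Adj (.left 0) (.leg 1 0) := hub_adj l m k 1
  have h2 : (fiveCrab l m k).Adj (.right 0) (.leg 2 0) := hub_adj l m k 2
  have h3 : (fiveCrab l m k).Adj (.right 0) (.leg 3 0) := hub_adj l m k 3
  have h4 : (fiveCrab l m k).Adj .centre (.leg 4 0) := hub_adj l m k 4
  have hl : (fiveCrab l m k).Adj (.left (Fin.last l)) .centre := CrabEdge.leftCentre.adj (by simp)
  have hr : (fiveCrab l m k).Adj (.right (Fin.last m)) .centre := CrabEdge.rightCentre.adj (by simp)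
  obtain ⟨l1, l2⟩ := f.btw_arm hT (fun i => .left i) (fun i j h => by simpa using h) .centre
    (by simp) (fun i => (CrabEdge.left i).adj (by simp [Fin.ext_iff])) hl
  obtain ⟨r1, r2⟩ := f.btw_arm hT (fun i => .right i) (fun i j h => by simpa using h) .centre
    (by simp) (fun i => (CrabEdge.right i).adj (by simp [Fin.ext_iff])) hr
  have l3 := l1.trans hT (f.btw hT hl h4 (by simp)) (hne (by simp))
  have r3 := r1.trans hT (f.btw hT hr h4 (by simp)) (hne (by simp))
  have lr : Btw T (f.node (.left 0)) (f.node .centre) (f.node (.right 0)) := by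
    have h5 := l1.trans hT (f.btw hT hl hr.symm (by simp)) (hne (by simp))
    exact (r1.trans hT h5.symm (hne (by simp))).symm
  have b1 : ∀ i, legNode l m k i 1 = .leg i 0 := fun i => by simp [legNode]
  refine ⟨⟨rfl, rfl, rfl, rfl, rfl⟩, ?_, ?_, ?_, ?_⟩
  · intro i j hj
    have e1 : legNode l m k i (j + 1) = .leg i (⟨j, by omega⟩ : Fin (k i + 1)).castSucc := by
      simp [legNode, show j < k i + 2 by omega]
    have e2 : legNode l m k i (j + 2) = .leg i (⟨j, by omega⟩ : Fin (k i + 1)).succ := by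
      simp [legNode, show j + 1 < k i + 2 by omega]
    have e3 : legLeafNode l m k i j = .legLeaf i (⟨j, by omega⟩ : Fin (k i + 1)) := by
      simp [legLeafNode, show j < k i + 1 by omega]
    have a2 := adj_leg (l := l) (m := m) (k := k) i ⟨j, by omega⟩
    have a3 := adj_legLeaf (l := l) (m := m) (k := k) i ⟨j, by omega⟩
    have a1 : (fiveCrab l m k).Adj (legNode l m k i j) (legNode l m k i (j + 1)) ∧
        legNode l m k i j ≠ legNode l m k i (j + 2) ∧
        legNode l m k i j ≠ legLeafNode l m k i j := by
      rw [e1, e2, e3]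
      rcases j with _ | j
      · exact ⟨hub_adj l m k i, hub_ne i _, hub_ne' i _⟩
      · have e4 : legNode l m k i (j + 1) = .leg i (⟨j, by omega⟩ : Fin (k i + 1)).castSucc := by
          simp [legNode, show j < k i + 2 by omega]
        rw [e4]
        exact ⟨adj_leg (l := l) (m := m) (k := k) i ⟨j, by omega⟩, by simp [Fin.ext_iff]; omega,
          by simp⟩
    obtain ⟨a1, n2, n3⟩ := a1
    rw [← e1, ← e2] at a2
    rw [← e1, ← e3] at a3
    have n4 : legNode l m k i (j + 2) ≠ legLeafNode l m k i j := by rw [e2, e3]; simp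
    exact ⟨hne a1.symm.ne, hne a2.ne, hne a3.ne, f.btw hT a1 a2 n2, f.btw hT a1 a3 n3,
      f.btw hT a2.symm a3 n4⟩
  · simp only [b1]
    exact ⟨hne (by simp), hne (by simp), hne (by simp), (l2 _ h0.symm (by simp) (by simp)).symm,
      (l2 _ h1.symm (by simp) (by simp)).symm, f.btw hT h0.symm h1 (by simp)⟩
  · simp only [b1]
    exact ⟨hne (by simp), hne (by simp), hne (by simp), (r2 _ h2.symm (by simp) (by simp)).symm,
      (r2 _ h3.symm (by simp) (by simp)).symm, f.btw hT h2.symm h3 (by simp)⟩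
  · simp only [b1]
    exact ⟨hne (by simp), hne (by simp), hne (by simp), lr, l3, r3⟩

theorem HasGreedyDrawing.tripleNumber_le [Fintype V] (hT : T.IsTree)
    (hdeg : ∀ v : V, (T.neighborSet v).ncard ≤ 3) (h : HasGreedyDrawing T) :
    tripleNumber T ≤ 5 := by
  obtain ⟨z, hz⟩ := h.exists_pathDecreasing hT
  rw [tripleNumber_eq hT]
  exact hz.ncard_terminal_le hT hdeg

theorem HasGreedyDrawing.not_containsFiveCrabWith [Finite V] (hT : T.IsTree)
    (h : HasGreedyDrawing T) {s : Multiset ℕ} (hs : (s.map fun k => (1 / 2 : ℝ) ^ k).sum ≤ 3) :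
    ¬ContainsFiveCrabWith T s := by
  rintro ⟨l, m, k, hk, ⟨f⟩⟩
  obtain ⟨z, hz⟩ := h.exists_pathDecreasing hT
  have := (f.isCrab hT).sum_legAngle_lt hT hz
  rw [sum_legAngle_lt_iff, sum_eq_of_orders hk] at this
  linarith

end CrabSubdivision

end GreedyTree

namespace GreedyTree

/-! ### Constructing subdivisions in trees -/

section NodeMap

variable {V W : Type*} {T : SimpleGraph V} {H : SimpleGraph W} {n : W → V}

/-- Two adjacent vertices have different images, and at every vertex of `H` the images of its
neighbours lie in different directions. In a tree such a map of a connected graph extends to a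
subdivision. -/
structure IsNodeMap (H : SimpleGraph W) (T : SimpleGraph V) (n : W → V) : Prop where
  connected : H.Connected
  ne : ∀ a b, H.Adj a b → n a ≠ n b
  btw : ∀ a b c, H.Adj a b → H.Adj b c → a ≠ c → Btw T (n a) (n b) (n c)

theorem isNodeMap_of_tripod (hH : H.Connected)
    (h : ∀ b, (∃ x, n b ≠ n x ∧ ∀ a, H.Adj b a → a = x) ∨
      ∃ x y z, (∀ a, H.Adj b a → a = x ∨ a = y ∨ a = z) ∧ Tripod T (n b) (n x) (n y) (n z)) :
    IsNodeMap H T n := by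
  refine ⟨hH, fun a b hab => ?_, fun a b c hab hbc hac => ?_⟩
  · rcases h a with ⟨x, hx, hu⟩ | ⟨x, y, z, hu, ht⟩
    · rwa [hu b hab]
    · rcases hu b hab with rfl | rfl | rfl
      exacts [ht.ne_x, ht.ne_y, ht.ne_z]
  · rcases h b with ⟨x, hx, hu⟩ | ⟨x, y, z, hu, ht⟩
    · exact absurd ((hu a hab.symm).trans (hu c hbc).symm) hac
    · rcases hu a hab.symm with rfl | rfl | rfl <;> rcases hu c hbc with rfl | rfl | rfl
      exacts [absurd rfl hac, ht.xy, ht.xz, ht.xy.symm, absurd rfl hac, ht.yz, ht.xz.symm,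
        ht.yz.symm, absurd rfl hac]

namespace IsNodeMap

theorem btw_of_isPath (hT : T.IsTree) (hn : IsNodeMap H T n) {a b x : W} (h : H.Adj a b)
    (q : H.Walk b x) (hq : (SimpleGraph.Walk.cons h q).IsPath) : Btw T (n a) (n b) (n x) := by
  induction q generalizing a with
  | nil => exact btw_right _ _
  | @cons b c x h' q ih =>
    have hq' := SimpleGraph.Walk.cons_isPath_iff _ _ |>.1 hq
    have hac : a ≠ c := by
      rintro rfl
      exact hq'.2 (by simp)
    exact (hn.btw a b c h h' hac).trans_left hT (ih h' hq'.1) (hn.ne b c h')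

theorem injective (hT : T.IsTree) (hn : IsNodeMap H T n) :
    Function.Injective n := by
  intro a x hax
  by_contra hne
  obtain ⟨p, hp⟩ := hn.connected.exists_isPath a x
  cases p with
  | nil => exact hne rfl
  | @cons _ b _ h q =>
    have := hn.btw_of_isPath hT h q hp
    rw [← hax] at this
    exact hn.ne a b h (eq_of_btw_self hT this).symm

theorem btw_or_btw (hT : T.IsTree) (hn : IsNodeMap H T n) {a b : W} (h : H.Adj a b)
    (x : W) : Btw T (n a) (n b) (n x) ∨ Btw T (n b) (n a) (n x) := by
  obtain ⟨p, hp⟩ := hn.connected.exists_isPath a x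
  cases p with
  | nil => exact Or.inr (btw_right _ _)
  | @cons _ c _ h' q =>
    have h1 := hn.btw_of_isPath hT h' q hp
    by_cases hbc : b = c
    · subst hbc; exact Or.inl h1
    · exact Or.inr ((hn.btw b a c h.symm h' hbc).trans_left hT h1 (hn.ne a c h'))

theorem eq_or_eq_of_btw (hT : T.IsTree) (hn : IsNodeMap H T n) {a b c : W} (h : H.Adj a b)
    (hc : Btw T (n a) (n c) (n b)) :
    c = a ∨ c = b := by
  rcases hn.btw_or_btw hT h c with h1 | h1
  · exact Or.inr (hn.injective hT (btw_antisymm hT h1 hc).symm)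
  · exact Or.inl (hn.injective hT (btw_antisymm hT h1 hc.symm).symm)

theorem exists_node_of_btw (hT : T.IsTree) (hn : IsNodeMap H T n) {a b c d : W}
    (h : H.Adj a b) (h' : H.Adj c d) (hne : s(a, b) ≠ s(c, d)) {v : V}
    (hv : Btw T (n a) v (n b)) (hv' : Btw T (n c) v (n d)) : ∃ x, n x = v := by
  -- Both ends of one edge are on the same side of the other edge.
  wlog hc : Btw T (n a) (n b) (n c) generalizing a b
  · exact this h.symm (by rwa [Sym2.eq_swap]) hv.symm ((hn.btw_or_btw hT h c).resolve_left hc)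
  have hd : Btw T (n a) (n b) (n d) := by
    refine (hn.btw_or_btw hT h d).resolve_right fun hd => ?_
    have h1 : Btw T (n d) (n a) (n c) := hd.symm.trans_left hT hc (hn.ne a b h)
    have h2 : Btw T (n d) (n b) (n c) := hd.symm.trans hT hc (hn.ne a b h)
    rcases hn.eq_or_eq_of_btw hT h'.symm h1 with rfl | rfl <;>
    rcases hn.eq_or_eq_of_btw hT h'.symm h2 with rfl | rfl
    · exact h.ne rfl
    · exact hne Sym2.eq_swap
    · exact hne rfl
    · exact h.ne rfl
  refine ⟨b, ((dist_zero_iff hT).1 ?_)⟩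
  have h1 := dist_tri hT (n c) (n b) (n d)
  have h2 := dist_tri hT (n a) v (n c)
  have h3 := dist_tri hT (n a) v (n d)
  have h4 := T.dist_comm (u := n c) (v := v)
  have h5 := T.dist_comm (u := n c) (v := n b)
  have h6 := T.dist_comm (u := n b) (v := v)
  unfold Btw at *
  omega

end IsNodeMap

/-- The path between two vertices of a tree. -/
noncomputable def treePath (hT : T.IsTree) (x y : V) : T.Walk x y :=
  (hT.connected.exists_isPath x y).choose

theorem treePath_isPath (hT : T.IsTree) (x y : V) : (treePath hT x y).IsPath :=
  (hT.connected.exists_isPath x y).choose_spec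

/-- The subdivision with given nodes. -/
noncomputable def IsNodeMap.subdivision (hT : T.IsTree) (hn : IsNodeMap H T n) :
    SubdivisionIn H T where
  node := n
  node_injective := hn.injective hT
  path := fun {a b} _ => treePath hT (n a) (n b)
  isPath := fun _ => treePath_isPath hT _ _
  path_symm := fun _ => path_unique hT (treePath_isPath hT _ _) (treePath_isPath hT _ _).reverse
  node_mem := fun h _ hc =>
    hn.eq_or_eq_of_btw hT h ((mem_support_iff hT _ (treePath_isPath hT _ _)).1 hc)
  disjoint := fun h h' hne _ hv hv' => hn.exists_node_of_btw hT h h' hne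
    ((mem_support_iff hT _ (treePath_isPath hT _ _)).1 hv)
    ((mem_support_iff hT _ (treePath_isPath hT _ _)).1 hv')

/-- A subdivision is the whole tree if no edge of the tree leaves it at a node or elsewhere. -/
theorem IsNodeMap.spanning (hT : T.IsTree) (hn : IsNodeMap H T n) {a₀ b₀ : W} (h₀ : H.Adj a₀ b₀)
    (hnode : ∀ a y, T.Adj (n a) y → ∃ b, H.Adj a b ∧ Btw T (n a) y (n b))
    (hdeg : ∀ t, (∀ a, n a ≠ t) → ∀ u v w, T.Adj t u → T.Adj t v → T.Adj t w →
      u = v ∨ u = w ∨ v = w) : (hn.subdivision hT).Spanning := by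
  have key : ∀ x y a b, H.Adj a b → Btw T (n a) x (n b) → T.Adj x y →
      ∃ a b, H.Adj a b ∧ Btw T (n a) x (n b) ∧ Btw T (n a) y (n b) := by
    intro x y a b hab hx hxy
    by_cases hxn : ∃ c, n c = x
    · obtain ⟨c, rfl⟩ := hxn
      obtain ⟨d, hd, hb⟩ := hnode c y hxy
      exact ⟨c, d, hd, btw_left _ _, hb⟩
    push Not at hxn
    obtain ⟨u, hu, hau⟩ := exists_step hT (hxn a).symm
    obtain ⟨w, hw, hbw⟩ := exists_step hT (hxn b).symm
    have huw : u ≠ w := by rintro rfl; exact hx.mem_side hT hau hbw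
    refine ⟨a, b, hab, hx, ?_⟩
    rcases hdeg x hxn u w y hu hw hxy with h | h | h
    · exact absurd h huw
    · exact h ▸ (hx.symm.sub_right hT (btw_of_mem_side hT hu hau)).symm
    · exact h ▸ hx.sub_right hT (btw_of_mem_side hT hw hbw)
  have hall : ∀ x, ∃ a b, H.Adj a b ∧ Btw T (n a) x (n b) := by
    intro x
    obtain ⟨p⟩ := hT.connected.preconnected x (n a₀)
    generalize hy : n a₀ = y at p
    induction p with
    | nil => exact ⟨a₀, b₀, h₀, hy ▸ btw_left _ _⟩
    | cons h p ih =>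
      obtain ⟨a, b, hab, hb⟩ := ih hy
      obtain ⟨a, b, hab, -, hb⟩ := key _ _ a b hab hb h.symm
      exact ⟨a, b, hab, hb⟩
  constructor
  · intro x
    obtain ⟨a, b, hab, hb⟩ := hall x
    exact Or.inr ⟨a, b, hab, (mem_support_iff hT _ (treePath_isPath hT _ _)).2 hb⟩
  · intro e
    induction e with
    | h x y =>
      intro he
      obtain ⟨a, b, hab, hb⟩ := hall x
      obtain ⟨a, b, hab, hb⟩ := key x y a b hab hb he
      exact ⟨a, b, hab, (mem_edges_iff hT _ (treePath_isPath hT _ _) he).2 hb⟩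

end NodeMap

/-! ### Five-crabs with given nodes -/

section Crab

variable {V : Type*} {T : SimpleGraph V} {k : Fin 5 → ℕ}

theorem crabEdge_cases {l m : ℕ} {x y : CrabVertex l m k} (h : (fiveCrab l m k).Adj x y) :
    CrabEdge l m k x y ∨ CrabEdge l m k y x :=
  ((SimpleGraph.fromRel_adj _ _ _).1 h).2

theorem fiveCrab_adj_leg {i : Fin 5} {j : Fin (k i + 2)} {a : CrabVertex 0 0 k}
    (h : (fiveCrab 0 0 k).Adj (.leg i j) a) : (j.1 = 0 ∧ a = hub 0 0 k i) ∨
      (∃ j' : Fin (k i + 2), a = .leg i j' ∧ (j'.1 + 1 = j.1 ∨ j.1 + 1 = j'.1)) ∨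
      ∃ j' : Fin (k i + 1), a = .legLeaf i j' ∧ j'.1 = j.1 := by
  rcases crabEdge_cases h with h | h
  · generalize hb : CrabVertex.leg i j = b at h
    cases h <;> try simp at hb
    · unfold hub at hb; split_ifs at hb
    · obtain ⟨rfl, hb⟩ := hb
      exact Or.inr (Or.inl ⟨_, rfl, Or.inr (by simp [eq_of_heq hb])⟩)
    · obtain ⟨rfl, hb⟩ := hb
      exact Or.inr (Or.inr ⟨_, rfl, by simp [eq_of_heq hb]⟩)
  · generalize hb : CrabVertex.leg i j = b at h
    cases h <;> try simp at hb
    · obtain ⟨rfl, hb⟩ := hb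
      exact Or.inl ⟨by simp [eq_of_heq hb], rfl⟩
    · obtain ⟨rfl, hb⟩ := hb
      exact Or.inr (Or.inl ⟨_, rfl, Or.inl (by simp [eq_of_heq hb])⟩)

theorem fiveCrab_adj_legLeaf {i : Fin 5} {j : Fin (k i + 1)} {a : CrabVertex 0 0 k}
    (h : (fiveCrab 0 0 k).Adj (.legLeaf i j) a) : a = .leg i j.castSucc := by
  rcases crabEdge_cases h with h | h
  · generalize hb : CrabVertex.legLeaf i j = b at h
    cases h <;> try simp at hb
    unfold hub at hb; split_ifs at hb
  · generalize hb : CrabVertex.legLeaf i j = b at h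
    cases h <;> try simp at hb
    obtain ⟨rfl, hb⟩ := hb
    rw [eq_of_heq hb]

theorem fiveCrab_adj_left {i : Fin 1} {a : CrabVertex 0 0 k}
    (h : (fiveCrab 0 0 k).Adj (.left i) a) : a = .centre ∨ a = .leg 0 0 ∨ a = .leg 1 0 := by
  rcases crabEdge_cases h with h | h
  · generalize hb : CrabVertex.left i = b at h
    cases h with
    | left i => exact i.elim0
    | leftPendant i => exact i.elim0
    | leftCentre => exact Or.inl rfl
    | root i =>
      unfold hub at hb
      split_ifs at hb with h1
      rcases h1 with rfl | rfl
      exacts [Or.inr (Or.inl rfl), Or.inr (Or.inr rfl)]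
    | _ => simp at hb
  · generalize hb : CrabVertex.left i = b at h
    cases h with
    | left i => exact i.elim0
    | _ => simp at hb

theorem fiveCrab_adj_right {i : Fin 1} {a : CrabVertex 0 0 k}
    (h : (fiveCrab 0 0 k).Adj (.right i) a) : a = .centre ∨ a = .leg 2 0 ∨ a = .leg 3 0 := by
  rcases crabEdge_cases h with h | h
  · generalize hb : CrabVertex.right i = b at h
    cases h with
    | right i => exact i.elim0
    | rightPendant i => exact i.elim0
    | rightCentre => exact Or.inl rfl
    | root i =>
      unfold hub at hb
      split_ifs at hb with h1 h2
      rcases h2 with rfl | rfl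
      exacts [Or.inr (Or.inl rfl), Or.inr (Or.inr rfl)]
    | _ => simp at hb
  · generalize hb : CrabVertex.right i = b at h
    cases h with
    | right i => exact i.elim0
    | _ => simp at hb

theorem fiveCrab_adj_centre {a : CrabVertex 0 0 k} (h : (fiveCrab 0 0 k).Adj .centre a) :
    a = .left 0 ∨ a = .right 0 ∨ a = .leg 4 0 := by
  rcases crabEdge_cases h with h | h
  · generalize hb : (CrabVertex.centre : CrabVertex 0 0 k) = b at h
    cases h with
    | root i =>
      unfold hub at hb
      split_ifs at hb with h1 h2
      have : i = 4 := by omega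
      subst this
      exact Or.inr (Or.inr rfl)
    | _ => simp at hb
  · generalize hb : (CrabVertex.centre : CrabVertex 0 0 k) = b at h
    cases h with
    | leftCentre => exact Or.inl rfl
    | rightCentre => exact Or.inr (Or.inl rfl)
    | _ => simp at hb

theorem fiveCrab_connected (k : Fin 5 → ℕ) : (fiveCrab 0 0 k).Connected := by
  have hl : ∀ i, (fiveCrab 0 0 k).Reachable (.left i) .centre := fun i => by
    rw [Fin.fin_one_eq_zero i]
    exact (CrabEdge.leftCentre.adj (by simp)).reachable
  have hr : ∀ i, (fiveCrab 0 0 k).Reachable (.right i) .centre := fun i => by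
    rw [Fin.fin_one_eq_zero i]
    exact (CrabEdge.rightCentre.adj (by simp)).reachable
  have hhub : ∀ i, (fiveCrab 0 0 k).Reachable (hub 0 0 k i) .centre := fun i => by
    unfold hub
    split_ifs
    exacts [hl 0, hr 0, .refl _]
  have hleg : ∀ i j (hj : j < k i + 2), (fiveCrab 0 0 k).Reachable (.leg i ⟨j, hj⟩) .centre := by
    intro i j
    induction j with
    | zero => exact fun _ => (hub_adj 0 0 k i).symm.reachable.trans (hhub i)
    | succ j ih =>
      exact fun hj => (adj_leg i ⟨j, by omega⟩).symm.reachable.trans (ih (by omega))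
  have hall : ∀ x, (fiveCrab 0 0 k).Reachable x .centre := by
    rintro (_ | i | i | i | i | ⟨i, j⟩ | ⟨i, j⟩)
    · exact .refl _
    · exact hl i
    · exact i.elim0
    · exact hr i
    · exact i.elim0
    · exact hleg i j.1 j.2
    · exact (adj_legLeaf i j).symm.reachable.trans (hleg i _ _)
  exact { preconnected := fun x y => (hall x).trans (hall y).symm, nonempty := ⟨.centre⟩ }

/-- The position in the tree of the vertices of a five-crab without pendant edges on its arms. -/
def crabNode (e p q : V) (b c : Fin 5 → ℕ → V) : CrabVertex 0 0 k → V
  | .centre => e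
  | .left _ => p
  | .leftLeaf _ => e
  | .right _ => q
  | .rightLeaf _ => e
  | .leg i j => b i (j + 1)
  | .legLeaf i j => c i j

theorem IsCrab.isNodeMap {e p q : V} {b c : Fin 5 → ℕ → V} (h : IsCrab T k e p q b c) :
    IsNodeMap (fiveCrab 0 0 k) T (crabNode e p q b c) := by
  refine isNodeMap_of_tripod (fiveCrab_connected k) ?_
  have hhub : ∀ i, crabNode e p q b c (hub 0 0 k i) = b i 0 := by
    obtain ⟨h0, h1, h2, h3, h4⟩ := h.root
    intro i
    fin_cases i
    exacts [h0.symm, h1.symm, h2.symm, h3.symm, h4.symm]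
  rintro (_ | i | i | i | i | ⟨i, j⟩ | ⟨i, j⟩)
  · exact Or.inr ⟨.left 0, .right 0, .leg 4 0, fun a => fiveCrab_adj_centre, h.centre⟩
  · exact Or.inr ⟨.centre, .leg 0 0, .leg 1 0, fun a => fiveCrab_adj_left, h.left⟩
  · exact i.elim0
  · exact Or.inr ⟨.centre, .leg 2 0, .leg 3 0, fun a => fiveCrab_adj_right, h.right⟩
  · exact i.elim0
  · by_cases hj : j.1 = k i + 1
    · refine Or.inl ⟨.leg i ⟨k i, by omega⟩, ?_, fun a ha => ?_⟩
      · have := (h.leg i (k i) le_rfl).ne_y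
        show b i (j.1 + 1) ≠ b i (k i + 1)
        rw [hj]
        exact this.symm
      · rcases fiveCrab_adj_leg ha with ⟨h0, -⟩ | ⟨j', rfl, h1 | h1⟩ | ⟨j', rfl, h1⟩
        · omega
        · congr 1
          ext
          simp only
          omega
        · omega
        · omega
    · have hj' : j.1 ≤ k i := by omega
      have ht := h.leg i j.1 hj'
      have hnext : ∀ a, (∃ j' : Fin (k i + 2), a = CrabVertex.leg i j' ∧ j.1 + 1 = j'.1) →
          a = (.leg i ⟨j.1 + 1, by omega⟩ : CrabVertex 0 0 k) := by
        rintro _ ⟨j', rfl, h1⟩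
        congr 1
        ext
        exact h1.symm
      have hleaf : ∀ a, (∃ j' : Fin (k i + 1), a = CrabVertex.legLeaf i j' ∧ j'.1 = j.1) →
          a = (.legLeaf i ⟨j.1, by omega⟩ : CrabVertex 0 0 k) := by
        rintro _ ⟨j', rfl, h1⟩
        congr 1
        ext
        exact h1
      by_cases hj0 : j.1 = 0
      · refine Or.inr ⟨hub 0 0 k i, .leg i ⟨j.1 + 1, by omega⟩, .legLeaf i ⟨j.1, by omega⟩,
          fun a ha => ?_, ?_⟩
        · rcases fiveCrab_adj_leg ha with ⟨-, rfl⟩ | ⟨j', rfl, h1 | h1⟩ | h1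
          · exact Or.inl rfl
          · omega
          · exact Or.inr (Or.inl (hnext _ ⟨j', rfl, h1⟩))
          · exact Or.inr (Or.inr (hleaf _ h1))
        · rw [hhub]
          rw [hj0] at ht
          show Tripod T (b i (j.1 + 1)) (b i 0) (b i (j.1 + 2)) (c i j.1)
          rwa [hj0]
      · refine Or.inr ⟨.leg i ⟨j.1 - 1, by omega⟩, .leg i ⟨j.1 + 1, by omega⟩,
          .legLeaf i ⟨j.1, by omega⟩, fun a ha => ?_, ?_⟩
        · rcases fiveCrab_adj_leg ha with ⟨h0, rfl⟩ | ⟨j', rfl, h1 | h1⟩ | h1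
          · exact absurd h0 hj0
          · refine Or.inl ?_
            congr 1
            ext
            simp only
            omega
          · exact Or.inr (Or.inl (hnext _ ⟨j', rfl, h1⟩))
          · exact Or.inr (Or.inr (hleaf _ h1))
        · show Tripod T (b i (j.1 + 1)) (b i (j.1 - 1 + 1)) (b i (j.1 + 2)) (c i j.1)
          rwa [Nat.sub_add_cancel (by omega)]
  · refine Or.inl ⟨.leg i j.castSucc, ?_, fun a => fiveCrab_adj_legLeaf⟩
    exact (h.leg i j.1 (by omega)).ne_z.symm

end Crab

end GreedyTree

namespace GreedyTree

/-! ### Sides that are subdivided caterpillars -/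

section Leg

variable {V : Type*} {T : SimpleGraph V}

theorem Tripod.extend (hT : T.IsTree) {o x y z x' : V} (h : Tripod T o x y z)
    (hx : Btw T x' x o) (hx' : o ≠ x') : Tripod T o x' y z :=
  ⟨hx', h.ne_y, h.ne_z, hx.trans hT h.xy h.ne_x.symm, hx.trans hT h.xz h.ne_x.symm, h.yz⟩

theorem tripod_of_sides (hT : T.IsTree) {v a b c x y z : V} (ha : T.Adj v a) (hb : T.Adj v b)
    (hc : T.Adj v c) (hab : a ≠ b) (hac : a ≠ c) (hbc : b ≠ c) (hx : x ∈ side T v a)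
    (hy : y ∈ side T v b) (hz : z ∈ side T v c) : Tripod T v x y z := by
  have hne : ∀ {u t}, t ∈ side T v u → v ≠ t := by rintro u t h rfl; exact root_notMem_side h
  have hbt : ∀ {u u' t t'}, T.Adj v u → T.Adj v u' → u ≠ u' → t ∈ side T v u → t' ∈ side T v u' →
      Btw T t v t' := fun hu hu' h ht ht' =>
    btw_of_sides hT hu ht (Set.disjoint_right.1 (disjoint_side hT hu hu' h) ht')
  exact ⟨hne hx, hne hy, hne hz, hbt ha hb hab hx hy, hbt ha hc hac hx hz, hbt hb hc hbc hy hz⟩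

/-- The three edges at a vertex of degree 3 lead to the three ends of a tripod. -/
theorem Tripod.exists_claw [Finite V] (hT : T.IsTree) {o x y z : V} (h : Tripod T o x y z)
    (hdeg : (T.neighborSet o).ncard ≤ 3) :
    ∃ a b c, Claw T o a b c ∧ x ∈ side T o a ∧ y ∈ side T o b ∧ z ∈ side T o c := by
  obtain ⟨a, ha, hx⟩ := exists_step hT h.ne_x
  obtain ⟨b, hb, hy⟩ := exists_step hT h.ne_y
  obtain ⟨c, hc, hz⟩ := exists_step hT h.ne_z
  have hab : a ≠ b := by rintro rfl; exact h.xy.mem_side hT hx hy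
  have hac : a ≠ c := by rintro rfl; exact h.xz.mem_side hT hx hz
  have hbc : b ≠ c := by rintro rfl; exact h.yz.mem_side hT hy hz
  have h3 : ({a, b, c} : Set V) = T.neighborSet o := by
    refine Set.eq_of_subset_of_ncard_le ?_ ?_ (Set.toFinite _)
    · rintro _ (rfl | rfl | rfl)
      exacts [ha, hb, hc]
    · rwa [Set.ncard_eq_three.2 ⟨a, b, c, hab, hac, hbc, rfl⟩]
  refine ⟨a, b, c, ⟨ha, hb, hc, hab, hac, hbc, fun w hw => ?_⟩, hx, hy, hz⟩
  have hw : w ∈ T.neighborSet o := hw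
  rw [← h3] at hw
  exact hw

/-- `t` has at most one neighbour. -/
def IsEnd (T : SimpleGraph V) (t : V) : Prop := ∀ u w, T.Adj t u → T.Adj t w → u = w

theorem IsEnd.btw (hT : T.IsTree) {t y z : V} (h : IsEnd T t) (hy : T.Adj t y) (hz : t ≠ z) :
    Btw T t y z := by
  obtain ⟨u, hu, hzu⟩ := exists_step hT hz
  rw [h y u hy hu]
  exact btw_of_mem_side hT hu hzu

theorem eq_of_adj_of_ncard_ne [Finite V] {t u v w : V} (hdeg : (T.neighborSet t).ncard ≤ 3)
    (h3 : (T.neighborSet t).ncard ≠ 3) (hu : T.Adj t u) (hv : T.Adj t v) (hw : T.Adj t w) :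
    u = v ∨ u = w ∨ v = w := by
  by_contra hcon
  push Not at hcon
  have hsub : ({u, v, w} : Set V) ⊆ T.neighborSet t := by
    rintro _ (rfl | rfl | rfl)
    exacts [hu, hv, hw]
  have h4 := Set.ncard_le_ncard hsub (Set.toFinite _)
  rw [Set.ncard_eq_three.2 ⟨u, v, w, hcon.1, hcon.2.1, hcon.2.2, rfl⟩] at h4
  omega

theorem exists_isEnd [Finite V] (hT : T.IsTree) {r v : V} (hr : T.Adj r v) :
    ∃ t ∈ side T r v, IsEnd T t := by
  refine dart_induction hT (P := fun r v => ∃ t ∈ side T r v, IsEnd T t) ?_ r v hr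
  clear! r v
  intro r v hr ih
  by_cases h : ∀ u, T.Adj v u → u = r
  · exact ⟨v, self_mem_side hr, fun u w hu hw => (h u hu).trans (h w hw).symm⟩
  · push Not at h
    obtain ⟨w, hw, hwr⟩ := h
    obtain ⟨t, ht, hte⟩ := ih w hw hwr
    exact ⟨t, side_subset_side hT hr hw hwr ht, hte⟩

/-- A leg at `r` in the side of `v` of the edge `rv` whose outermost vertices are leaves of the tree
and which contains all the vertices of degree 3 of the side: the side is a subdivided `Q_k`. -/
structure IsWholeLeg (T : SimpleGraph V) (r v : V) (k : ℕ) (b c : ℕ → V) : Prop where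
  zero : b 0 = r
  isLeg : IsLeg T k b c
  mem_b : ∀ j ≤ k + 1, b (j + 1) ∈ side T r v
  mem_c : ∀ j ≤ k, c j ∈ side T r v
  isEnd_b : IsEnd T (b (k + 2))
  isEnd_c : ∀ j ≤ k, IsEnd T (c j)
  fork : ∀ t ∈ side T r v, (T.neighborSet t).ncard = 3 → ∃ j ≤ k, t = b (j + 1)

theorem exists_isWholeLeg [Finite V] (hT : T.IsTree)
    (hdeg : ∀ v : V, (T.neighborSet v).ncard ≤ 3) {r v : V} (hr : T.Adj r v)
    (hrev : ¬PathSide T v r) (h : terminalCount T r v = 1) {k : ℕ} (hk : forkCount T r v = k + 1) :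
    ∃ b c, IsWholeLeg T r v k b c := by
  refine dart_induction hT (P := fun r v => ∀ k, ¬PathSide T v r → terminalCount T r v = 1 →
    forkCount T r v = k + 1 → ∃ b c, IsWholeLeg T r v k b c) ?_ r v hr k hrev h hk
  clear! r v k
  intro r v hr ih k hrev h hk
  rcases dart_cases hdeg hr with (⟨h3, hl⟩ | ⟨h3, w, hw, hwr, hu⟩) | ⟨w₁, w₂, hB⟩
  · have : PathSide T r v := by
      intro x hx
      rw [side_eq_of_leaf hT hr hl] at hx
      exact hx ▸ h3
    rw [← terminalCount_eq_zero_iff hT hr] at this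
    omega
  · obtain ⟨b, c, hbc⟩ := ih w hw hwr k (fun hp => hrev (hp.mono
      (side_subset_side hT hw.symm hr.symm hwr.symm)))
      (by rw [← terminalCount_of_unary hT hr hw hwr h3 hu, h])
      (by rw [← forkCount_of_unary hT hr hw hwr h3 hu, hk])
    have hs := side_subset_side hT hr hw hwr
    refine ⟨fun j => Nat.casesOn j r fun j => b (j + 1), c, rfl, ?_,
      fun j hj => hs (hbc.mem_b j hj), fun j hj => hs (hbc.mem_c j hj), hbc.isEnd_b,
      hbc.isEnd_c, ?_⟩
    · rintro (_ | j) hj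
      · have h1 := hs (hbc.mem_b 0 (by omega))
        refine (hbc.isLeg 0 (by omega)).extend hT ?_ ?_
        · rw [hbc.zero]
          exact btw_of_mem_side hT hr h1
        · intro h0
          exact root_notMem_side (h0 ▸ h1)
      · exact hbc.isLeg (j + 1) hj
    · intro t ht ht3
      rw [side_eq_of_unary hT hr hw hwr hu] at ht
      rcases ht with rfl | ht
      · exact absurd ht3 h3
      · exact hbc.fork t ht ht3
  · have h3 := (hB.claw hr).ncard
    have hs₁ := side_subset_side hT hr hB.adj₁ hB.ne₁
    have hs₂ := side_subset_side hT hr hB.adj₂ hB.ne₂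
    have hr' : r ∈ side T v r := self_mem_side hr.symm
    obtain ⟨t₁, ht₁, he₁⟩ := exists_isEnd hT hB.adj₁
    by_cases hv : IsTerminal T v
    · obtain ⟨h1, h2⟩ := (hB.isTerminal_iff hr hrev).1 hv
      have h0 : k = 0 := by
        have := hB.forkCount hT hr
        rw [forkCount_eq_zero h1, forkCount_eq_zero h2] at this
        omega
      subst h0
      obtain ⟨t₂, ht₂, he₂⟩ := exists_isEnd hT hB.adj₂
      have ht := tripod_of_sides hT hr.symm hB.adj₂ hB.adj₁ hB.ne₂.symm hB.ne₁.symm hB.ne.symm hr'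
        ht₂ ht₁
      refine ⟨fun j => Nat.casesOn j r fun j => Nat.casesOn j v fun _ => t₂, fun _ => t₁, rfl,
        ?_, ?_, fun _ _ => hs₁ ht₁, he₂, fun _ _ => he₁, ?_⟩
      · intro j hj
        obtain rfl : j = 0 := by omega
        exact ht
      · rintro (_ | _ | j) hj
        · exact self_mem_side hr
        · exact hs₂ ht₂
        · omega
      · intro t ht ht3
        rw [side_eq_of_branching hT hr hB] at ht
        rcases ht with rfl | ht | ht
        · exact ⟨0, le_rfl, rfl⟩
        · exact absurd ht3 (h1 t ht)
        · exact absurd ht3 (h2 t ht)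
    · have hsum := hB.terminalCount_of_not_terminal hT hr hv
      wlog h0 : terminalCount T v w₁ = 0 generalizing w₁ w₂ t₁
      · obtain ⟨t₂, ht₂, he₂⟩ := exists_isEnd hT hB.adj₂
        exact this w₂ w₁ hB.swap hs₂ hs₁ t₂ ht₂ he₂ (by omega) (by omega)
      have hp := (terminalCount_eq_zero_iff hT hB.adj₁).1 h0
      have hf := hB.forkCount hT hr
      rw [forkCount_eq_zero hp] at hf
      obtain ⟨k', hk'⟩ := exists_forkCount hT hB.adj₂ (by omega)
      obtain rfl : k = k' + 1 := by omega
      obtain ⟨b, c, hbc⟩ :=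
        ih w₂ hB.adj₂ hB.ne₂ k' (not_pathSide_of_ncard h3 hB.adj₂) (by omega) hk'
      refine ⟨fun j => Nat.casesOn j r b, fun j => Nat.casesOn j t₁ c, rfl, ?_, ?_, ?_,
        hbc.isEnd_b, ?_, ?_⟩
      · rintro (_ | j) hj
        · have := tripod_of_sides hT hr.symm hB.adj₂ hB.adj₁ hB.ne₂.symm hB.ne₁.symm hB.ne.symm hr'
            (hbc.mem_b 0 (by omega)) ht₁
          show Tripod T (b 0) r (b 1) t₁
          rwa [hbc.zero]
        · exact hbc.isLeg j (by omega)
      · rintro (_ | j) hj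
        · show b 0 ∈ side T r v
          rw [hbc.zero]
          exact self_mem_side hr
        · exact hs₂ (hbc.mem_b j (by omega))
      · rintro (_ | j) hj
        · exact hs₁ ht₁
        · exact hs₂ (hbc.mem_c j (by omega))
      · rintro (_ | j) hj
        · exact he₁
        · exact hbc.isEnd_c j (by omega)
      · intro t ht ht3
        rw [side_eq_of_branching hT hr hB] at ht
        rcases ht with rfl | ht | ht
        · exact ⟨0, by omega, hbc.zero.symm⟩
        · exact absurd ht3 (hp t ht)
        · obtain ⟨j, hj, rfl⟩ := hbc.fork t ht ht3
          exact ⟨j + 1, by omega, rfl⟩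

theorem branchSet_eq (hT : T.IsTree) {r v : V} (hr : T.Adj r v) :
    branchSet T r v = insert r (side T r v) := by
  ext t
  refine or_congr Iff.rfl ⟨fun h => ?_, fun h => ?_⟩
  · exact (side_iff_of_reachable hT hr (Set.mem_singleton _) h).1 (self_mem_side hr)
  · refine reachable_of_side_iff hT fun r' v' _ he => ?_
    rcases Sym2.eq_iff.1 he with ⟨rfl, rfl⟩ | ⟨rfl, rfl⟩
    · exact iff_of_true (self_mem_side hr) h
    · exact iff_of_false ((not_mem_side_iff hT hr.symm).2 (self_mem_side hr))
        ((not_mem_side_iff hT hr.symm).2 h)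

theorem branch_isTree (hT : T.IsTree) {r v : V} (hr : T.Adj r v) :
    (T.induce (branchSet T r v)).IsTree := by
  have key : ∀ m t (ht : t ∈ branchSet T r v), T.dist t r = m →
      (T.induce (branchSet T r v)).Reachable ⟨t, ht⟩ ⟨r, Or.inl rfl⟩ := by
    intro m
    induction m with
    | zero =>
      intro t ht h0
      obtain rfl := (dist_zero_iff hT).1 h0
      exact .refl _
    | succ m ih =>
      intro t ht hd
      have htr : t ≠ r := by rintro rfl; simp at hd
      obtain ⟨u, hu, hru⟩ := exists_step hT htr
      have hts : t ∈ side T r v := by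
        rw [branchSet_eq hT hr] at ht
        exact ht.resolve_left htr
      have hus : u ∈ branchSet T r v := by
        rw [branchSet_eq hT hr]
        by_contra hcon
        have := (eq_of_adj_of_side hT hr hu hts fun h => hcon (Or.inr h)).2
        exact hcon (Or.inl this)
      rw [mem_side_iff hT hu] at hru
      have h1 : (T.induce (branchSet T r v)).Adj ⟨t, ht⟩ ⟨u, hus⟩ := hu
      exact h1.reachable.trans (ih u hus (by omega))
  refine ⟨{ preconnected := fun x y => ?_, nonempty := ⟨⟨r, Or.inl rfl⟩⟩ }, hT.isAcyclic.induce _⟩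
  exact (key _ x.1 x.2 rfl).trans (key _ y.1 y.2 rfl).symm

theorem dist_induce {S : Set V} (hT : T.IsTree) (hS : (T.induce S).IsTree) (x y : S) :
    (T.induce S).dist x y = T.dist x.1 y.1 := by
  obtain ⟨p, hp, hpl⟩ := hS.connected.exists_path_of_dist x y
  rw [← hpl]
  have h1 := length_eq_dist hT (p.map (SimpleGraph.Embedding.induce S).toHom)
    (hp.map Subtype.val_injective)
  rw [SimpleGraph.Walk.length_map] at h1
  exact h1

theorem btw_induce {S : Set V} (hT : T.IsTree) (hS : (T.induce S).IsTree) {x y z : S} :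
    Btw (T.induce S) x y z ↔ Btw T x.1 y.1 z.1 := by
  unfold Btw
  rw [dist_induce hT hS, dist_induce hT hS, dist_induce hT hS]

theorem tripod_induce {S : Set V} (hT : T.IsTree) (hS : (T.induce S).IsTree) {o x y z : S}
    (h : Tripod T o.1 x.1 y.1 z.1) : Tripod (T.induce S) o x y z :=
  ⟨fun he => h.ne_x (congrArg _ he), fun he => h.ne_y (congrArg _ he),
    fun he => h.ne_z (congrArg _ he), (btw_induce hT hS).2 h.xy, (btw_induce hT hS).2 h.xz,
    (btw_induce hT hS).2 h.yz⟩

theorem caterpillar_adj_b {k : ℕ} {j : Fin (k + 3)} {a : QVertex k}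
    (h : (caterpillar k).Adj (.b j) a) :
    (∃ i : Fin (k + 3), a = .b i ∧ (i.1 + 1 = j.1 ∨ j.1 + 1 = i.1)) ∨
      ∃ i : Fin (k + 1), a = .c i ∧ i.1 + 1 = j.1 := by
  rcases ((SimpleGraph.fromRel_adj _ _ _).1 h).2 with h | h
  · cases h
    · exact Or.inl ⟨_, rfl, Or.inr (by simp)⟩
    · exact Or.inr ⟨_, rfl, by simp⟩
  · cases h
    exact Or.inl ⟨_, rfl, Or.inl (by simp)⟩

theorem caterpillar_adj_c {k : ℕ} {i : Fin (k + 1)} {a : QVertex k}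
    (h : (caterpillar k).Adj (.c i) a) : a = .b i.succ.castSucc := by
  rcases ((SimpleGraph.fromRel_adj _ _ _).1 h).2 with h | h
  · cases h
  · cases h; rfl

theorem caterpillar_adj_succ {k : ℕ} (j : Fin (k + 2)) :
    (caterpillar k).Adj (.b j.castSucc) (.b j.succ) :=
  (SimpleGraph.fromRel_adj _ _ _).2 ⟨by simp [Fin.ext_iff], Or.inl (.spine j)⟩

theorem caterpillar_adj_leaf {k : ℕ} (j : Fin (k + 1)) :
    (caterpillar k).Adj (.b j.succ.castSucc) (.c j) :=
  (SimpleGraph.fromRel_adj _ _ _).2 ⟨by simp, Or.inl (.pendant j)⟩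

theorem caterpillar_connected (k : ℕ) : (caterpillar k).Connected := by
  have hb : ∀ j (hj : j < k + 3), (caterpillar k).Reachable (.b ⟨j, hj⟩) (.b 0) := by
    intro j
    induction j with
    | zero => exact fun _ => .refl _
    | succ j ih =>
      exact fun hj => (caterpillar_adj_succ ⟨j, by omega⟩).symm.reachable.trans (ih (by omega))
  have hall : ∀ x, (caterpillar k).Reachable x (.b 0) := by
    rintro (j | j)
    · exact hb j.1 j.2
    · exact (caterpillar_adj_leaf j).symm.reachable.trans (hb _ _)
  exact { preconnected := fun x y => (hall x).trans (hall y).symm, nonempty := ⟨.b 0⟩ }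

/-- The position in the tree of the vertices of a caterpillar. -/
def legPosition (k : ℕ) (b c : ℕ → V) : QVertex k → V
  | .b j => b j
  | .c j => c j

theorem IsWholeLeg.branchHasOrder [Finite V] (hT : T.IsTree)
    (hdeg : ∀ v : V, (T.neighborSet v).ncard ≤ 3) {r v : V} (hr : T.Adj r v) {k : ℕ} {b c : ℕ → V}
    (h : IsWholeLeg T r v k b c) : BranchHasOrder T r v k := by
  have hS := branch_isTree hT hr
  have hmem : ∀ x, legPosition k b c x ∈ branchSet T r v := by
    rw [branchSet_eq hT hr]
    rintro (⟨_ | j, hj⟩ | j)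
    · exact Or.inl h.zero
    · exact Or.inr (h.mem_b j (by omega))
    · exact Or.inr (h.mem_c j.1 (by omega))
  set n : QVertex k → branchSet T r v := fun x => ⟨legPosition k b c x, hmem x⟩ with hnd
  have hinner : ∀ (j : ℕ) (hj : j ≤ k), Tripod T (b (j + 1)) (b j) (b (j + 2)) (c j) := h.isLeg
  -- The vertices adjacent to each vertex of the caterpillar.
  have hadj : ∀ (j : ℕ) (hj : j ≤ k) (a : QVertex k),
      (caterpillar k).Adj (.b ⟨j + 1, by omega⟩) a →
      a = .b ⟨j, by omega⟩ ∨ a = .b ⟨j + 2, by omega⟩ ∨ a = .c ⟨j, by omega⟩ := by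
    intro j hj a ha
    rcases caterpillar_adj_b ha with ⟨⟨i, hi⟩, rfl, h1 | h1⟩ | ⟨⟨i, hi⟩, rfl, h1⟩ <;>
      simp at h1 ⊢ <;> omega
  have hcases : ∀ x : QVertex k, x = .b 0 ∨ x = .b (Fin.last (k + 2)) ∨
      (∃ j : Fin (k + 1), x = .c j) ∨
      ∃ (j : ℕ) (hj : j ≤ k), x = .b ⟨j + 1, by omega⟩ := by
    rintro (⟨_ | j, hj⟩ | j)
    · exact Or.inl rfl
    · by_cases hjk : j = k + 1
      · subst hjk
        exact Or.inr (Or.inl rfl)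
      · exact Or.inr (Or.inr (Or.inr ⟨j, by omega, rfl⟩))
    · exact Or.inr (Or.inr (Or.inl ⟨j, rfl⟩))
  have hn : IsNodeMap (caterpillar k) (T.induce (branchSet T r v)) n := by
    refine isNodeMap_of_tripod (caterpillar_connected k) fun x => ?_
    rcases hcases x with rfl | rfl | ⟨j, rfl⟩ | ⟨j, hj, rfl⟩
    · refine Or.inl ⟨.b 1, fun he => ?_, fun a ha => ?_⟩
      · exact (hinner 0 (by omega)).ne_x (congrArg Subtype.val he).symm
      · rcases caterpillar_adj_b ha with ⟨⟨i, hi⟩, rfl, h1 | h1⟩ | ⟨⟨i, hi⟩, rfl, h1⟩ <;>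
          simp [Fin.ext_iff] at h1 ⊢
        omega
    · refine Or.inl ⟨.b ⟨k + 1, by omega⟩, fun he => ?_, fun a ha => ?_⟩
      · exact (hinner k le_rfl).ne_y (congrArg Subtype.val he).symm
      · rcases caterpillar_adj_b ha with ⟨⟨i, hi⟩, rfl, h1 | h1⟩ | ⟨⟨i, hi⟩, rfl, h1⟩ <;>
          simp [Fin.ext_iff] at h1 ⊢ <;> omega
    · exact Or.inl ⟨.b j.succ.castSucc, fun he => (hinner j.1 (by omega)).ne_z
        (congrArg Subtype.val he).symm, fun a => caterpillar_adj_c⟩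
    · exact Or.inr ⟨_, _, _, hadj j hj, tripod_induce hT hS (hinner j hj)⟩
  refine ⟨hn.subdivision hS, Subtype.ext h.zero, hn.spanning hS (caterpillar_adj_succ 0) ?_ ?_⟩
  · intro x y hy
    have hy' : T.Adj (legPosition k b c x) y.1 := hy
    suffices H : ∃ a, (caterpillar k).Adj x a ∧
        Btw T (legPosition k b c x) y.1 (legPosition k b c a) from
      H.imp fun a ha => ⟨ha.1, (btw_induce hT hS).2 ha.2⟩
    rcases hcases x with rfl | rfl | ⟨j, rfl⟩ | ⟨j, hj, rfl⟩
    · refine ⟨_, caterpillar_adj_succ 0, ?_⟩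
      have hy'' : T.Adj (b 0) y.1 := hy'
      rw [h.zero] at hy''
      have hys : y.1 ∈ side T r v := by
        exact ((branchSet_eq hT hr).subset y.2).resolve_left hy''.ne.symm
      show Btw T (b 0) y.1 (b 1)
      rw [h.zero, (eq_of_adj_of_side hT hr hy''.symm hys root_notMem_side).1]
      exact btw_of_mem_side hT hr (h.mem_b 0 (by omega))
    · exact ⟨_, (caterpillar_adj_succ (Fin.last (k + 1))).symm,
        h.isEnd_b.btw hT hy' (hinner k le_rfl).ne_y.symm⟩
    · exact ⟨_, (caterpillar_adj_leaf j).symm,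
        (h.isEnd_c j (by omega)).btw hT hy' (hinner j (by omega)).ne_z.symm⟩
    · obtain ⟨u₁, u₂, u₃, hC, h1, h2, h3⟩ := (hinner j hj).exists_claw hT (hdeg _)
      rcases hC.eq _ hy' with hyu | hyu | hyu <;> rw [hyu]
      · exact ⟨_, (caterpillar_adj_succ ⟨j, by omega⟩).symm, btw_of_mem_side hT hC.adj₁ h1⟩
      · exact ⟨_, caterpillar_adj_succ ⟨j + 1, by omega⟩, btw_of_mem_side hT hC.adj₂ h2⟩
      · exact ⟨_, caterpillar_adj_leaf ⟨j, by omega⟩, btw_of_mem_side hT hC.adj₃ h3⟩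
  · intro t ht u₁ u₂ u₃ h1 h2 h3
    have htr : t.1 ≠ r := fun he => ht (.b 0) (Subtype.ext (h.zero.trans he.symm))
    have hts : t.1 ∈ side T r v := by
      exact ((branchSet_eq hT hr).subset t.2).resolve_left htr
    have ht3 : (T.neighborSet t.1).ncard ≠ 3 := fun h3 => by
      obtain ⟨j, hj, he⟩ := h.fork t.1 hts h3
      exact ht (.b ⟨j + 1, by omega⟩) (Subtype.ext he.symm)
    rcases eq_of_adj_of_ncard_ne (hdeg t.1) ht3 h1 h2 h3 with h | h | h
    exacts [Or.inl (Subtype.ext h), Or.inr (Or.inl (Subtype.ext h)),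
      Or.inr (Or.inr (Subtype.ext h))]

/-- A caterpillar `Q_k` has only `k + 1` vertices of degree 3. -/
theorem BranchHasOrder.forkCount_le [Finite V] (hT : T.IsTree) {r v : V} (hr : T.Adj r v) {k : ℕ}
    (h : BranchHasOrder T r v k) : forkCount T r v ≤ k + 1 := by
  obtain ⟨f, -, hf⟩ := h
  have hS := branch_isTree hT hr
  have hbt : ∀ {a b : QVertex k} (hab : (caterpillar k).Adj a b) {t : branchSet T r v},
      t ∈ (f.path hab).support ↔ Btw (T.induce (branchSet T r v)) (f.node a) t (f.node b) := by
    intro a b hab t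
    exact mem_support_iff hS _ (f.isPath hab)
  have hsub : {x | (T.neighborSet x).ncard = 3} ∩ side T r v ⊆
      (fun j : Fin (k + 1) => (f.node (.b j.succ.castSucc)).1) '' Set.univ := by
    rintro t ⟨ht3, hts⟩
    obtain ⟨y₁, y₂, y₃, hC⟩ := exists_claw ht3
    have hmem : ∀ y, T.Adj t y → y ∈ branchSet T r v := by
      intro y hy
      rw [branchSet_eq hT hr]
      by_contra hcon
      exact hcon (Or.inl (eq_of_adj_of_side hT hr hy hts fun h => hcon (Or.inr h)).2)
    have htS : t ∈ branchSet T r v := by rw [branchSet_eq hT hr]; exact Or.inr hts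
    -- Every edge at `t` is on one of the paths of the subdivision.
    have hedge : ∀ y (hy : T.Adj t y), ∃ a b, (caterpillar k).Adj a b ∧
        Btw (T.induce (branchSet T r v)) (f.node a) ⟨t, htS⟩ (f.node b) ∧
        Btw (T.induce (branchSet T r v)) (f.node a) ⟨y, hmem y hy⟩ (f.node b) := by
      intro y hy
      have hadj : (T.induce (branchSet T r v)).Adj ⟨t, htS⟩ ⟨y, hmem y hy⟩ := hy
      obtain ⟨a, b, hab, he⟩ := hf.2 s(⟨t, htS⟩, ⟨y, hmem y hy⟩) hadj
      exact ⟨a, b, hab, (mem_edges_iff hS _ (f.isPath hab) hadj).1 he⟩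
    by_cases hn : ∃ x, f.node x = ⟨t, htS⟩
    · obtain ⟨x, hx⟩ := hn
      have hdir : ∀ y (hy : T.Adj t y), ∃ a, (caterpillar k).Adj x a ∧ Btw T t y (f.node a).1 := by
        intro y hy
        obtain ⟨a, b, hab, h1, h2⟩ := hedge y hy
        have h3 := f.node_mem hab x ((hbt hab).2 (hx ▸ h1))
        rcases h3 with rfl | rfl
        · refine ⟨b, hab, ?_⟩
          rw [hx, btw_induce hT hS] at h2
          exact h2
        · refine ⟨a, hab.symm, ?_⟩
          rw [hx, btw_induce hT hS] at h2
          exact h2.symm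
      obtain ⟨a₁, ha₁, hb₁⟩ := hdir y₁ hC.adj₁
      obtain ⟨a₂, ha₂, hb₂⟩ := hdir y₂ hC.adj₂
      obtain ⟨a₃, ha₃, hb₃⟩ := hdir y₃ hC.adj₃
      have hne : ∀ {y y' a a'}, T.Adj t y → T.Adj t y' → y ≠ y' → Btw T t y (f.node a).1 →
          Btw T t y' (f.node a').1 → a ≠ a' := by
        rintro y y' a a' hy hy' hne hb hb' rfl
        exact hne (step_unique hT hy hy' (mem_side_of_btw hy hb) (mem_side_of_btw hy' hb'))
      have h12 := hne hC.adj₁ hC.adj₂ hC.ne₁₂ hb₁ hb₂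
      have h13 := hne hC.adj₁ hC.adj₃ hC.ne₁₃ hb₁ hb₃
      have h23 := hne hC.adj₂ hC.adj₃ hC.ne₂₃ hb₂ hb₃
      -- A vertex of the caterpillar with three neighbours is one of `b 1, …, b (k + 1)`.
      rcases x with ⟨j, hj⟩ | j
      · by_cases hjk : 1 ≤ j ∧ j ≤ k + 1
        · refine ⟨⟨j - 1, by omega⟩, trivial, ?_⟩
          have : (Fin.succ (⟨j - 1, by omega⟩ : Fin (k + 1))).castSucc = ⟨j, hj⟩ := by
            ext; simp; omega
          simp only [this, hx]
        · exfalso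
          have hone : ∀ a, (caterpillar k).Adj (.b ⟨j, hj⟩) a → ∃ i : Fin (k + 3), a = .b i ∧
              i.1 = if j = 0 then 1 else k + 1 := by
            intro a ha
            rcases caterpillar_adj_b ha with ⟨i, rfl, h1⟩ | ⟨i, rfl, h1⟩
            · refine ⟨i, rfl, ?_⟩
              simp only at h1
              split_ifs <;> omega
            · simp only at h1
              omega
          obtain ⟨i₁, rfl, e₁⟩ := hone a₁ ha₁
          obtain ⟨i₂, rfl, e₂⟩ := hone a₂ ha₂
          exact h12 (congrArg QVertex.b (Fin.ext (e₁.trans e₂.symm)))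
      · exact absurd ((caterpillar_adj_c ha₁).trans (caterpillar_adj_c ha₂).symm) h12
    · exfalso
      push Not at hn
      obtain ⟨a, b, hab, h1, -⟩ := hedge y₁ hC.adj₁
      have hall : ∀ y (hy : T.Adj t y),
          Btw (T.induce (branchSet T r v)) (f.node a) ⟨y, hmem y hy⟩ (f.node b) := by
        intro y hy
        obtain ⟨a', b', hab', h1', h2'⟩ := hedge y hy
        by_cases hs : s(a, b) = s(a', b')
        · rcases Sym2.eq_iff.1 hs with ⟨rfl, rfl⟩ | ⟨rfl, rfl⟩
          · exact h2'
          · exact h2'.symm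
        · obtain ⟨x, hx⟩ := f.disjoint hab hab' hs _ ((hbt hab).2 h1) ((hbt hab').2 h1')
          exact absurd hx (hn x)
      obtain ⟨u, hu, hau⟩ := exists_step hS (hn a).symm
      obtain ⟨w, hw, hbw⟩ := exists_step hS (hn b).symm
      have hstep : ∀ y (hy : T.Adj t y), y = u.1 ∨ y = w.1 := by
        intro y hy
        have hadj : (T.induce (branchSet T r v)).Adj ⟨t, htS⟩ ⟨y, hmem y hy⟩ := hy
        have h2 := hall y hy
        rcases dist_adj_cases hS hadj (f.node a) with h3 | h3
        · left
          have h4 := (mem_side_iff hS hadj).2 h3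
          exact congrArg Subtype.val (step_unique hS hadj hu h4 hau)
        · right
          have h4 : f.node b ∈ side (T.induce (branchSet T r v)) ⟨t, htS⟩ ⟨y, hmem y hy⟩ := by
            rw [mem_side]
            have := (T.induce (branchSet T r v)).dist_comm (u := f.node a) (v := ⟨t, htS⟩)
            have := (T.induce (branchSet T r v)).dist_comm (u := f.node a) (v := ⟨y, hmem y hy⟩)
            unfold Btw at h1 h2
            omega
          exact congrArg Subtype.val (step_unique hS hadj hw h4 hbw)
      have := hC.ne₁₂
      have := hC.ne₁₃
      have := hC.ne₂₃
      rcases hstep _ hC.adj₁ with e₁ | e₁ <;> rcases hstep _ hC.adj₂ with e₂ | e₂ <;>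
        rcases hstep _ hC.adj₃ with e₃ | e₃ <;> simp_all
  calc forkCount T r v
      ≤ ((fun j : Fin (k + 1) => (f.node (.b j.succ.castSucc)).1) '' Set.univ).ncard :=
        Set.ncard_le_ncard hsub (Set.toFinite _)
    _ ≤ (Set.univ : Set (Fin (k + 1))).ncard := Set.ncard_image_le (Set.toFinite _)
    _ = k + 1 := by simp

end Leg

end GreedyTree

namespace GreedyTree

/-! ### Trees with five terminal vertices -/

section Five

variable {V : Type*} {T : SimpleGraph V}

theorem orders_comp (x : Fin 5 → ℕ) (σ : Equiv.Perm (Fin 5)) : orders (x ∘ σ) = orders x := by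
  unfold orders
  rw [← Multiset.map_map]
  congr 1
  exact congrArg Finset.val (Finset.map_univ_equiv σ)

theorem orders_cons (a b c d e : ℕ) : orders ![a, b, c, d, e] = {a, b, c, d, e} := rfl

/-- The minimal orders that are not among the admissible ones. -/
theorem orders_cases (x : Fin 5 → ℕ) :
    ((∃ x₁ x₂ : ℕ, orders x = {0, 0, 0, x₁, x₂}) ∨ ∃ x₁ : ℕ, orders x = {0, 0, 1, 1, x₁}) ∨
      ∃ y : Fin 5 → ℕ, (∀ i, y i ≤ x i) ∧
        (orders y = {0, 1, 1, 1, 1} ∨ orders y = {0, 0, 1, 2, 2}) := by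
  have hmono := Tuple.monotone_sort x
  rw [← orders_comp x (Tuple.sort x)]
  have hlift : ∀ y : Fin 5 → ℕ, (∀ i, y i ≤ (x ∘ Tuple.sort x) i) → ∃ y' : Fin 5 → ℕ,
      (∀ i, y' i ≤ x i) ∧ orders y' = orders y := fun y hy =>
    ⟨y ∘ (Tuple.sort x).symm, fun i => by simpa using hy ((Tuple.sort x).symm i), orders_comp _ _⟩
  generalize x ∘ Tuple.sort x = s at *
  have h01 : s 0 ≤ s 1 := hmono (by decide)
  have h12 : s 1 ≤ s 2 := hmono (by decide)
  have h23 : s 2 ≤ s 3 := hmono (by decide)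
  have h34 : s 3 ≤ s 4 := hmono (by decide)
  have hs : s = ![s 0, s 1, s 2, s 3, s 4] := by
    ext i; fin_cases i <;> rfl
  by_cases h2 : s 2 = 0
  · refine Or.inl (Or.inl ⟨s 3, s 4, ?_⟩)
    rw [hs, orders_cons]
    simp [show s 0 = 0 by omega, show s 1 = 0 by omega, h2]
  by_cases h1 : s 1 = 0
  · by_cases h3 : s 3 ≤ 1
    · refine Or.inl (Or.inr ⟨s 4, ?_⟩)
      rw [hs, orders_cons]
      simp [show s 0 = 0 by omega, h1, show s 2 = 1 by omega, show s 3 = 1 by omega]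
    · obtain ⟨y, hy, he⟩ := hlift ![0, 0, 1, 2, 2] (by
        intro i; fin_cases i <;> simp <;> omega)
      exact Or.inr ⟨y, hy, Or.inr (he.trans (orders_cons _ _ _ _ _))⟩
  · obtain ⟨y, hy, he⟩ := hlift ![0, 1, 1, 1, 1] (by
      intro i; fin_cases i <;> simp <;> omega)
    exact Or.inr ⟨y, hy, Or.inl (he.trans (orders_cons _ _ _ _ _))⟩

theorem Tripod.ncard [Finite V] (hT : T.IsTree) (hdeg : ∀ v : V, (T.neighborSet v).ncard ≤ 3)
    {o x y z : V} (h : Tripod T o x y z) : (T.neighborSet o).ncard = 3 := by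
  obtain ⟨a, b, c, hC, -⟩ := h.exists_claw hT (hdeg o)
  exact hC.ncard

theorem legAngle_mono : Monotone legAngle := by
  refine monotone_nat_of_le_succ fun k => ?_
  rw [legAngle_succ]
  linarith [legAngle_lt k]

/-- Two legs at `p` with terminal vertices account for two terminal vertices behind `eu`; if there
are no others, they form a fork. -/
theorem two_le_terminalCount [Finite V] (hT : T.IsTree)
    (hdeg : ∀ v : V, (T.neighborSet v).ncard ≤ 3) {e u p a b x y : V} (h : Tripod T p e x y)
    (hu : T.Adj e u) (hp : p ∈ side T e u) (ha : T.Adj p a) (hb : T.Adj p b) (hx : x ∈ side T p a)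
    (hy : y ∈ side T p b) (hca : terminalCount T p a ≠ 0) (hcb : terminalCount T p b ≠ 0) :
    2 ≤ terminalCount T e u ∧ (terminalCount T e u = 2 → Fork T e u p a b) := by
  obtain ⟨t, a', b', hC, he, hx', hy'⟩ := h.exists_claw hT (hdeg p)
  obtain rfl := step_unique hT ha hC.adj₂ hx hx'
  obtain rfl := step_unique hT hb hC.adj₃ hy hy'
  have h1 := hC.branching.terminalCount_le hT hC.adj₁.symm
  have h2 := terminalCount_mono
    (side_subset_of_btw hT hu hC.adj₁.symm hp (btw_of_mem_side hT hC.adj₁ he).symm)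
  exact ⟨by omega, fun h3 => ⟨hu, hp, ha, hb, hC.ne₂₃, fun he => h.xy.mem_side hT he hx,
    fun he => h.xz.mem_side hT he hy, h3, by omega, by omega⟩⟩

theorem snd_of_mem_side (hT : T.IsTree) {x y v : V} (p : T.Walk x y) (hp : p.IsPath)
    (hv : T.Adj x v) (hy : y ∈ side T x v) : p.snd = v := by
  have hnil : ¬p.Nil := fun h => root_notMem_side (h.eq ▸ hy)
  have h1 := p.adj_snd hnil
  exact step_unique hT h1 hv
    (mem_side_of_btw h1 ((mem_support_iff hT p hp).1 (p.getVert_mem_support 1))) hy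

theorem ContainsFiveCrabOfOrders.hasGreedyDrawing [Finite V] (hT : T.IsTree)
    (hdeg : ∀ v : V, (T.neighborSet v).ncard ≤ 3) (hn : {x | IsTerminal T x}.ncard = 5)
    {x : Fin 5 → ℕ} (h : ContainsFiveCrabOfOrders T x) (hx : 3 < ∑ i, (1 / 2 : ℝ) ^ x i) :
    HasGreedyDrawing T := by
  obtain ⟨l, m, f, hf⟩ := h
  have hc := f.isCrab hT
  have hadj : ∀ i, T.Adj (f.node (hub l m _ i)) (f.path (hub_adj l m _ i)).snd := fun i =>
    SimpleGraph.Walk.adj_snd fun h =>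
      (hub_adj l m (fun _ => 0) i).ne (f.node_injective h.eq)
  have hside : ∀ i, f.node (legNode l m _ i 1) ∈
      side T (f.node (hub l m _ i)) (f.path (hub_adj l m _ i)).snd := fun i =>
    mem_side_of_btw (hadj i) ((mem_support_iff hT _ (f.isPath _)).1
      (SimpleGraph.Walk.getVert_mem_support _ 1))
  have hcount : ∀ i, terminalCount T (f.node (hub l m _ i)) (f.path (hub_adj l m _ i)).snd ≠ 0 := by
    intro i h0
    rw [terminalCount_eq_zero_iff hT (hadj i)] at h0
    exact h0 _ (hside i) ((hc.leg i 0 le_rfl).ncard hT hdeg)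
  have hfork : ∀ i, ∃ k ≤ x i,
      forkCount T (f.node (hub l m _ i)) (f.path (hub_adj l m _ i)).snd = k + 1 := by
    intro i
    obtain ⟨k, hk⟩ := exists_forkCount hT (hadj i) (hcount i)
    have := (hf i).forkCount_le hT (hadj i)
    exact ⟨k, by omega, hk⟩
  choose k hkx hk using hfork
  obtain ⟨u₁, u₂, u₃, hC, h1, h2, h3⟩ := hc.centre.exists_claw hT (hdeg _)
  have hle := hC.terminalCount_le hT
  obtain ⟨c1, F1⟩ := two_le_terminalCount hT hdeg hc.left hC.adj₁ h1 (hadj 0) (hadj 1) (hside 0)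
    (hside 1) (hcount 0) (hcount 1)
  obtain ⟨c2, F2⟩ := two_le_terminalCount hT hdeg hc.right hC.adj₂ h2 (hadj 2) (hadj 3) (hside 2)
    (hside 3) (hcount 2) (hcount 3)
  have hu₃ := step_unique hT (hadj 4) hC.adj₃ (hside 4) h3
  have c3 := hcount 4
  have k4 := hk 4
  rw [hu₃] at c3 k4
  have c3' : terminalCount T (f.node .centre) u₃ ≠ 0 := c3
  refine hC.hasGreedyDrawing_of_forks hT hdeg (F1 (by omega)) (F2 (by omega)) (by omega) (hk 0)
    (hk 1) (hk 2) (hk 3) k4 ?_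
  have hs := (sum_legAngle_lt_iff x).2 hx
  rw [Fin.sum_univ_five] at hs
  linarith [legAngle_mono (hkx 0), legAngle_mono (hkx 1), legAngle_mono (hkx 2),
    legAngle_mono (hkx 3), legAngle_mono (hkx 4)]

/-- The centre of a tree with five terminal vertices. -/
theorem exists_centre_of_ncard_eq_five [Finite V] (hT : T.IsTree)
    (hdeg : ∀ v : V, (T.neighborSet v).ncard ≤ 3) (hn : {x | IsTerminal T x}.ncard = 5) :
    ∃ e u₁ u₂ u₃, Claw T e u₁ u₂ u₃ ∧ terminalCount T e u₁ = 2 ∧ terminalCount T e u₂ = 2 ∧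
      terminalCount T e u₃ = 1 := by
  obtain ⟨x, hx⟩ : {x | IsTerminal T x}.Nonempty := by
    rw [Set.nonempty_iff_ne_empty]
    intro h
    rw [h, Set.ncard_empty] at hn
    omega
  obtain ⟨r, v, hr, h3⟩ : ∃ r v, T.Adj r v ∧ 3 ≤ terminalCount T r v := by
    obtain ⟨-, w, -, -, hw, -⟩ := hx
    have := terminalCount_add_reverse hT hw
    by_cases h : 3 ≤ terminalCount T x w
    · exact ⟨x, w, hw, h⟩
    · exact ⟨w, x, hw.symm, by omega⟩
  obtain ⟨p, e, w₁, w₂, hp, hB, hpe, h1, h2⟩ := exists_centre hT hdeg hr h3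
  have hrev := terminalCount_add_reverse hT hp
  have hsum : terminalCount T p e = terminalCount T e w₁ + terminalCount T e w₂ := by
    by_cases he : IsTerminal T e
    · have h4 := hB.terminalCount_of_terminal hT hp he
      by_cases hps : PathSide T e p
      · have h5 := (terminalCount_eq_zero_iff hT hp.symm).2 hps
        obtain ⟨-, w, w', hne, hw, hw', hpw, hpw'⟩ := he
        rw [← terminalCount_eq_zero_iff hT hw] at hpw
        rw [← terminalCount_eq_zero_iff hT hw'] at hpw'
        rcases (hB.claw hp).eq w hw with rfl | rfl | rfl <;>
        rcases (hB.claw hp).eq w' hw' with rfl | rfl | rfl <;> first | exact absurd rfl hne | omega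
      · obtain ⟨h5, h6⟩ := (hB.isTerminal_iff hp hps).1 he
        rw [← terminalCount_eq_zero_iff hT hB.adj₁] at h5
        rw [← terminalCount_eq_zero_iff hT hB.adj₂] at h6
        omega
    · exact hB.terminalCount_of_not_terminal hT hp he
  have hC := hB.claw hp
  by_cases e1 : terminalCount T e w₁ = 1
  · exact ⟨e, w₂, p, w₁, hC.rotate.rotate, by omega, by omega, e1⟩
  by_cases e2 : terminalCount T e w₂ = 1
  · exact ⟨e, p, w₁, w₂, hC, by omega, by omega, e2⟩
  exact ⟨e, w₁, w₂, p, hC.rotate, by omega, by omega, by omega⟩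

theorem containsFiveCrabOfOrders_of_isCrab [Finite V] (hT : T.IsTree)
    (hdeg : ∀ v : V, (T.neighborSet v).ncard ≤ 3) {x : Fin 5 → ℕ} {e p q : V}
    {b c : Fin 5 → ℕ → V} {v : Fin 5 → V} (h : IsCrab T x e p q b c)
    (hv : ∀ i, T.Adj (b i 0) (v i)) (hl : ∀ i, IsWholeLeg T (b i 0) (v i) (x i) (b i) (c i)) :
    ContainsFiveCrabOfOrders T x := by
  have hn := (h.mono (k' := fun _ => 0) fun i => Nat.zero_le _).isNodeMap
  refine ⟨0, 0, hn.subdivision hT, fun i => ?_⟩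
  have hhub : (hn.subdivision hT).node (hub 0 0 _ i) = b i 0 := by
    obtain ⟨h0, h1, h2, h3, h4⟩ := h.root
    fin_cases i
    exacts [h0.symm, h1.symm, h2.symm, h3.symm, h4.symm]
  have hsnd : ((hn.subdivision hT).path (hub_adj 0 0 _ i)).snd = v i := by
    refine snd_of_mem_side hT _ ((hn.subdivision hT).isPath _) (hhub ▸ hv i) ?_
    rw [hhub]
    exact (hl i).mem_b 0 (by omega)
  rw [hsnd, hhub]
  exact (hl i).branchHasOrder hT hdeg (hv i)

theorem Fork.tripod [Finite V] (hT : T.IsTree) (hdeg : ∀ v : V, (T.neighborSet v).ncard ≤ 3)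
    {e u p a b x y : V} (h : Fork T e u p a b) (hx : x ∈ side T p a) (hy : y ∈ side T p b) :
    Tripod T p e x y := by
  obtain ⟨t, ht, hb, hB⟩ := h.exists_branching hT hdeg
  exact tripod_of_sides hT ht.symm hB.adj₁ hB.adj₂ hB.ne₁.symm hB.ne₂.symm hB.ne
    (mem_side_of_btw ht.symm hb.symm) hx hy

/-- A tree with five terminal vertices contains a five-crab whose legs consist of everything behind
their first edges. -/
theorem exists_isCrab [Finite V] (hT : T.IsTree)
    (hdeg : ∀ v : V, (T.neighborSet v).ncard ≤ 3) (hn : {x | IsTerminal T x}.ncard = 5) :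
    ∃ x e p q b c, IsCrab T x e p q b c ∧ ContainsFiveCrabOfOrders T x := by
  obtain ⟨e, u₁, u₂, u₃, hC, n1, n2, n3⟩ := exists_centre_of_ncard_eq_five hT hdeg hn
  obtain ⟨p, a₁, b₁, F1⟩ := exists_fork hT hdeg hC.adj₁ (hC.not_pathSide hC.adj₁) n1
  obtain ⟨q, a₂, b₂, F2⟩ := exists_fork hT hdeg hC.adj₂ (hC.not_pathSide hC.adj₂) n2
  have hp3 : (T.neighborSet p).ncard = 3 := by
    obtain ⟨t, ht, -, hB⟩ := F1.exists_branching hT hdeg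
    exact (hB.claw ht).ncard
  have hq3 : (T.neighborSet q).ncard = 3 := by
    obtain ⟨t, ht, -, hB⟩ := F2.exists_branching hT hdeg
    exact (hB.claw ht).ncard
  have hleg : ∀ i : Fin 5, ∃ k b c,
      IsWholeLeg T (![p, p, q, q, e] i) (![a₁, b₁, a₂, b₂, u₃] i) k b c := by
    have key : ∀ r v, T.Adj r v → (T.neighborSet r).ncard = 3 → terminalCount T r v = 1 →
        ∃ k b c, IsWholeLeg T r v k b c := by
      intro r v hr h3 h1
      obtain ⟨k, hk⟩ := exists_forkCount hT hr (by omega)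
      exact ⟨k, exists_isWholeLeg hT hdeg hr (not_pathSide_of_ncard h3 hr) h1 hk⟩
    intro i
    fin_cases i
    exacts [key _ _ F1.adj_left hp3 F1.count_left, key _ _ F1.adj_right hp3 F1.count_right,
      key _ _ F2.adj_left hq3 F2.count_left, key _ _ F2.adj_right hq3 F2.count_right,
      key _ _ hC.adj₃ hC.ncard n3]
  choose x b c hl using hleg
  have hcrab : IsCrab T x e p q b c := by
    refine ⟨⟨(hl 0).zero, (hl 1).zero, (hl 2).zero, (hl 3).zero, (hl 4).zero⟩,
      fun i => (hl i).isLeg, ?_, ?_, ?_⟩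
    · exact F1.tripod hT hdeg ((hl 0).mem_b 0 (by omega)) ((hl 1).mem_b 0 (by omega))
    · exact F2.tripod hT hdeg ((hl 2).mem_b 0 (by omega)) ((hl 3).mem_b 0 (by omega))
    · exact tripod_of_sides hT hC.adj₁ hC.adj₂ hC.adj₃ hC.ne₁₂ hC.ne₁₃ hC.ne₂₃ F1.mem F2.mem
        ((hl 4).mem_b 0 (by omega))
  refine ⟨x, e, p, q, b, c, hcrab, containsFiveCrabOfOrders_of_isCrab hT hdeg
    (v := ![a₁, b₁, a₂, b₂, u₃]) hcrab (fun i => ?_) fun i => ?_⟩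
  · rw [(hl i).zero]
    fin_cases i
    exacts [F1.adj_left, F1.adj_right, F2.adj_left, F2.adj_right, hC.adj₃]
  · have := hl i
    rwa [(hl i).zero]

end Five

end GreedyTree

theorem mainTheorem2 {V : Type*} [Fintype V] (T : SimpleGraph V) (hT : T.IsTree)
    (hdeg : ∀ v : V, (T.neighborSet v).ncard ≤ 3) :
    (GreedyTree.HasGreedyDrawing T ↔
      GreedyTree.tripleNumber T ≤ 4 ∨
      (GreedyTree.tripleNumber T = 5 ∧
        ∃ x : Fin 5 → ℕ, GreedyTree.ContainsFiveCrabOfOrders T x ∧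
          ((∃ x₁ x₂ : ℕ, GreedyTree.orders x = {0, 0, 0, x₁, x₂}) ∨
            (∃ x₁ : ℕ, GreedyTree.orders x = {0, 0, 1, 1, x₁})))) ∧
    (GreedyTree.HasGreedyDrawing T ↔
      GreedyTree.tripleNumber T ≤ 5 ∧
        ¬ GreedyTree.ContainsFiveCrabWith T {0, 1, 1, 1, 1} ∧
        ¬ GreedyTree.ContainsFiveCrabWith T {0, 0, 1, 2, 2}) := by
  have necessary : GreedyTree.HasGreedyDrawing T → GreedyTree.tripleNumber T ≤ 5 ∧
      ¬ GreedyTree.ContainsFiveCrabWith T {0, 1, 1, 1, 1} ∧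
      ¬ GreedyTree.ContainsFiveCrabWith T {0, 0, 1, 2, 2} := fun h =>
    ⟨h.tripleNumber_le hT hdeg, h.not_containsFiveCrabWith hT (by norm_num),
      h.not_containsFiveCrabWith hT (by norm_num)⟩
  have orders : (GreedyTree.tripleNumber T ≤ 5 ∧
      ¬ GreedyTree.ContainsFiveCrabWith T {0, 1, 1, 1, 1} ∧
      ¬ GreedyTree.ContainsFiveCrabWith T {0, 0, 1, 2, 2}) →
      GreedyTree.tripleNumber T ≤ 4 ∨
      (GreedyTree.tripleNumber T = 5 ∧
        ∃ x : Fin 5 → ℕ, GreedyTree.ContainsFiveCrabOfOrders T x ∧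
          ((∃ x₁ x₂ : ℕ, GreedyTree.orders x = {0, 0, 0, x₁, x₂}) ∨
            (∃ x₁ : ℕ, GreedyTree.orders x = {0, 0, 1, 1, x₁}))) := by
    rintro ⟨h5, hc1, hc2⟩
    by_cases h4 : GreedyTree.tripleNumber T ≤ 4
    · exact Or.inl h4
    have hn : GreedyTree.tripleNumber T = 5 := by omega
    obtain ⟨x, e, p, q, b, c, hcrab, hx⟩ :=
      GreedyTree.exists_isCrab hT hdeg (GreedyTree.tripleNumber_eq hT ▸ hn)
    refine Or.inr ⟨hn, x, hx, ?_⟩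
    rcases GreedyTree.orders_cases x with h | ⟨y, hy, h⟩
    · exact h
    · have hf := (hcrab.mono hy).isNodeMap.subdivision hT
      rcases h with h | h
      · exact absurd ⟨0, 0, y, h, ⟨hf⟩⟩ hc1
      · exact absurd ⟨0, 0, y, h, ⟨hf⟩⟩ hc2
  have sufficient : (GreedyTree.tripleNumber T ≤ 4 ∨
      (GreedyTree.tripleNumber T = 5 ∧
        ∃ x : Fin 5 → ℕ, GreedyTree.ContainsFiveCrabOfOrders T x ∧
          ((∃ x₁ x₂ : ℕ, GreedyTree.orders x = {0, 0, 0, x₁, x₂}) ∨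
            (∃ x₁ : ℕ, GreedyTree.orders x = {0, 0, 1, 1, x₁})))) →
      GreedyTree.HasGreedyDrawing T := by
    rw [GreedyTree.tripleNumber_eq hT]
    rintro (h4 | ⟨h5, x, hx, h⟩)
    · exact GreedyTree.hasGreedyDrawing_of_ncard_le_four hT hdeg h4
    · refine hx.hasGreedyDrawing hT hdeg h5 ?_
      rcases h with ⟨x₁, x₂, h⟩ | ⟨x₁, h⟩ <;> rw [GreedyTree.sum_eq_of_orders h]
      · have h1 : (0 : ℝ) < (1 / 2) ^ x₁ := by positivity
        have h2 : (0 : ℝ) < (1 / 2) ^ x₂ := by positivity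
        simp only [Multiset.insert_eq_cons, Multiset.map_cons, Multiset.map_singleton,
          Multiset.sum_cons, Multiset.sum_singleton]
        linarith
      · have h1 : (0 : ℝ) < (1 / 2) ^ x₁ := by positivity
        simp only [Multiset.insert_eq_cons, Multiset.map_cons, Multiset.map_singleton,
          Multiset.sum_cons, Multiset.sum_singleton]
        linarith
  exact ⟨⟨fun h => orders (necessary h), sufficient⟩, ⟨necessary, fun h => sufficient (orders h)⟩⟩
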